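/- For $N\ge 1$ and $\varepsilon>0$ let $\mathbb M_N=\{(v_1,\dots,v_N)\in\mathbb R^{3N}:\frac12\sum_k|v_k|^2=N\varepsilon\}$, the sphere $\mathbb S^{3N-1}_{\sqrt{2N\varepsilon}}$. For $N\ge 2$, $u\in\mathbb R^3$, $\varepsilon>\frac12|u|^2$ and $\varepsilon_0=\varepsilon-\frac12|u|^2$ let $\mathbb M'_N=\{(v_1,\dots,v_N):\sum_k v_k=Nu,\ \frac12\sum_k|v_k|^2=N\varepsilon\}$, a sphere $\mathbb S^{3N-4}_{\sqrt{2N\varepsilon_0}}$. Let $\Delta$ denote the Laplace–Beltrami operator of the sphere in question, and let $\sigma_N$ be its uniform probability measure. (1) Spectra. The spectrum of $-\Delta$ on $L^2(\mathbb M_N)$ is $\{\lambda_N^{(j)}\}_{j\ge0}$ with $\lambda_N^{(j)}=\frac{j(j+3N-2)}{2N\varepsilon}$; the spectrum of $-\Delta$ on $L^2(\mathbb M'_N)$ is $\{\lambda_N^{(j)}\}_{j\ge0}$ with $\lambda_N^{(j)}=\frac{j(j+3N-5)}{2N\varepsilon_0}$. In both cases $0=\lambda^{(0)}_N<\lambda^{(1)}_N<\cdots$,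 and every $\lambda^{(j)}_N$ is an eigenvalue with a smooth eigenfunction. For every $j$, as $N\to\infty$, $\lambda_N^{(j)}\to\frac{3j}{2\varepsilon}$, respectively $\lambda_N^{(j)}\to\frac{3j}{2\varepsilon_0}$, and every cluster point of a sequence of points $z_N$ of the $N$-th spectrum is one of these limits. There is $\delta>0$ such that for all $N\ge1$ (respectively $N\ge2$) the nonzero spectrum lies in $[\delta,\infty)$. (2) Relaxation of the limiting marginals. Put $(\bar\varepsilon,\bar u)=(\varepsilon,0)$ in the first case and $(\bar\varepsilon,\bar u)=(\varepsilon_0,u)$ in the second. For $n\ge 0$ let $f_M(v)=\prod_{k=1}^n\left(\frac{3}{4\pi\bar\varepsilon}\right)^{3/2}e^{-3|v_k-\bar u|^2/(4\bar\varepsilon)}$ on $\mathbb R^{3n}$. For every $N$ (with $N\ge 1$, respectively $N\ge2$) let $F^{(N)}(\cdot,t)$, $t\ge0$, be probability densities with respect to $\sigma_N$ on the sphere, invariant under permutations of the $N$ particles, in $L^2(\sigma_N)$, and solving $\partial_tF^{(N)}=\Delta F^{(N)}$ in the weak sense, i.e. $\frac{d}{dt}\int\varphi F^{(N)}d\sigma_N=\int(\Delta\varphi)F^{(N)}d\sigma_N$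 for all smooth $\varphi$ and all $t\ge0$ (one-sided derivative at $t=0$). Fix $n$ and suppose that the $n$-velocity marginals of $F^{(N)}(\cdot,0)$ converge weakly, as $N\to\infty$, to a measure with density $f_0\ge0$ such that $f_0/f_M\in L^2(f_M\,dv)$. Then there are nonnegative functions $f(\cdot,t)$, $t\ge0$, on $\mathbb R^{3n}$ with integral $1$ and with $f(\cdot,0)=f_0$, and coefficients $c_m$, $m\in\mathbb N_0^{3n}$, with $c_0=1$, such that for every $t\ge0$: the $n$-velocity marginals of $F^{(N)}(\cdot,t)$ converge weakly to $f(\cdot,t)\,dv$; $$f(\cdot,t)=f_M\sum_{m}c_m\,e^{-\frac{3|m|}{2\bar\varepsilon}t}H_m,$$ where $|m|$ is the sum of the entries of $m$, $H_m$ is the product of the Hermite polynomials of degrees $m_{k,a}$ in the variables $(v_{k,a}-\bar u_a)/\sqrt{2\bar\varepsilon/3}$, and the series for $f(\cdot,t)/f_M$ converges unconditionally in $L^2(f_M\,dv)$; and $$\Big\|\tfrac{f(\cdot,t)}{f_M}-1\Big\|_{L^2(f_M dv)}\le e^{-\frac{3}{2\bar\varepsilon}t}\Big\|\tfrac{f_0}{f_M}-1\Big\|_{L^2(f_M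 dv)},\qquad \|f(\cdot,t)-f_M\|_{L^1(dv)}\le e^{-\frac{3}{2\bar\varepsilon}t}\Big\|\tfrac{f_0}{f_M}-1\Big\|_{L^2(f_M dv)} .$$ -/

import Mathlib

open MeasureTheory Filter Topology
open scoped ContDiff BoundedContinuousFunction

noncomputable section

namespace VelocitySphere

/-- The space `ℝ³ᴺ` of `N`-velocities; `x (k, a)` is the `a`-th component of the velocity of
particle `k`. -/
abbrev Vel (N : ℕ) : Type := EuclideanSpace ℝ (Fin N × Fin 3)

/-- The energy `½ ∑ₖ |vₖ|²`. -/
def energy {N : ℕ} (x : Vel N) : ℝ := 1 / 2 * ∑ k : Fin N, ∑ a : Fin 3, x (k, a) ^ 2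

/-- The momentum `∑ₖ vₖ`. -/
def momentum {N : ℕ} (x : Vel N) : EuclideanSpace ℝ (Fin 3) :=
  WithLp.toLp 2 fun a => ∑ k : Fin N, x (k, a)

/-- The vector `(e_a, …, e_a)`, i.e. the gradient of the `a`-th momentum component. -/
def translation (N : ℕ) (a : Fin 3) : Vel N :=
  WithLp.toLp 2 fun p => if p.2 = a then 1 else 0

/-- A leaf of a foliation of (an open part of) `ℝ³ᴺ`: the leaf itself, its dimension, and the field
which assigns to each point the tangent space, at that point, of the leaf through it. -/
structure Leaf (N : ℕ) where
  carrier : Set (Vel N)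
  dim : ℝ
  tangent : Vel N → Submodule ℝ (Vel N)

/-- The manifold of constant energy `N ε`, the sphere of radius `√(2 N ε)` in `ℝ³ᴺ`; its tangent
space at `x` is the orthogonal complement of the gradient `x` of the energy. -/
def energyLeaf (N : ℕ) (ε : ℝ) : Leaf N where
  carrier := {x | energy x = N * ε}
  dim := 3 * N - 1
  tangent := fun x => (Submodule.span ℝ {x})ᗮ

/-- The manifold of constant momentum `N u` and constant energy `N ε`; its tangent space at `x` is
the orthogonal complement of the gradients of the energy and of the momentum components. -/
def energyMomentumLeaf (N : ℕ) (u : EuclideanSpace ℝ (Fin 3)) (ε : ℝ) : Leaf N where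
  carrier := {x | momentum x = (N : ℝ) • u ∧ energy x = N * ε}
  dim := 3 * N - 4
  tangent := fun x => (Submodule.span ℝ ({x} ∪ Set.range (translation N)))ᗮ

namespace Leaf

variable {N : ℕ}

/-- The uniform probability measure on the leaf: normalized surface (Hausdorff) measure. -/
def unif (M : Leaf N) : Measure (Vel N) :=
  ProbabilityTheory.cond (Measure.hausdorffMeasure M.dim) M.carrier

/-- The Laplace–Beltrami operator of the leaf, `Δ φ = ∇ · [P ∇ φ]`, where `P` is the orthogonal
projection onto the tangent space. At points of the leaf the value depends on `φ` only through its
restriction to the leaf. -/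
def laplacian (M : Leaf N) (φ : Vel N → ℝ) (x : Vel N) : ℝ :=
  LinearMap.trace ℝ (Vel N)
    (fderiv ℝ (fun y => (M.tangent y).starProjection (gradient φ y)) x : Vel N →ₗ[ℝ] Vel N)

/-- `l` is an eigenvalue of `-Δ`, with a smooth eigenfunction. -/
def IsEigenvalue (M : Leaf N) (l : ℝ) : Prop :=
  ∃ φ : Vel N → ℝ, ContDiff ℝ ∞ φ ∧ (∃ x ∈ M.carrier, φ x ≠ 0) ∧
    ∀ x ∈ M.carrier, -(M.laplacian φ x) = l * φ x

/-- `(-Δ - z) f = g` for `f, g ∈ L²(M; ℂ)`, where `Δ f` is taken in the sense of distributions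
on `M`. On a closed manifold this maximal realization of `-Δ` is the unique self-adjoint one. -/
def ResolventEq (M : Leaf N) (z : ℂ) (f g : Lp ℂ 2 M.unif) : Prop :=
  ∀ φ : Vel N → ℝ, ContDiff ℝ ∞ φ →
    ∫ x, f x * (((-(M.laplacian φ x) : ℝ) : ℂ) - z * (φ x : ℂ)) ∂M.unif
      = ∫ x, g x * (φ x : ℂ) ∂M.unif

/-- The spectrum of `-Δ` on `L²(M; ℂ)`: those `z` for which `-Δ - z` is not a bijection from its
domain onto `L²` (for a closed operator the inverse of such a bijection is bounded). -/
def spectrum (M : Leaf N) : Set ℂ :=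
  {z | ¬ ∀ g : Lp ℂ 2 M.unif, ∃! f : Lp ℂ 2 M.unif, M.ResolventEq z f g}

/-- Relabelling of the particles. -/
def permute (π : Equiv.Perm (Fin N)) (x : Vel N) : Vel N :=
  WithLp.toLp 2 fun p => x (π p.1, p.2)

/-- `F t`, `t ≥ 0`, are `S_N`-symmetric probability densities on the leaf (with respect to the
uniform probability measure) which lie in `L²` and evolve by the diffusion master equation
`∂ₜ F = Δ F`, tested against smooth functions; the derivative at `t = 0` is one-sided. -/
structure IsEnsemble (M : Leaf N) (F : ℝ → Vel N → ℝ) : Prop where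
  memLp : ∀ t, 0 ≤ t → MemLp (F t) 2 M.unif
  nonneg : ∀ t, 0 ≤ t → ∀ᵐ x ∂M.unif, 0 ≤ F t x
  mass : ∀ t, 0 ≤ t → ∫ x, F t x ∂M.unif = 1
  symmetric : ∀ t, 0 ≤ t → ∀ π : Equiv.Perm (Fin N), ∀ᵐ x ∂M.unif, F t (permute π x) = F t x
  master : ∀ φ : Vel N → ℝ, ContDiff ℝ ∞ φ → ∀ t, 0 ≤ t →
    HasDerivWithinAt (fun s => ∫ x, φ x * F s x ∂M.unif)
      (∫ x, M.laplacian φ x * F t x ∂M.unif) (Set.Ici 0) t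

/-- The velocities of the first `n` particles (only used for `n ≤ N`; padded by `0` otherwise). -/
def firstVel (n : ℕ) (x : Vel N) : Vel n :=
  WithLp.toLp 2 fun p => if h : (p.1 : ℕ) < N then x (⟨p.1, h⟩, p.2) else 0

/-- The `n`-velocity marginal distribution of the ensemble with density `F`. -/
def marginal (M : Leaf N) (n : ℕ) (F : Vel N → ℝ) : Measure (Vel n) :=
  (M.unif.withDensity fun x => ENNReal.ofReal (F x)).map (firstVel n)

end Leaf

/-- Weak convergence of the measures `μ N` to the measure with Lebesgue density `f`. -/
def TendstoDensity {n : ℕ} (μ : ℕ → Measure (Vel n)) (f : Vel n → ℝ) : Prop :=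
  ∀ φ : Vel n →ᵇ ℝ, Tendsto (fun N => ∫ v, φ v ∂(μ N)) atTop
    (𝓝 (∫ v, φ v ∂(volume.withDensity fun v => ENNReal.ofReal (f v))))

/-- The `n`-velocity Maxwellian with drift `u` and energy `ε` per particle in the frame moving
with velocity `u`. -/
def maxwellian (n : ℕ) (u : EuclideanSpace ℝ (Fin 3)) (ε : ℝ) (v : Vel n) : ℝ :=
  ∏ k : Fin n, ((3 / (4 * Real.pi * ε)) ^ (3 / 2 : ℝ) *
    Real.exp (-(3 / (4 * ε)) * ∑ a : Fin 3, (v (k, a) - u a) ^ 2))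

/-- The probability measure with density `maxwellian n u ε`. -/
def maxwellMeasure (n : ℕ) (u : EuclideanSpace ℝ (Fin 3)) (ε : ℝ) : Measure (Vel n) :=
  volume.withDensity fun v => ENNReal.ofReal (maxwellian n u ε v)

/-- Products of (probabilists') Hermite polynomials, one in each component of the `n` velocities,
centred at `u` and scaled by the standard deviation `√(2 ε / 3)` of the Maxwellian. -/
def hermiteProd {n : ℕ} (u : EuclideanSpace ℝ (Fin 3)) (ε : ℝ) (m : Fin n × Fin 3 → ℕ)
    (v : Vel n) : ℝ :=
  ∏ p, Polynomial.aeval ((v p - u p.2) / Real.sqrt (2 * ε / 3)) (Polynomial.hermite (m p))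

/-- `f = maxwellian * ∑ₘ c m * hermiteProd m`, where the series for `f / maxwellian` converges
unconditionally in `L²` of the Maxwellian measure. -/
def HasHermiteExpansion {n : ℕ} (u : EuclideanSpace ℝ (Fin 3)) (ε : ℝ)
    (c : (Fin n × Fin 3 → ℕ) → ℝ) (f : Vel n → ℝ) : Prop :=
  Tendsto (fun s : Finset (Fin n × Fin 3 → ℕ) =>
    eLpNorm (fun v => f v / maxwellian n u ε v - ∑ m ∈ s, c m * hermiteProd u ε m v) 2
      (maxwellMeasure n u ε)) atTop (𝓝 0)

/-- The number `j (j + 3 N - 2) / (2 N ε)`. -/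
def energyEigenvalue (ε : ℝ) (N j : ℕ) : ℝ :=
  (j : ℝ) * ((j : ℝ) + 3 * (N : ℝ) - 2) / (2 * (N : ℝ) * ε)

/-- The number `j (j + 3 N - 5) / (2 N ε₀)`. -/
def energyMomentumEigenvalue (ε₀ : ℝ) (N j : ℕ) : ℝ :=
  (j : ℝ) * ((j : ℝ) + 3 * (N : ℝ) - 5) / (2 * (N : ℝ) * ε₀)

/-- For every sequence of ensembles `F N`, `N ≥ N₀`, on the leaves `M N` and every `n`: if the
initial `n`-velocity marginals converge weakly to a density `f₀` with `f₀ / f_M ∈ L²(f_M)`, then at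
every time `t ≥ 0` the `n`-velocity marginals converge weakly to a probability density `f t`, whose
Hermite modes of degree `j` decay like `exp (-3 j t / (2 ε))`, and which approaches the Maxwellian
`f_M` (drift `u`, energy `ε`) at the exponential rate `3 / (2 ε)`. -/
def LimitMarginalsRelax (M : (N : ℕ) → Leaf N) (N₀ : ℕ) (u : EuclideanSpace ℝ (Fin 3))
    (ε : ℝ) : Prop :=
  ∀ (F : (N : ℕ) → ℝ → Vel N → ℝ), (∀ N, N₀ ≤ N → (M N).IsEnsemble (F N)) →
  ∀ (n : ℕ) (f₀ : Vel n → ℝ), (∀ v, 0 ≤ f₀ v) →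
    MemLp (fun v => f₀ v / maxwellian n u ε v) 2 (maxwellMeasure n u ε) →
    TendstoDensity (fun N => (M N).marginal n (F N 0)) f₀ →
  ∃ (f : ℝ → Vel n → ℝ) (c : (Fin n × Fin 3 → ℕ) → ℝ), f 0 = f₀ ∧ c 0 = 1 ∧
    ∀ t : ℝ, 0 ≤ t →
      (∀ v, 0 ≤ f t v) ∧ Integrable (f t) ∧ ∫ v, f t v = 1 ∧
      MemLp (fun v => f t v / maxwellian n u ε v) 2 (maxwellMeasure n u ε) ∧
      TendstoDensity (fun N => (M N).marginal n (F N t)) (f t) ∧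
      HasHermiteExpansion u ε
        (fun m => c m * Real.exp (-(3 * ((∑ p, m p : ℕ) : ℝ) / (2 * ε)) * t)) (f t) ∧
      eLpNorm (fun v => f t v / maxwellian n u ε v - 1) 2 (maxwellMeasure n u ε)
        ≤ ENNReal.ofReal (Real.exp (-(3 / (2 * ε)) * t)) *
          eLpNorm (fun v => f₀ v / maxwellian n u ε v - 1) 2 (maxwellMeasure n u ε) ∧
      eLpNorm (fun v => f t v - maxwellian n u ε v) 1 volume
        ≤ ENNReal.ofReal (Real.exp (-(3 / (2 * ε)) * t)) *
          eLpNorm (fun v => f₀ v / maxwellian n u ε v - 1) 2 (maxwellMeasure n u ε)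

/-- For `N ≥ N₀` the spectrum of `-Δ` on `M N` consists of the eigenvalues
`ev N 0 < ev N 1 < ev N 2 < …`; as `N → ∞` the `j`-th eigenvalue converges to `3 j / (2 ε)`, no other
point is approached by the spectra, and the nonzero spectrum stays uniformly away from `0`. -/
def SpectraConverge (M : (N : ℕ) → Leaf N) (N₀ : ℕ) (ev : ℕ → ℕ → ℝ) (ε : ℝ) : Prop :=
  (∀ N, N₀ ≤ N → (M N).spectrum = Set.range (fun j : ℕ => ((ev N j : ℝ) : ℂ)) ∧
    (∀ j, (M N).IsEigenvalue (ev N j)) ∧ ev N 0 = 0 ∧ StrictMono (ev N)) ∧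
  (∀ j : ℕ, Tendsto (fun N => ev N j) atTop (𝓝 (3 * (j : ℝ) / (2 * ε)))) ∧
  (∀ z : ℕ → ℂ, (∀ N, N₀ ≤ N → z N ∈ (M N).spectrum) → ∀ w : ℂ, MapClusterPt w atTop z →
    ∃ j : ℕ, w = ((3 * (j : ℝ) / (2 * ε) : ℝ) : ℂ)) ∧
  (∃ δ : ℝ, 0 < δ ∧ ∀ N, N₀ ≤ N → ∀ z ∈ (M N).spectrum, z ≠ 0 → δ ≤ z.re)

end VelocitySphere

end

/-! Both manifolds are round spheres of radius `R = √(2Nε̄)` in a translate `c + W` of a subspace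
`W`, with `c ⟂ W` and `dim W = 3N` or `3N - 3`. Nearly everything is proved once for such spheres
(`IsSphereLeaf`). There the Laplacian is `R⁻²` times the sum of the squared rotation fields over the
coordinate planes of `W` (`laplacian_eq_lapSphere`). Rotations preserve the uniform measure, so each
field is antisymmetric and the Laplacian is symmetric (`integral_lapSphere_mul`).

Spectrum. On polynomials in one linear coordinate `⟨ξ, x⟩`, minus the Laplacian is triangular with
respect to the degree, with diagonal entries `j(j + dim W - 2)/R²`. So there is one eigenpolynomial
in each degree, and these span all polynomials. An integrable function on the sphere orthogonal to
all of them has vanishing moments in every direction, hence is zero (`ae_eq_zero_of_orthogonal`).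
The eigenspaces therefore form a Hilbert sum, and the resolvent equation is solved componentwise off
the eigenvalues (`spectrum_eq`). Since `R² = 2Nε̄` and `dim W ~ 3N`, the `j`-th eigenvalue tends to
`3j/(2ε̄)`; the bound `j/(2ε̄)` from below, uniform in `N`, excludes other cluster points and gives
the gap.

Relaxation. On functions of finitely many velocities the Laplacian approaches the Ornstein–Uhlenbeck
operator with drift rate `κ = 3/(2ε̄)`, which moves a plane wave of frequency `ξ` to frequency
`e^{-κt}ξ` with Gaussian damping. A plane wave with exactly this moving frequency and amplitude is
inserted as a time dependent test function in the master equation on the sphere. The error is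
controlled by a second moment, which permutation symmetry and the energy constraint bound uniformly
in `N` (`abs_integral_cos_sub_le`), and it vanishes as `N → ∞`. So the characteristic functions of
the marginals converge, and the limit is the Fourier transform of the Mehler semigroup applied to
`f₀ / f_M` (`fourierMaxwell_mehler`). That semigroup multiplies Hermite modes of degree `j` by
`e^{-κjt}`, which gives the expansion and the `L²` rate; the `L¹` rate follows because the
Maxwellian is a probability measure. Positivity holds because the transform is that of a convolution
of positive measures (`mehler_nonneg`). Lévy's theorem turns this into weak convergence. -/

noncomputable section

namespace VelocitySphere

/-! ### Functions determined by their Fourier transform or by their moments. -/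

section Determinacy

variable {E : Type*} [NormedAddCommGroup E] [InnerProductSpace ℝ E] [FiniteDimensional ℝ E]
  [MeasurableSpace E] [BorelSpace E]

/-- An integrable function whose Fourier transform vanishes is zero almost everywhere. -/
lemma ae_eq_zero_of_integral_exp_inner_eq_zero {μ : Measure E} {f : E → ℝ}
    (hf : Integrable f μ)
    (h : ∀ ξ : E, ∫ x, Complex.exp ((inner ℝ x ξ : ℝ) * Complex.I) * (f x : ℂ) ∂μ = 0) :
    f =ᵐ[μ] 0 := by
  have hm := hf.1.aemeasurable
  have hmn : AEMeasurable (fun x => -f x) μ := hm.neg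
  have h1 : ∫⁻ x, ENNReal.ofReal (f x) ∂μ ≠ ⊤ := hf.lintegral_lt_top.ne
  have h2 : ∫⁻ x, ENNReal.ofReal (-f x) ∂μ ≠ ⊤ := hf.neg.lintegral_lt_top.ne
  have : IsFiniteMeasure (μ.withDensity fun x => ENNReal.ofReal (f x)) :=
    isFiniteMeasure_withDensity h1
  have : IsFiniteMeasure (μ.withDensity fun x => ENNReal.ofReal (-f x)) :=
    isFiniteMeasure_withDensity h2
  have hint : ∀ ξ : E, ∀ g : E → ℝ, Integrable g μ →
      Integrable (fun x => g x • Complex.exp ((inner ℝ x ξ : ℝ) * Complex.I)) μ := by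
    intro ξ g hg
    refine hg.norm.mono' (hg.1.smul (Continuous.aestronglyMeasurable (by fun_prop))) ?_
    filter_upwards with x
    simp [Complex.norm_exp_ofReal_mul_I]
  -- The positive and negative parts of `f` are densities of finite measures; the hypothesis says
  -- that their characteristic functions agree.
  have key : (μ.withDensity fun x => ENNReal.ofReal (f x))
      = μ.withDensity fun x => ENNReal.ofReal (-f x) := by
    refine Measure.ext_of_charFun (funext fun ξ => ?_)
    rw [charFun_apply, charFun_apply,
      integral_withDensity_eq_integral_toReal_smul₀ hm.ennreal_ofReal
        (ae_of_all _ fun _ => ENNReal.ofReal_lt_top),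
      integral_withDensity_eq_integral_toReal_smul₀ hmn.ennreal_ofReal
        (ae_of_all _ fun _ => ENNReal.ofReal_lt_top), ← sub_eq_zero, ← integral_sub]
    · rw [← h ξ]
      congr 1 with x
      rw [← sub_smul, ENNReal.toReal_ofReal', ENNReal.toReal_ofReal', Complex.real_smul, mul_comm]
      congr 2
      exact max_zero_sub_max_neg_zero_eq_self (f x)
    · exact hint ξ _ (by simpa only [ENNReal.toReal_ofReal'] using hf.pos_part)
    · exact hint ξ _ (by simpa only [ENNReal.toReal_ofReal', Pi.neg_apply] using hf.neg.pos_part)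
  rw [withDensity_eq_iff hm.ennreal_ofReal hmn.ennreal_ofReal h1] at key
  filter_upwards [key] with x hx
  have := congrArg ENNReal.toReal hx
  rw [ENNReal.toReal_ofReal', ENNReal.toReal_ofReal'] at this
  have h3 := max_zero_sub_max_neg_zero_eq_self (f x)
  rw [this, sub_self] at h3
  exact h3.symm

/-- A function with exponential moments, all of whose moments vanish, is zero almost everywhere. -/
lemma ae_eq_zero_of_integral_inner_pow_eq_zero {μ : Measure E} {f : E → ℝ}
    (hf : AEStronglyMeasurable f μ)
    (hexp : ∀ ξ : E, Integrable (fun x => Real.exp |inner ℝ x ξ| * |f x|) μ)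
    (h : ∀ (ξ : E) (k : ℕ), ∫ x, (inner ℝ x ξ : ℝ) ^ k * f x ∂μ = 0) : f =ᵐ[μ] 0 := by
  have hfi : Integrable f μ := by
    refine (hexp 0).mono' hf ?_
    filter_upwards with x
    simp
  refine ae_eq_zero_of_integral_exp_inner_eq_zero hfi fun ξ => ?_
  -- The exponential series is integrated term by term against `f`; the absolute values sum to the
  -- exponential weight in `hexp`.
  have hs := hasSum_integral_of_dominated_convergence (μ := μ)
    (F := fun (k : ℕ) x => (((inner ℝ x ξ : ℝ) * Complex.I) ^ k / (k.factorial : ℂ)) * (f x : ℂ))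
    (f := fun x => Complex.exp ((inner ℝ x ξ : ℝ) * Complex.I) * (f x : ℂ))
    (fun k x => |(inner ℝ x ξ : ℝ)| ^ k / (k.factorial : ℝ) * |f x|) ?_ ?_ ?_ ?_ ?_
  · refine hs.unique ?_
    convert hasSum_zero using 1
    ext k
    have : ∀ x, ((((inner ℝ x ξ : ℝ) * Complex.I) ^ k / (k.factorial : ℂ)) * (f x : ℂ))
        = (Complex.I ^ k / (k.factorial : ℂ)) * (((inner ℝ x ξ : ℝ) ^ k * f x : ℝ) : ℂ) := by
      intro x; push_cast; ring
    simp_rw [this]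
    rw [integral_const_mul, integral_complex_ofReal, h ξ k]
    simp
  · intro k
    refine AEStronglyMeasurable.mul (Continuous.aestronglyMeasurable (by fun_prop)) ?_
    exact Complex.continuous_ofReal.comp_aestronglyMeasurable hf
  · intro k
    filter_upwards with x
    simp
  · filter_upwards with x
    exact (Real.summable_pow_div_factorial _).mul_right _
  · convert hexp ξ using 2 with x
    rw [tsum_mul_right, Real.exp_eq_exp_ℝ, NormedSpace.exp_eq_tsum_div]
  · filter_upwards with x
    refine HasSum.mul_right _ ?_
    rw [Complex.exp_eq_exp_ℂ]
    exact NormedSpace.expSeries_div_hasSum_exp _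

end Determinacy

/-! ### The Laplacian of a sphere as a sum of squares of rotation fields. -/

section SphereLaplacian

variable {E : Type*} [NormedAddCommGroup E] [InnerProductSpace ℝ E]

/-- The vector field generating rotations in the plane spanned by `a` and `b`. -/
def rotField (a b x : E) : E := inner ℝ a x • b - inner ℝ b x • a

/-- Derivative of `φ` along the rotation in the plane spanned by `a` and `b`. -/
def angular (a b : E) (φ : E → ℝ) (x : E) : ℝ := fderiv ℝ φ x (rotField a b x)

lemma contDiff_angular (a b : E) {φ : E → ℝ} (hφ : ContDiff ℝ ∞ φ) :
    ContDiff ℝ ∞ (angular a b φ) := by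
  have h1 : ContDiff ℝ ∞ (fderiv ℝ φ) := hφ.fderiv_right le_rfl
  have h2 : ContDiff ℝ ∞ (rotField a b) :=
    ((innerSL ℝ a).contDiff.smul contDiff_const).sub ((innerSL ℝ b).contDiff.smul contDiff_const)
  exact h1.clm_apply h2

/-- The rotation field is linear in `x`, so its derivative along itself is the field applied twice.
This is the first order term. -/
lemma angular_angular (a b : E) {φ : E → ℝ} (hφ : ContDiff ℝ ∞ φ) (x : E) :
    angular a b (angular a b φ) x
      = fderiv ℝ (fderiv ℝ φ) x (rotField a b x) (rotField a b x)
        + fderiv ℝ φ x (rotField a b (rotField a b x)) := by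
  have h1 : HasFDerivAt (fderiv ℝ φ) (fderiv ℝ (fderiv ℝ φ) x) x :=
    ((hφ.fderiv_right (m := ∞) le_rfl).differentiable (by simp) x).hasFDerivAt
  have h2 : HasFDerivAt (rotField a b)
      ((innerSL ℝ a).smulRight b - (innerSL ℝ b).smulRight a) x := by
    exact ((innerSL ℝ a).hasFDerivAt.smul_const b).sub ((innerSL ℝ b).hasFDerivAt.smul_const a)
  have h3 := (h1.clm_apply h2).fderiv
  rw [angular]
  unfold angular
  rw [h3]
  simp [rotField]
  ring

variable [FiniteDimensional ℝ E]

/-- The Laplace-Beltrami operator of the spheres of radius `R` in the translates of a subspace `W`,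
as a differential operator on the whole space. -/
def lapSphere (W : Submodule ℝ E) (R : ℝ) (φ : E → ℝ) (x : E) : ℝ :=
  (1 / (2 * R ^ 2)) * ∑ i, ∑ j, angular (stdOrthonormalBasis ℝ W i : E)
    (stdOrthonormalBasis ℝ W j : E) (angular (stdOrthonormalBasis ℝ W i : E)
    (stdOrthonormalBasis ℝ W j : E) φ) x

/-- This is the advantage of the rotation form: its coefficients are polynomial, so the result is
smooth on the whole space and can serve again as a test function, whereas the tangential projection
is singular where `W.starProjection x = 0`. -/
lemma contDiff_lapSphere (W : Submodule ℝ E) (R : ℝ) {φ : E → ℝ} (hφ : ContDiff ℝ ∞ φ) :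
    ContDiff ℝ ∞ (lapSphere W R φ) := by
  unfold lapSphere
  refine contDiff_const.mul (ContDiff.sum fun i _ => ContDiff.sum fun j _ => ?_)
  exact contDiff_angular _ _ (contDiff_angular _ _ hφ)

lemma starProjection_eq_sum (W : Submodule ℝ E) (x : E) :
    W.starProjection x = ∑ i, (inner ℝ (stdOrthonormalBasis ℝ W i : E) x : ℝ) •
      (stdOrthonormalBasis ℝ W i : E) := by
  have := congrArg (Subtype.val) ((stdOrthonormalBasis ℝ W).sum_repr' (W.orthogonalProjectionOnto x))
  rw [Submodule.starProjection_apply, ← this]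
  simp only [AddSubmonoidClass.coe_finsetSum, Submodule.coe_smul]
  refine Finset.sum_congr rfl fun i _ => ?_
  congr 1
  exact Submodule.inner_orthogonalProjectionOnto_eq_of_mem_left _ _

lemma inner_stdOrthonormalBasis (W : Submodule ℝ E) (i j) :
    (inner ℝ (stdOrthonormalBasis ℝ W i : E) (stdOrthonormalBasis ℝ W j : E) : ℝ)
      = if i = j then 1 else 0 := by
  rw [← Submodule.coe_inner]
  exact orthonormal_iff_ite.1 (stdOrthonormalBasis ℝ W).orthonormal i j

/-- With `a i = ⟨b i, x⟩`, square the field `a i ∂ⱼ - a j ∂ᵢ` and sum over ordered pairs. The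
diagonal terms use `∑ a i ² = R²`, the mixed ones give the Hessian in the radial direction, and each
plane occurs twice, which the factor `1/2` compensates. -/
lemma lapSphere_eq (W : Submodule ℝ E) {R : ℝ} (hR : 0 < R) {φ : E → ℝ} (hφ : ContDiff ℝ ∞ φ)
    {x : E} (hx : ‖W.starProjection x‖ = R) :
    lapSphere W R φ x
      = ∑ i, fderiv ℝ (fderiv ℝ φ) x (stdOrthonormalBasis ℝ W i : E) (stdOrthonormalBasis ℝ W i : E)
        - (fderiv ℝ (fderiv ℝ φ) x (W.starProjection x) (W.starProjection x)
          + (Module.finrank ℝ W - 1) * fderiv ℝ φ x (W.starProjection x)) / R ^ 2 := by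
  set b : Fin (Module.finrank ℝ W) → E := fun i => (stdOrthonormalBasis ℝ W i : E) with hb
  set a : Fin (Module.finrank ℝ W) → ℝ := fun i => inner ℝ (b i) x with ha
  set w := W.starProjection x with hw
  have hbb : ∀ i j, (inner ℝ (b i) (b j) : ℝ) = if i = j then 1 else 0 :=
    inner_stdOrthonormalBasis W
  have hwsum : w = ∑ i, a i • b i := starProjection_eq_sum W x
  have hsq : ∑ i, a i * a i = R ^ 2 := by
    rw [← hx, ← real_inner_self_eq_norm_sq]
    nth_rw 1 [hwsum]
    rw [sum_inner]
    refine Finset.sum_congr rfl fun i _ => ?_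
    rw [real_inner_smul_left, hwsum, inner_sum]
    simp [real_inner_smul_right, hbb]
  set H := fderiv ℝ (fderiv ℝ φ) x with hH
  set D := fderiv ℝ φ x with hD
  have hterm : ∀ i j, angular (b i) (b j) (angular (b i) (b j) φ) x
      = a i * a i * H (b j) (b j) + a j * a j * H (b i) (b i)
        - a i * a j * H (b i) (b j) - a i * a j * H (b j) (b i)
        + ((if i = j then a i else 0) * D (b j) - a j * D (b j) - a i * D (b i)
          + (if i = j then a j else 0) * D (b i)) := by
    intro i j
    rw [angular_angular _ _ hφ]
    have e1 : rotField (b i) (b j) x = a i • b j - a j • b i := rfl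
    have e2 : rotField (b i) (b j) (rotField (b i) (b j) x)
        = ((if i = j then a i else 0) - a j) • b j - (a i - (if i = j then a j else 0)) • b i := by
      rw [e1, rotField, inner_sub_right, inner_sub_right]
      simp only [real_inner_smul_right, hbb, eq_comm (a := j) (b := i)]
      simp
    rw [e2, e1]
    simp only [map_sub, map_smul, smul_eq_mul, FunLike.coe_sub, Pi.sub_apply,
      FunLike.coe_smul, Pi.smul_apply]
    ring
  have hHw : H w w = ∑ i, ∑ j, a i * a j * H (b i) (b j) := by
    rw [hwsum]
    simp only [map_sum, map_smul, smul_eq_mul, FunLike.coe_sum, Finset.sum_apply,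
      FunLike.coe_smul, Pi.smul_apply, Finset.mul_sum, mul_assoc]
    rw [Finset.sum_comm]
    refine Finset.sum_congr rfl fun i _ => Finset.sum_congr rfl fun j _ => ?_
    ring
  have hDw : D w = ∑ i, a i * D (b i) := by
    rw [hwsum]; simp [map_sum, map_smul, smul_eq_mul]
  have hHw' : H w w = ∑ i, ∑ j, a i * a j * H (b j) (b i) := by
    rw [hHw, Finset.sum_comm]
    refine Finset.sum_congr rfl fun i _ => Finset.sum_congr rfl fun j _ => ?_
    ring
  rw [lapSphere]
  change 1 / (2 * R ^ 2) * ∑ i, ∑ j, angular (b i) (b j) (angular (b i) (b j) φ) x = _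
  simp_rw [hterm]
  simp only [Finset.sum_add_distrib, Finset.sum_sub_distrib]
  rw [← hHw, ← hHw']
  have s1 : ∑ i, ∑ j, a i * a i * H (b j) (b j) = R ^ 2 * ∑ j, H (b j) (b j) := by
    rw [← hsq, Finset.sum_mul_sum]
  have s2 : ∑ i, ∑ j, a j * a j * H (b i) (b i) = R ^ 2 * ∑ j, H (b j) (b j) := by
    rw [← s1, Finset.sum_comm]
  have s3 : ∑ i, ∑ j, (if i = j then a i else 0) * D (b j) = D w := by
    rw [hDw]; simp
  have s4 : ∑ i, ∑ j, (if i = j then a j else 0) * D (b i) = D w := by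
    rw [hDw]; simp
  have s5 : ∑ i : Fin (Module.finrank ℝ W), ∑ j, a j * D (b j)
      = Module.finrank ℝ W * D w := by
    rw [hDw]; simp
  have s6 : ∑ i, ∑ _j : Fin (Module.finrank ℝ W), a i * D (b i)
      = Module.finrank ℝ W * D w := by
    rw [hDw]; simp [Finset.mul_sum]
  rw [s1, s2, s3, s4, s5, s6]
  field_simp
  ring

/-- The divergence of the tangential gradient of `φ`, for the foliation of the translates of `W`
by concentric spheres. -/
lemma trace_fderiv_tangential_gradient (W : Submodule ℝ E) {φ : E → ℝ} (hφ : ContDiff ℝ ∞ φ)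
    {x : E} (hx : W.starProjection x ≠ 0) :
    LinearMap.trace ℝ E (fderiv ℝ (fun y => W.starProjection (gradient φ y)
        - (inner ℝ (W.starProjection y) (gradient φ y) / ‖W.starProjection y‖ ^ 2 : ℝ) •
          W.starProjection y) x : E →ₗ[ℝ] E)
      = ∑ i, fderiv ℝ (fderiv ℝ φ) x (stdOrthonormalBasis ℝ W i : E) (stdOrthonormalBasis ℝ W i : E)
        - (fderiv ℝ (fderiv ℝ φ) x (W.starProjection x) (W.starProjection x)
          + (Module.finrank ℝ W - 1) * fderiv ℝ φ x (W.starProjection x))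
            / ‖W.starProjection x‖ ^ 2 := by
  set P := W.starProjection with hP
  have hgrad : ∀ y v, (inner ℝ v (gradient φ y) : ℝ) = fderiv ℝ φ y v := by
    intro y v
    rw [← toDual_gradient, InnerProductSpace.toDual_apply_apply, real_inner_comm]
  have hD1 : ContDiff ℝ ∞ (fderiv ℝ φ) := hφ.fderiv_right le_rfl
  have h1 : HasFDerivAt (fderiv ℝ φ) (fderiv ℝ (fderiv ℝ φ) x) x :=
    (hD1.differentiable (by simp) x).hasFDerivAt
  set H := fderiv ℝ (fderiv ℝ φ) x with hH
  set G : E →L[ℝ] E :=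
    ((InnerProductSpace.toDual ℝ E).symm.toContinuousLinearEquiv.toContinuousLinearMap).comp H
  have hG : HasFDerivAt (gradient φ) G x :=
    ((InnerProductSpace.toDual ℝ E).symm.toContinuousLinearEquiv.toContinuousLinearMap).hasFDerivAt.comp
      x h1
  have hGi : ∀ v u, (inner ℝ u (G v) : ℝ) = H v u := by
    intro v u
    rw [real_inner_comm]
    exact InnerProductSpace.toDual_symm_apply
  have hq : HasFDerivAt (fun y => (fderiv ℝ φ y (P y) / ‖P y‖ ^ 2 : ℝ))
      ((‖P x‖ ^ 2 * ‖P x‖ ^ 2)⁻¹ • (‖P x‖ ^ 2 • ((fderiv ℝ φ x).comp P + H.flip (P x))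
        - fderiv ℝ φ x (P x) • ((2 : ℝ) • (innerSL ℝ (P x)).comp P))) x := by
    have e1 := h1.clm_apply P.hasFDerivAt
    have e2 : HasFDerivAt (fun y => ‖P y‖ ^ 2) ((2 : ℝ) • (innerSL ℝ (P x)).comp P) x := by
      convert P.hasFDerivAt.norm_sq using 1
      ext v
      simp
    have hne : ‖P x‖ ^ 2 ≠ 0 := by positivity
    have := e1.mul ((hasDerivAt_inv hne).comp_hasFDerivAt x e2)
    simp only [div_eq_mul_inv]
    refine this.congr_fderiv ?_
    ext v
    simp
    field_simp
    ring
  set q' := ((‖P x‖ ^ 2 * ‖P x‖ ^ 2)⁻¹ • (‖P x‖ ^ 2 • ((fderiv ℝ φ x).comp P + H.flip (P x))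
        - fderiv ℝ φ x (P x) • ((2 : ℝ) • (innerSL ℝ (P x)).comp P))) with hq'
  have hfun : (fun y => P (gradient φ y) - (inner ℝ (P y) (gradient φ y) / ‖P y‖ ^ 2 : ℝ) • P y)
      = fun y => P (gradient φ y) - (fderiv ℝ φ y (P y) / ‖P y‖ ^ 2) • P y := by
    ext1 y; rw [hgrad]
  have hfd := (((P.hasFDerivAt).comp x hG).sub (hq.smul P.hasFDerivAt)).fderiv
  rw [hfun]
  have hfd' : fderiv ℝ (fun y => P (gradient φ y) - (fderiv ℝ φ y (P y) / ‖P y‖ ^ 2) • P y) x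
      = P.comp G - ((fderiv ℝ φ x (P x) / ‖P x‖ ^ 2) • P + q'.smulRight (P x)) := hfd
  rw [hfd']
  have tP : LinearMap.trace ℝ E (P : E →ₗ[ℝ] E) = Module.finrank ℝ W := by
    have : (P : E →ₗ[ℝ] E) = W.subtype ∘ₗ (W.orthogonalProjectionOnto : E →ₗ[ℝ] W) := rfl
    rw [this, LinearMap.trace_comp_comm']
    have : (W.orthogonalProjectionOnto : E →ₗ[ℝ] W) ∘ₗ W.subtype = LinearMap.id := by
      ext v; simp
    rw [this, LinearMap.trace_id]
  have tG : LinearMap.trace ℝ E ((P.comp G : E →L[ℝ] E) : E →ₗ[ℝ] E)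
      = ∑ i, H (stdOrthonormalBasis ℝ W i : E) (stdOrthonormalBasis ℝ W i : E) := by
    have : ((P.comp G : E →L[ℝ] E) : E →ₗ[ℝ] E)
      = W.subtype ∘ₗ ((W.orthogonalProjectionOnto : E →ₗ[ℝ] W) ∘ₗ (G : E →ₗ[ℝ] E)) := rfl
    rw [this, LinearMap.trace_comp_comm', LinearMap.trace_eq_sum_inner _ (stdOrthonormalBasis ℝ W)]
    refine Finset.sum_congr rfl fun i _ => ?_
    rw [← hGi]
    exact Submodule.inner_orthogonalProjectionOnto_eq_of_mem_left _ _
  -- The derivative of the radial coefficient enters through a rank one map, so only its value in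
  -- the radial direction contributes to the trace.
  have tq : LinearMap.trace ℝ E ((q'.smulRight (P x) : E →L[ℝ] E) : E →ₗ[ℝ] E) = q' (P x) := by
    exact LinearMap.trace_smulRight _ _
  have hPP : P (P x) = P x := Submodule.starProjection_eq_self_iff.2 (Submodule.starProjection_apply_mem _ _)
  have hne : ‖P x‖ ≠ 0 := norm_ne_zero_iff.2 hx
  have hqx : q' (P x) = (H (P x) (P x) - fderiv ℝ φ x (P x)) / ‖P x‖ ^ 2 := by
    rw [hq']
    simp [hPP]
    field_simp
    ring
  rw [ContinuousLinearMap.toLinearMap_sub, ContinuousLinearMap.toLinearMap_add, map_sub, map_add,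
    ContinuousLinearMap.toLinearMap_smul, map_smul, tP, tG, tq, hqx]
  simp only [smul_eq_mul]
  field_simp
  ring

end SphereLaplacian

/-! ### The unit sphere has finite and positive Hausdorff measure. -/

section HausdorffSphere

open Module

variable {E : Type*} [NormedAddCommGroup E] [InnerProductSpace ℝ E] [FiniteDimensional ℝ E]

lemma finrank_orthogonal_singleton {v : E} (hv : ‖v‖ = 1) :
    (finrank ℝ (Submodule.span ℝ {v})ᗮ : ℝ) = finrank ℝ E - 1 := by
  have hv0 : v ≠ 0 := by rintro rfl; simp at hv
  have h1 := (Submodule.span ℝ {v}).finrank_add_finrank_orthogonal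
  rw [finrank_span_singleton hv0] at h1
  rw [← h1]
  push_cast
  ring

variable [MeasurableSpace E] [BorelSpace E]

/-- The half sphere `⟨v, x⟩ ≤ 0` is contained in the image of a ball in the hyperplane `v⟂` under
inverse stereographic projection from `v`, which is Lipschitz on compact sets. The radius `2`
suffices since the projection multiplies by `2 / (1 - ⟨v, x⟩) ≤ 2`. Two opposite halves cover the
sphere. -/
lemma hausdorffMeasure_unitSphere_lt_top [Nontrivial E] :
    μH[(finrank ℝ E : ℝ) - 1] (Metric.sphere (0 : E) 1) < ⊤ := by
  obtain ⟨v, hv⟩ := exists_norm_eq E zero_le_one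
  have hpos : (0 : ℝ) ≤ (finrank ℝ E : ℝ) - 1 := by
    have : 1 ≤ finrank ℝ E := finrank_pos
    have : (1 : ℝ) ≤ finrank ℝ E := by exact_mod_cast this
    linarith
  have half : ∀ v : E, ‖v‖ = 1 →
      μH[(finrank ℝ E : ℝ) - 1] {x ∈ Metric.sphere (0 : E) 1 | inner ℝ v x ≤ (0 : ℝ)} < ⊤ := by
    intro v hv
    set K := (Submodule.span ℝ {v})ᗮ with hK
    set B : Set K := Metric.closedBall 0 2
    have hlip : LocallyLipschitz (fun w : K => stereoInvFunAux v (w : E)) := by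
      refine ContDiff.locallyLipschitz (𝕂 := ℝ) ?_
      exact contDiff_stereoInvFunAux.comp K.subtypeL.contDiff
    obtain ⟨C, hC⟩ := (hlip.locallyLipschitzOn (s := B)).exists_lipschitzOnWith_of_compact
      (isCompact_closedBall _ _)
    have hsub : {x ∈ Metric.sphere (0 : E) 1 | inner ℝ v x ≤ (0 : ℝ)}
        ⊆ (fun w : K => stereoInvFunAux v (w : E)) '' B := by
      rintro x ⟨hx, hvx⟩
      have hxv : x ≠ v := by
        rintro rfl
        rw [real_inner_self_eq_norm_sq, hv] at hvx
        norm_num at hvx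
      refine ⟨stereoToFun v x, ?_, ?_⟩
      · rw [mem_closedBall_zero_iff, stereoToFun_apply, norm_smul]
        have h1 : ‖(Submodule.span ℝ {v})ᗮ.orthogonalProjectionOnto x‖ ≤ 1 := by
          refine (Submodule.norm_orthogonalProjectionOnto_apply_le _ x).trans ?_
          exact (mem_sphere_zero_iff_norm.1 hx).le
        have h2 : ‖(2 / (1 - innerSL ℝ v x) : ℝ)‖ ≤ 2 := by
          rw [innerSL_apply_apply, Real.norm_eq_abs, abs_div, abs_of_pos (by linarith : (0:ℝ) < 1 - inner ℝ v x), div_le_iff₀ (by linarith)]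
          norm_num
          linarith
        calc _ ≤ (2 : ℝ) * 1 := mul_le_mul h2 h1 (norm_nonneg _) (by norm_num)
          _ = 2 := by norm_num
      · have := congrArg Subtype.val (stereo_left_inv hv (x := ⟨x, hx⟩) hxv)
        exact this
    refine (measure_mono hsub).trans_lt ?_
    refine (hC.hausdorffMeasure_image_le hpos).trans_lt ?_
    refine ENNReal.mul_lt_top (ENNReal.rpow_lt_top_of_nonneg hpos ENNReal.coe_ne_top) ?_
    rw [← finrank_orthogonal_singleton hv]
    exact (isCompact_closedBall _ _).measure_lt_top
  refine (measure_mono (t := {x ∈ Metric.sphere (0 : E) 1 | inner ℝ v x ≤ (0 : ℝ)} ∪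
    {x ∈ Metric.sphere (0 : E) 1 | inner ℝ (-v) x ≤ (0 : ℝ)}) ?_).trans_lt ?_
  · intro x hx
    rcases le_total (inner ℝ v x : ℝ) 0 with h | h
    · exact Or.inl ⟨hx, h⟩
    · exact Or.inr ⟨hx, by rw [inner_neg_left]; linarith⟩
  · exact measure_union_lt_top (half v hv) (half (-v) (by rwa [norm_neg]))

/-- Orthogonal projection onto a hyperplane does not increase Hausdorff measure, and the image of
the sphere contains the open unit ball of the hyperplane. -/
lemma hausdorffMeasure_unitSphere_pos [Nontrivial E] :
    0 < μH[(finrank ℝ E : ℝ) - 1] (Metric.sphere (0 : E) 1) := by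
  obtain ⟨v, hv⟩ := exists_norm_eq E zero_le_one
  set K := (Submodule.span ℝ {v})ᗮ with hK
  have hfr := finrank_orthogonal_singleton hv
  rw [← hfr]
  refine lt_of_lt_of_le ?_ (hausdorffMeasure_orthogonalProjectionOnto_le K _ _ (Nat.cast_nonneg _))
  refine lt_of_lt_of_le (Metric.measure_ball_pos _ (0 : K) one_pos) (measure_mono ?_)
  intro w hw
  rw [mem_ball_zero_iff] at hw
  have hw1 : 0 ≤ 1 - ‖w‖ ^ 2 := by nlinarith [norm_nonneg w]
  have hwv : inner ℝ (w : E) v = (0 : ℝ) := Submodule.mem_orthogonal_singleton_iff_inner_left.1 w.2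
  refine ⟨w + √(1 - ‖w‖ ^ 2) • v, ?_, ?_⟩
  · rw [mem_sphere_zero_iff_norm, ← sq_eq_sq₀ (norm_nonneg _) zero_le_one, norm_add_sq_real,
      real_inner_smul_right, hwv, norm_smul, hv, mul_one, Real.norm_eq_abs, sq_abs,
      Real.sq_sqrt hw1, Submodule.coe_norm]
    ring
  · rw [map_add, map_smul, Submodule.orthogonalProjectionOnto_mem_subspace_eq_self,
      Submodule.orthogonalProjectionOnto_orthogonal_apply_eq_zero (Submodule.mem_span_singleton_self v)]
    simp

end HausdorffSphere

/-! ### Geometry and uniform measure of a sphere in an affine subspace. -/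

section SphereLeaf

open Module

/-- The leaf `M` is the sphere of radius `R` about `c` in the affine subspace `c + W`, where `c` is
orthogonal to `W`, foliated by concentric spheres. -/
structure IsSphereLeaf {N : ℕ} (M : Leaf N) (W : Submodule ℝ (Vel N)) (c : Vel N) (R : ℝ) :
    Prop where
  radius_pos : 0 < R
  center_mem : c ∈ Wᗮ
  three_le : 3 ≤ finrank ℝ W
  carrier_eq : M.carrier = {x | x - W.starProjection x = c ∧ ‖W.starProjection x‖ = R}
  dim_eq : M.dim = finrank ℝ W - 1
  tangent_eq : ∀ y, M.tangent y = W ⊓ (Submodule.span ℝ {W.starProjection y})ᗮ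

namespace IsSphereLeaf

variable {N : ℕ} {M : Leaf N} {W : Submodule ℝ (Vel N)} {c : Vel N} {R : ℝ}

lemma mem_carrier (h : IsSphereLeaf M W c R) {x : Vel N} :
    x ∈ M.carrier ↔ x - W.starProjection x = c ∧ ‖W.starProjection x‖ = R := by
  rw [h.carrier_eq]; rfl

lemma starProjection_tangent (h : IsSphereLeaf M W c R) (y v : Vel N) :
    (M.tangent y).starProjection v = W.starProjection v
      - (inner ℝ (W.starProjection y) v / ‖W.starProjection y‖ ^ 2 : ℝ) • W.starProjection y := by
  have hyW : W.starProjection y ∈ W := Submodule.starProjection_apply_mem _ _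
  have hinner : ∀ w ∈ W, inner ℝ (v - W.starProjection v) w = (0 : ℝ) := fun w hw =>
    Submodule.starProjection_inner_eq_zero v w hw
  have hyv : (inner ℝ (W.starProjection y) (W.starProjection v) : ℝ)
      = inner ℝ (W.starProjection y) v := by
    have := hinner _ hyW
    rw [inner_sub_left, sub_eq_zero] at this
    rw [real_inner_comm, ← this, real_inner_comm]
  refine Submodule.eq_starProjection_of_mem_of_inner_eq_zero ?_ ?_
  · rw [h.tangent_eq]
    refine ⟨W.sub_mem (Submodule.starProjection_apply_mem _ _) (W.smul_mem _ hyW), ?_⟩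
    rw [SetLike.mem_coe, Submodule.mem_orthogonal_singleton_iff_inner_right, inner_sub_right,
      real_inner_smul_right, real_inner_self_eq_norm_sq, hyv]
    rcases eq_or_ne (W.starProjection y) 0 with h0 | h0
    · simp [h0]
    · have : ‖W.starProjection y‖ ≠ 0 := norm_ne_zero_iff.2 h0
      field_simp
      ring
  · intro w hw
    rw [h.tangent_eq] at hw
    have h2 : inner ℝ (W.starProjection y) w = (0 : ℝ) :=
      Submodule.mem_orthogonal_singleton_iff_inner_right.1 hw.2
    rw [show v - (W.starProjection v
      - (inner ℝ (W.starProjection y) v / ‖W.starProjection y‖ ^ 2 : ℝ) • W.starProjection y)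
      = (v - W.starProjection v)
      + (inner ℝ (W.starProjection y) v / ‖W.starProjection y‖ ^ 2 : ℝ) • W.starProjection y by abel,
      inner_add_left, hinner w hw.1, real_inner_smul_left, h2]
    simp

lemma starProjection_ne_zero (h : IsSphereLeaf M W c R) {x : Vel N} (hx : x ∈ M.carrier) :
    W.starProjection x ≠ 0 := by
  rw [← norm_ne_zero_iff, (h.mem_carrier.1 hx).2]
  exact h.radius_pos.ne'

/-- The divergence form and the rotation form reduce to the same expression in the Hessian and the
gradient at points with `‖W.starProjection x‖ = R`. -/
lemma laplacian_eq_lapSphere (h : IsSphereLeaf M W c R) {φ : Vel N → ℝ} (hφ : ContDiff ℝ ∞ φ)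
    {x : Vel N} (hx : x ∈ M.carrier) : M.laplacian φ x = lapSphere W R φ x := by
  rw [Leaf.laplacian]
  simp_rw [h.starProjection_tangent]
  rw [trace_fderiv_tangential_gradient W hφ (h.starProjection_ne_zero hx),
    lapSphere_eq W h.radius_pos hφ (h.mem_carrier.1 hx).2, (h.mem_carrier.1 hx).2]

lemma norm_sq_eq (h : IsSphereLeaf M W c R) {x : Vel N} (hx : x ∈ M.carrier) :
    ‖x‖ ^ 2 = ‖c‖ ^ 2 + R ^ 2 := by
  obtain ⟨h1, h2⟩ := h.mem_carrier.1 hx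
  have h3 : inner ℝ (W.starProjection x) c = (0 : ℝ) :=
    h.center_mem _ (Submodule.starProjection_apply_mem _ _)
  have h4 : x = W.starProjection x + c := by rw [← h1]; abel
  rw [h4, norm_add_sq_real, h3, h2]
  ring

/-- Replacing the norm of the `W`-component by the full norm makes invariance under isometries of
the whole space visible. -/
lemma mem_carrier_iff_norm (h : IsSphereLeaf M W c R) {x : Vel N} :
    x ∈ M.carrier ↔ x - W.starProjection x = c ∧ ‖x‖ ^ 2 = ‖c‖ ^ 2 + R ^ 2 := by
  refine ⟨fun hx => ⟨(h.mem_carrier.1 hx).1, h.norm_sq_eq hx⟩, fun ⟨h1, h2⟩ => ?_⟩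
  refine h.mem_carrier.2 ⟨h1, ?_⟩
  have h3 : inner ℝ (W.starProjection x) c = (0 : ℝ) :=
    h.center_mem _ (Submodule.starProjection_apply_mem _ _)
  have h4 : x = W.starProjection x + c := by rw [← h1]; abel
  rw [h4, norm_add_sq_real, h3] at h2
  rw [← sq_eq_sq₀ (norm_nonneg _) h.radius_pos.le]
  linarith

lemma isCompact_carrier (h : IsSphereLeaf M W c R) : IsCompact M.carrier := by
  refine Metric.isCompact_of_isClosed_isBounded ?_ ?_
  · rw [h.carrier_eq]
    refine IsClosed.inter ?_ ?_
    · exact isClosed_eq (by fun_prop) continuous_const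
    · exact isClosed_eq (by fun_prop) continuous_const
  · refine (Metric.isBounded_closedBall (x := (0 : Vel N)) (r := √(‖c‖ ^ 2 + R ^ 2))).subset ?_
    intro x hx
    rw [mem_closedBall_zero_iff, ← h.norm_sq_eq hx, Real.sqrt_sq (norm_nonneg _)]

lemma measurableSet_carrier (h : IsSphereLeaf M W c R) : MeasurableSet M.carrier :=
  h.isCompact_carrier.measurableSet

lemma add_smul_mem_carrier (h : IsSphereLeaf M W c R) {w : Vel N} (hw : w ∈ W) (hw1 : ‖w‖ = 1) :
    c + R • w ∈ M.carrier := by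
  have h1 : W.starProjection c = 0 := (Submodule.starProjection_apply_eq_zero_iff W).2 h.center_mem
  have h2 : W.starProjection w = w := Submodule.starProjection_eq_self_iff.2 hw
  refine h.mem_carrier.2 ?_
  rw [map_add, map_smul, h1, h2, zero_add, norm_smul, hw1, Real.norm_eq_abs,
    abs_of_pos h.radius_pos]
  simp

lemma nontrivial (h : IsSphereLeaf M W c R) : Nontrivial W :=
  Module.nontrivial_of_finrank_pos (R := ℝ) (by have := h.three_le; omega)

lemma dim_nonneg (h : IsSphereLeaf M W c R) : 0 ≤ M.dim := by
  rw [h.dim_eq]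
  have : (3 : ℝ) ≤ finrank ℝ W := by exact_mod_cast h.three_le
  linarith

/-- The leaf lies in a dilated and translated copy of the unit sphere of `W`, the image of a
Lipschitz map. -/
lemma hausdorffMeasure_carrier_ne_top (h : IsSphereLeaf M W c R) : μH[M.dim] M.carrier ≠ ⊤ := by
  have := h.nontrivial
  have hsub : M.carrier ⊆ (fun w : W => c + R • (w : Vel N)) '' Metric.sphere 0 1 := by
    intro x hx
    obtain ⟨h1, h2⟩ := h.mem_carrier.1 hx
    refine ⟨R⁻¹ • ⟨W.starProjection x, Submodule.starProjection_apply_mem _ _⟩, ?_, ?_⟩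
    · rw [mem_sphere_zero_iff_norm, norm_smul, Submodule.coe_norm, h2, norm_inv, Real.norm_eq_abs,
        abs_of_pos h.radius_pos, inv_mul_cancel₀ h.radius_pos.ne']
    · simp only [Submodule.coe_smul, smul_smul]
      rw [mul_inv_cancel₀ h.radius_pos.ne', one_smul, ← h1]
      abel
  have hlip : LipschitzWith (Real.toNNReal R) (fun w : W => c + R • (w : Vel N)) := by
    refine LipschitzWith.of_dist_le_mul fun v w => ?_
    rw [dist_add_left, dist_smul₀, Real.norm_eq_abs, abs_of_pos h.radius_pos,
      Real.coe_toNNReal _ h.radius_pos.le]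
    rfl
  refine ((measure_mono hsub).trans_lt
    ((hlip.hausdorffMeasure_image_le h.dim_nonneg _).trans_lt ?_)).ne
  refine ENNReal.mul_lt_top (ENNReal.rpow_lt_top_of_nonneg h.dim_nonneg ENNReal.coe_ne_top) ?_
  rw [h.dim_eq]
  exact hausdorffMeasure_unitSphere_lt_top

/-- The Lipschitz map `R⁻¹` times the projection to `W` sends the leaf onto the unit sphere, which
has positive measure. -/
lemma hausdorffMeasure_carrier_ne_zero (h : IsSphereLeaf M W c R) : μH[M.dim] M.carrier ≠ 0 := by
  have := h.nontrivial
  intro h0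
  have hlip := (ContinuousLinearMap.lipschitz (R⁻¹ • W.orthogonalProjectionOnto))
  have hsub : Metric.sphere (0 : W) 1 ⊆ (R⁻¹ • W.orthogonalProjectionOnto) '' M.carrier := by
    intro w hw
    rw [mem_sphere_zero_iff_norm] at hw
    refine ⟨c + R • (w : Vel N), h.add_smul_mem_carrier w.2 hw, ?_⟩
    simp only [FunLike.coe_smul, Pi.smul_apply, map_add, map_smul,
      Submodule.orthogonalProjectionOnto_mem_subspace_eq_self]
    rw [Submodule.orthogonalProjectionOnto_eq_zero_iff.2 h.center_mem,
      smul_zero, zero_add, smul_smul, mul_inv_cancel₀ h.radius_pos.ne', one_smul]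
  have h1 := (measure_mono hsub).trans (hlip.hausdorffMeasure_image_le h.dim_nonneg M.carrier)
  rw [h0, mul_zero, h.dim_eq] at h1
  exact absurd h1 (not_le.2 hausdorffMeasure_unitSphere_pos)

lemma isProbabilityMeasure_unif (h : IsSphereLeaf M W c R) : IsProbabilityMeasure M.unif :=
  ProbabilityTheory.cond_isProbabilityMeasure_of_finite h.hausdorffMeasure_carrier_ne_zero
    h.hausdorffMeasure_carrier_ne_top

lemma ae_mem_carrier (h : IsSphereLeaf M W c R) : ∀ᵐ x ∂M.unif, x ∈ M.carrier :=
  ProbabilityTheory.ae_cond_mem h.measurableSet_carrier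

lemma measurePreserving (h : IsSphereLeaf M W c R) (e : Vel N ≃ₗᵢ[ℝ] Vel N)
    (he : e ⁻¹' M.carrier = M.carrier) : MeasurePreserving e M.unif M.unif := by
  have h1 := (e.toIsometryEquiv.measurePreserving_hausdorffMeasure M.dim).restrict_preimage
    h.measurableSet_carrier
  have h2 : (e.toIsometryEquiv : Vel N → Vel N) ⁻¹' M.carrier = M.carrier := he
  rw [h2] at h1
  exact h1.smul_measure (μH[M.dim] M.carrier)⁻¹

/-- If an isometry displaces points only along `W`, it keeps the component in `Wᗮ` as well as the
norm. -/
lemma preimage_carrier_of_sub_mem (h : IsSphereLeaf M W c R) (e : Vel N ≃ₗᵢ[ℝ] Vel N)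
    (he : ∀ x, e x - x ∈ W) : e ⁻¹' M.carrier = M.carrier := by
  ext x
  have h1 : e x - W.starProjection (e x) = x - W.starProjection x := by
    have := Submodule.starProjection_eq_self_iff.2 (he x)
    rw [map_sub] at this
    rw [sub_eq_sub_iff_add_eq_add, add_comm x, ← sub_eq_sub_iff_add_eq_add, this]
  rw [Set.mem_preimage, h.mem_carrier_iff_norm, h.mem_carrier_iff_norm, h1, e.norm_map]

/-- Reflections act transitively on the leaf and preserve the measure. A null open set meeting the
leaf could thus be moved to a neighbourhood of any point, and by compactness the whole leaf would be
null. This separates continuous functions from zero in `L²`. -/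
lemma measure_pos_of_isOpen (h : IsSphereLeaf M W c R) {U : Set (Vel N)} (hU : IsOpen U)
    {x : Vel N} (hx : x ∈ M.carrier) (hxU : x ∈ U) : M.unif U ≠ 0 := by
  intro h0
  have := h.isProbabilityMeasure_unif
  have h1 : M.unif M.carrier = 0 := by
    refine h.isCompact_carrier.measure_zero_of_nhdsWithin fun y hy => ?_
    -- Reflection in the hyperplane orthogonal to `y - x` takes `y` to `x`, since both have the same
    -- norm.
    set e := (Submodule.span ℝ {y - x})ᗮ.reflection with he
    have hxy : e y = x := by
      refine Submodule.reflection_sub ?_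
      rw [← sq_eq_sq₀ (norm_nonneg _) (norm_nonneg _), h.norm_sq_eq hx, h.norm_sq_eq hy]
    have hyx : y - x ∈ W := by
      have : y - x = W.starProjection y - W.starProjection x := by
        have := (h.mem_carrier.1 hy).1.trans (h.mem_carrier.1 hx).1.symm
        rw [sub_eq_sub_iff_add_eq_add] at this ⊢
        rw [this]; abel
      rw [this]
      exact W.sub_mem (Submodule.starProjection_apply_mem _ _) (Submodule.starProjection_apply_mem _ _)
    have hmp := h.measurePreserving e (h.preimage_carrier_of_sub_mem e fun z => ?_)
    · refine ⟨e ⁻¹' U, mem_nhdsWithin_of_mem_nhds ?_, ?_⟩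
      · exact (hU.preimage e.continuous).mem_nhds (by rwa [Set.mem_preimage, hxy])
      · rw [hmp.measure_preimage hU.measurableSet.nullMeasurableSet, h0]
    · rw [he, Submodule.reflection_orthogonal_apply, Submodule.reflection_singleton_apply]
      have : ∀ v : Vel N, -(2 • v - z) - z = -(2 • v) := fun v => by abel
      rw [this]
      exact W.neg_mem (W.smul_of_tower_mem _ (W.smul_mem _ hyx))
  rw [(prob_compl_eq_zero_iff h.measurableSet_carrier (μ := M.unif)).1 h.ae_mem_carrier] at h1
  exact one_ne_zero h1

end IsSphereLeaf

end SphereLeaf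

/-! ### Integration by parts on the sphere through invariance under rotations. -/

section Green

variable {E : Type*} [NormedAddCommGroup E] [InnerProductSpace ℝ E]

/-- Rotation by the angle `t` in the plane spanned by the orthonormal vectors `a` and `b`. -/
def rotationLinear (a b : E) (t : ℝ) : E →ₗ[ℝ] E where
  toFun x := x + ((Real.cos t - 1) * inner ℝ a x - Real.sin t * inner ℝ b x : ℝ) • a
    + ((Real.cos t - 1) * inner ℝ b x + Real.sin t * inner ℝ a x : ℝ) • b
  map_add' x y := by simp only [inner_add_right]; module
  map_smul' r x := by simp only [real_inner_smul_right, RingHom.id_apply]; module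

lemma rotationLinear_apply (a b : E) (t : ℝ) (x : E) :
    rotationLinear a b t x
      = x + ((Real.cos t - 1) * inner ℝ a x - Real.sin t * inner ℝ b x : ℝ) • a
        + ((Real.cos t - 1) * inner ℝ b x + Real.sin t * inner ℝ a x : ℝ) • b := rfl

lemma norm_rotationLinear {a b : E} (ha : ‖a‖ = 1) (hb : ‖b‖ = 1) (hab : inner ℝ a b = (0 : ℝ))
    (t : ℝ) (x : E) : ‖rotationLinear a b t x‖ = ‖x‖ := by
  rw [← sq_eq_sq₀ (norm_nonneg _) (norm_nonneg _), rotationLinear_apply, norm_add_sq_real,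
    norm_add_sq_real, inner_add_left]
  simp only [real_inner_smul_right, real_inner_smul_left, norm_smul, ha, hb, hab, mul_one,
    Real.norm_eq_abs, sq_abs, real_inner_comm a x, real_inner_comm b x]
  linear_combination ((inner ℝ a x : ℝ) ^ 2 + (inner ℝ b x : ℝ) ^ 2) * Real.sin_sq_add_cos_sq t

lemma hasDerivAt_rotationLinear (a b x : E) (t : ℝ) :
    HasDerivAt (fun t => rotationLinear a b t x)
      ((-Real.sin t * inner ℝ a x - Real.cos t * inner ℝ b x : ℝ) • a
        + (-Real.sin t * inner ℝ b x + Real.cos t * inner ℝ a x : ℝ) • b) t := by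
  simp only [rotationLinear_apply]
  have hs := Real.hasDerivAt_sin t
  have hc := (Real.hasDerivAt_cos t).sub_const 1
  exact (((hc.mul_const _).sub (hs.mul_const _)).smul_const a).const_add x |>.add
    (((hc.mul_const _).add (hs.mul_const _)).smul_const b)

lemma angular_mul (a b : E) {φ ψ : E → ℝ} (hφ : ContDiff ℝ ∞ φ) (hψ : ContDiff ℝ ∞ ψ) (x : E) :
    angular a b (fun y => φ y * ψ y) x = φ x * angular a b ψ x + ψ x * angular a b φ x := by
  unfold angular
  rw [fderiv_fun_mul (hφ.differentiable (by simp) x) (hψ.differentiable (by simp) x)]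
  simp

lemma angular_self (a : E) (φ : E → ℝ) (x : E) : angular a a φ x = 0 := by
  simp [angular, rotField]

variable [FiniteDimensional ℝ E]

/-- Rotation by the angle `t` in the plane spanned by the orthonormal vectors `a` and `b`. -/
def rotation {a b : E} (ha : ‖a‖ = 1) (hb : ‖b‖ = 1) (hab : inner ℝ a b = (0 : ℝ)) (t : ℝ) :
    E ≃ₗᵢ[ℝ] E :=
  LinearIsometry.toLinearIsometryEquiv ⟨rotationLinear a b t, norm_rotationLinear ha hb hab t⟩ rfl

namespace IsSphereLeaf

variable {N : ℕ} {M : Leaf N} {W : Submodule ℝ (Vel N)} {c : Vel N} {R : ℝ}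

lemma exists_bound_of_continuous {F : Type*} [NormedAddCommGroup F] (h : IsSphereLeaf M W c R)
    {g : Vel N → F} (hg : Continuous g) : ∃ C, 0 ≤ C ∧ ∀ᵐ x ∂M.unif, ‖g x‖ ≤ C := by
  obtain ⟨C, hC⟩ := h.isCompact_carrier.exists_bound_of_continuousOn hg.continuousOn
  refine ⟨max C 0, le_max_right _ _, ?_⟩
  filter_upwards [h.ae_mem_carrier] with x hx using (hC x hx).trans (le_max_left _ _)

lemma integrable_of_continuous (h : IsSphereLeaf M W c R) {g : Vel N → ℝ} (hg : Continuous g) :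
    Integrable g M.unif := by
  have := h.isProbabilityMeasure_unif
  obtain ⟨C, -, hC⟩ := h.exists_bound_of_continuous hg
  exact Integrable.of_bound hg.aestronglyMeasurable C hC

/-- The integral of `φ` composed with the rotation by `t` does not depend on `t`; its derivative at
`t = 0`, taken under the integral, is the left side. -/
lemma integral_angular_eq_zero (h : IsSphereLeaf M W c R) {a b : Vel N} (haW : a ∈ W)
    (hbW : b ∈ W) (ha : ‖a‖ = 1) (hb : ‖b‖ = 1) (hab : inner ℝ a b = (0 : ℝ))
    {φ : Vel N → ℝ} (hφ : ContDiff ℝ ∞ φ) : ∫ x, angular a b φ x ∂M.unif = 0 := by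
  have := h.isProbabilityMeasure_unif
  have hinv : ∀ t, ∫ x, φ (rotationLinear a b t x) ∂M.unif = ∫ x, φ x ∂M.unif := by
    intro t
    have hmp := h.measurePreserving (rotation ha hb hab t)
      (h.preimage_carrier_of_sub_mem _ fun x => ?_)
    · exact hmp.integral_comp (rotation ha hb hab t).toHomeomorph.measurableEmbedding φ
    · change rotationLinear a b t x - x ∈ W
      rw [rotationLinear_apply, add_assoc, add_sub_cancel_left]
      exact W.add_mem (W.smul_mem _ haW) (W.smul_mem _ hbW)
  have hd : ∀ x t, HasDerivAt (fun t => φ (rotationLinear a b t x))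
      (fderiv ℝ φ (rotationLinear a b t x)
        ((-Real.sin t * inner ℝ a x - Real.cos t * inner ℝ b x : ℝ) • a
        + (-Real.sin t * inner ℝ b x + Real.cos t * inner ℝ a x : ℝ) • b)) t := fun x t =>
    (hφ.differentiable (by simp) _).hasFDerivAt.comp_hasDerivAt t (hasDerivAt_rotationLinear a b x t)
  set F' : ℝ → Vel N → ℝ := fun t x => fderiv ℝ φ (rotationLinear a b t x)
        ((-Real.sin t * inner ℝ a x - Real.cos t * inner ℝ b x : ℝ) • a
        + (-Real.sin t * inner ℝ b x + Real.cos t * inner ℝ a x : ℝ) • b) with hF'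
  have hcont : Continuous (fun p : ℝ × Vel N => F' p.1 p.2) := by
    have h1 : Continuous (fderiv ℝ φ) := (hφ.fderiv_right (m := ∞) le_rfl).continuous
    simp only [hF', rotationLinear_apply]
    fun_prop
  obtain ⟨C, hC⟩ := ((isCompact_closedBall (0 : ℝ) 1).prod
    h.isCompact_carrier).exists_bound_of_continuousOn hcont.continuousOn
  have key := (hasDerivAt_integral_of_dominated_loc_of_deriv_le (μ := M.unif) (𝕜 := ℝ)
    (F := fun t x => φ (rotationLinear a b t x)) (F' := F') (x₀ := 0) (bound := fun _ => C)
    (Metric.ball_mem_nhds (0 : ℝ) one_pos) ?_ ?_ ?_ ?_ ?_ ?_).2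
  · simp_rw [hinv] at key
    have := key.unique (hasDerivAt_const (0 : ℝ) _)
    rw [← this]
    refine integral_congr_ae (ae_of_all _ fun x => ?_)
    simp only [angular, hF', rotationLinear_apply, rotField]
    simp [sub_eq_add_neg, add_comm]
  · refine Filter.Eventually.of_forall fun t => Continuous.aestronglyMeasurable ?_
    exact hφ.continuous.comp (rotationLinear a b t).continuous_of_finiteDimensional
  · exact h.integrable_of_continuous
      (hφ.continuous.comp (rotationLinear a b 0).continuous_of_finiteDimensional)
  · exact (hcont.comp (Continuous.prodMk_right (0 : ℝ))).aestronglyMeasurable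
  · filter_upwards [h.ae_mem_carrier] with x hx t ht
    exact hC (t, x) ⟨Metric.ball_subset_closedBall ht, hx⟩
  · exact integrable_const _
  · exact ae_of_all _ fun x t _ => hd x t

lemma integral_angular_mul (h : IsSphereLeaf M W c R) (i j) {φ ψ : Vel N → ℝ}
    (hφ : ContDiff ℝ ∞ φ) (hψ : ContDiff ℝ ∞ ψ) :
    ∫ x, angular (stdOrthonormalBasis ℝ W i : Vel N) (stdOrthonormalBasis ℝ W j : Vel N) φ x * ψ x
        ∂M.unif
      = -∫ x, φ x * angular (stdOrthonormalBasis ℝ W i : Vel N)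
        (stdOrthonormalBasis ℝ W j : Vel N) ψ x ∂M.unif := by
  rcases eq_or_ne i j with rfl | hij
  · simp [angular_self]
  set a : Vel N := ((stdOrthonormalBasis ℝ W i : W) : Vel N)
  set b : Vel N := ((stdOrthonormalBasis ℝ W j : W) : Vel N)
  have ha : ‖a‖ = 1 := (stdOrthonormalBasis ℝ W).orthonormal.1 i
  have hb : ‖b‖ = 1 := (stdOrthonormalBasis ℝ W).orthonormal.1 j
  have hab : inner ℝ a b = (0 : ℝ) := (stdOrthonormalBasis ℝ W).orthonormal.2 hij
  have h1 : ∫ x, angular a b (φ * ψ) x ∂M.unif = 0 :=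
    h.integral_angular_eq_zero (Subtype.coe_prop _) (Subtype.coe_prop _) ha hb hab
    (hφ.mul hψ)
  have h2 : ∀ x, angular a b (φ * ψ) x = φ x * angular a b ψ x + angular a b φ x * ψ x := by
    intro x
    rw [mul_comm (angular a b φ x)]
    exact angular_mul a b hφ hψ x
  simp_rw [h2] at h1
  rw [integral_add] at h1
  · linarith
  · exact h.integrable_of_continuous (hφ.continuous.mul (contDiff_angular a b hψ).continuous)
  · exact h.integrable_of_continuous ((contDiff_angular a b hφ).continuous.mul hψ.continuous)

/-- Each squared rotation field is moved across by two antisymmetric integrations by parts. -/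
lemma integral_lapSphere_mul (h : IsSphereLeaf M W c R) {φ ψ : Vel N → ℝ}
    (hφ : ContDiff ℝ ∞ φ) (hψ : ContDiff ℝ ∞ ψ) :
    ∫ x, lapSphere W R φ x * ψ x ∂M.unif = ∫ x, φ x * lapSphere W R ψ x ∂M.unif := by
  have hint : ∀ {f g : Vel N → ℝ}, ContDiff ℝ ∞ f → ContDiff ℝ ∞ g →
      Integrable (fun x => f x * g x) M.unif := fun hf hg =>
    h.integrable_of_continuous (hf.continuous.mul hg.continuous)
  simp only [lapSphere, Finset.mul_sum, Finset.sum_mul]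
  rw [integral_finsetSum, integral_finsetSum]
  · refine Finset.sum_congr rfl fun i _ => ?_
    rw [integral_finsetSum, integral_finsetSum]
    · refine Finset.sum_congr rfl fun j _ => ?_
      simp only [mul_assoc, mul_left_comm _ (1 / (2 * R ^ 2))]
      rw [integral_const_mul, integral_const_mul,
        h.integral_angular_mul i j (contDiff_angular _ _ hφ) hψ,
        ← neg_eq_iff_eq_neg.2 (h.integral_angular_mul i j hφ (contDiff_angular _ _ hψ))]
    · intro j _
      exact hint hφ (contDiff_const.mul (contDiff_angular _ _ (contDiff_angular _ _ hψ)))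
    · intro j _
      exact hint (contDiff_const.mul (contDiff_angular _ _ (contDiff_angular _ _ hφ))) hψ
  · intro i _
    refine integrable_finsetSum _ fun j _ => ?_
    exact hint hφ (contDiff_const.mul (contDiff_angular _ _ (contDiff_angular _ _ hψ)))
  · intro i _
    refine integrable_finsetSum _ fun j _ => ?_
    exact hint (contDiff_const.mul (contDiff_angular _ _ (contDiff_angular _ _ hφ))) hψ

end IsSphereLeaf

end Green

/-! ### Polynomials in a single linear coordinate and their eigenvalues. -/

section Ridge

open Module Polynomial

variable {E : Type*} [NormedAddCommGroup E] [InnerProductSpace ℝ E]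

lemma contDiff_ridge {g : ℝ → ℝ} (hg : ContDiff ℝ ∞ g) (ξ : E) :
    ContDiff ℝ ∞ (fun x : E => g (inner ℝ ξ x)) := hg.comp (innerSL ℝ ξ).contDiff

lemma fderiv_ridge {g : ℝ → ℝ} (hg : ContDiff ℝ ∞ g) (ξ x : E) :
    fderiv ℝ (fun x : E => g (inner ℝ ξ x)) x = deriv g (inner ℝ ξ x) • innerSL ℝ ξ :=
  ((hg.differentiable (by simp) _).hasDerivAt.comp_hasFDerivAt x (innerSL ℝ ξ).hasFDerivAt).fderiv

lemma fderiv_fderiv_ridge {g : ℝ → ℝ} (hg : ContDiff ℝ ∞ g) (ξ x v w : E) :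
    fderiv ℝ (fderiv ℝ (fun x : E => g (inner ℝ ξ x))) x v w
      = deriv (deriv g) (inner ℝ ξ x) * (inner ℝ ξ v * inner ℝ ξ w) := by
  have h1 : fderiv ℝ (fun x : E => g (inner ℝ ξ x))
      = fun x => deriv g (inner ℝ ξ x) • innerSL ℝ ξ := funext fun x => fderiv_ridge hg ξ x
  have hg' : ContDiff ℝ ∞ (deriv g) := (contDiff_infty_iff_deriv.1 hg).2
  have h2 : HasFDerivAt (fun x : E => deriv g (inner ℝ ξ x))
      (deriv (deriv g) (inner ℝ ξ x) • innerSL ℝ ξ) x :=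
    (hg'.differentiable (by simp) _).hasDerivAt.comp_hasFDerivAt x (innerSL ℝ ξ).hasFDerivAt
  rw [h1, (h2.smul_const (innerSL ℝ ξ)).fderiv]
  simp
  ring

variable [FiniteDimensional ℝ E]

lemma lapSphere_ridge (W : Submodule ℝ E) {R : ℝ} (hR : 0 < R) {g : ℝ → ℝ}
    (hg : ContDiff ℝ ∞ g) (ξ : E) {x : E} (hx : ‖W.starProjection x‖ = R) :
    lapSphere W R (fun x => g (inner ℝ ξ x)) x
      = deriv (deriv g) (inner ℝ ξ x) * ‖W.starProjection ξ‖ ^ 2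
        - (deriv (deriv g) (inner ℝ ξ x) * inner ℝ ξ (W.starProjection x) ^ 2
          + (finrank ℝ W - 1) * (deriv g (inner ℝ ξ x) * inner ℝ ξ (W.starProjection x)))
            / R ^ 2 := by
  rw [lapSphere_eq W hR (contDiff_ridge hg ξ) hx]
  simp only [fderiv_fderiv_ridge hg, fderiv_ridge hg]
  have : ‖W.starProjection ξ‖ ^ 2 = ∑ i, (inner ℝ ξ (stdOrthonormalBasis ℝ W i : E) : ℝ)
      * inner ℝ ξ (stdOrthonormalBasis ℝ W i : E) := by
    rw [← real_inner_self_eq_norm_sq]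
    nth_rw 1 [starProjection_eq_sum]
    rw [sum_inner]
    refine Finset.sum_congr rfl fun i _ => ?_
    rw [real_inner_smul_left, real_inner_comm, real_inner_comm (W.starProjection ξ)]
    congr 1
    have h2 := Submodule.starProjection_inner_eq_zero (K := W) ξ (stdOrthonormalBasis ℝ W i : E)
      (Subtype.coe_prop _)
    rw [inner_sub_left, sub_eq_zero] at h2
    exact h2.symm
  rw [this, Finset.mul_sum]
  simp [pow_two]

/-- The operator induced by minus the Laplace-Beltrami operator of the sphere of radius `R` in an
`n`-dimensional space on polynomials in a linear coordinate of squared norm `s`. -/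
def ridgeOp (n R s : ℝ) : ℝ[X] →ₗ[ℝ] ℝ[X] where
  toFun p := C (1 / R ^ 2) * (X ^ 2 * derivative (derivative p) + C (n - 1) * X * derivative p)
    - C s * derivative (derivative p)
  map_add' p q := by simp only [map_add]; ring
  map_smul' r p := by
    simp only [derivative_smul, RingHom.id_apply]; simp only [smul_eq_C_mul]; ring

/-- The `j`-th eigenvalue of the sphere of radius `R` in an `n`-dimensional space. -/
def sphereEigenvalue (n R : ℝ) (j : ℕ) : ℝ := j * (j + n - 2) / R ^ 2

lemma sphereEigenvalue_strictMono {n R : ℝ} (hn : 3 ≤ n) (hR : 0 < R) :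
    StrictMono (sphereEigenvalue n R) := by
  refine strictMono_nat_of_lt_succ fun j => ?_
  refine div_lt_div_of_pos_right ?_ (by positivity)
  push_cast
  nlinarith [(Nat.cast_nonneg j : (0 : ℝ) ≤ j)]

/-- The operator is triangular for the degree: monomials are mapped to multiples of themselves plus
a term two degrees lower. The diagonal entries are the eigenvalues of the sphere. -/
lemma coeff_ridgeOp (n R s : ℝ) (p : ℝ[X]) (m : ℕ) :
    (ridgeOp n R s p).coeff m
      = sphereEigenvalue n R m * p.coeff m - s * ((m + 2) * (m + 1)) * p.coeff (m + 2) := by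
  have h : ridgeOp n R s p = C (1 / R ^ 2) * (X ^ 2 * derivative (derivative p)
      + C (n - 1) * (X * derivative p)) - C s * derivative (derivative p) := by
    simp [ridgeOp, mul_assoc]
  rw [h, coeff_sub, coeff_C_mul, coeff_C_mul, coeff_add, coeff_C_mul]
  rcases m with _ | _ | m
  · simp [sphereEigenvalue, coeff_derivative]
    ring
  · simp [coeff_X_pow_mul', sphereEigenvalue, coeff_derivative]
    ring
  · rw [coeff_X_mul, coeff_X_pow_mul]
    simp [sphereEigenvalue, coeff_derivative]
    ring

/-- Below degree `k` the triangular operator `ridgeOp - λₖ` has diagonal entries `λₘ - λₖ ≠ 0`, so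
it can be inverted by removing one top coefficient at a time. -/
lemma exists_ridgeOp_sub_smul_eq {n R s : ℝ} (hn : 3 ≤ n) (hR : 0 < R) {k : ℕ} :
    ∀ d ≤ k, ∀ r : ℝ[X], r.degree < (d : WithBot ℕ) → ∃ q : ℝ[X], q.degree < (d : WithBot ℕ) ∧
      ridgeOp n R s q - sphereEigenvalue n R k • q = r := by
  intro d
  induction d with
  | zero =>
    intro _ r hr
    refine ⟨0, by simp, ?_⟩
    have : r = 0 := by
      rw [← degree_eq_bot]
      simpa [Nat.WithBot.lt_zero_iff] using hr
    simp [this]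
  | succ d ih =>
    intro hd r hr
    have hne : sphereEigenvalue n R d - sphereEigenvalue n R k ≠ 0 :=
      sub_ne_zero.2 (sphereEigenvalue_strictMono hn hR (Nat.lt_of_succ_le hd)).ne
    set q₀ : ℝ[X] := C (r.coeff d / (sphereEigenvalue n R d - sphereEigenvalue n R k)) * X ^ d
      with hq₀
    have hc : ∀ m, q₀.coeff m
        = if m = d then r.coeff d / (sphereEigenvalue n R d - sphereEigenvalue n R k) else 0 := by
      intro m
      rw [hq₀, coeff_C_mul, coeff_X_pow]
      simp
    obtain ⟨q, hq, hq'⟩ := ih (Nat.le_of_succ_le hd)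
      (r - (ridgeOp n R s q₀ - sphereEigenvalue n R k • q₀)) (by
        rw [degree_lt_iff_coeff_zero] at hr ⊢
        intro m hm
        rw [coeff_sub, coeff_sub, coeff_ridgeOp, coeff_smul, hc, hc, if_neg (by omega : m + 2 ≠ d)]
        rcases hm.eq_or_lt with rfl | hm
        · rw [if_pos rfl, smul_eq_mul]
          field_simp
          ring
        · rw [if_neg hm.ne', hr m hm]
          simp)
    refine ⟨q + q₀, ?_, ?_⟩
    · rw [degree_lt_iff_coeff_zero] at hq ⊢
      intro m hm
      rw [coeff_add, hq m (by omega), hc, if_neg (by omega)]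
      simp
    · rw [map_add, smul_add, ← sub_eq_zero, ← sub_eq_zero.2 hq']
      abel

/-- On `X ^ k` the operator `ridgeOp - λₖ` produces only lower degrees, and these are cancelled by a
correction of degree below `k`. -/
lemma exists_monic_ridgeOp_eq {n R : ℝ} (s : ℝ) (hn : 3 ≤ n) (hR : 0 < R) (k : ℕ) :
    ∃ p : ℝ[X], p.Monic ∧ p.natDegree = k ∧ ridgeOp n R s p = sphereEigenvalue n R k • p := by
  obtain ⟨q, hq, hq'⟩ := exists_ridgeOp_sub_smul_eq (s := s) hn hR k le_rfl
    (-(ridgeOp n R s (X ^ k) - sphereEigenvalue n R k • X ^ k)) (by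
      rw [degree_lt_iff_coeff_zero]
      intro m hm
      rw [coeff_neg, coeff_sub, coeff_ridgeOp, coeff_smul, coeff_X_pow, coeff_X_pow,
        if_neg (by omega : m + 2 ≠ k)]
      rcases hm.eq_or_lt with rfl | hm
      · simp
      · simp [hm.ne'])
  refine ⟨X ^ k + q, monic_X_pow_add hq, natDegree_eq_of_degree_eq_some ?_, ?_⟩
  · rw [degree_add_eq_left_of_degree_lt (by rwa [degree_X_pow]), degree_X_pow]
  · rw [map_add, smul_add, ← sub_eq_zero, ← sub_eq_zero.2 hq']
    abel

/-- Eigenpolynomials span the polynomials. -/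
lemma exists_ridge_eigenpolynomials {n R : ℝ} (s : ℝ) (hn : 3 ≤ n) (hR : 0 < R) :
    ∃ p : ℕ → ℝ[X], (∀ k, (p k).Monic ∧ ridgeOp n R s (p k) = sphereEigenvalue n R k • p k) ∧
      Submodule.span ℝ (Set.range p) = ⊤ := by
  choose p hp using fun k => exists_monic_ridgeOp_eq (n := n) (R := R) s hn hR k
  refine ⟨p, fun k => ⟨(hp k).1, (hp k).2.2⟩, ?_⟩
  let S : Polynomial.Sequence ℝ :=
    ⟨p, fun k => by rw [degree_eq_natDegree (hp k).1.ne_zero, (hp k).2.1]⟩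
  exact S.span fun k => by
    have : (S k).leadingCoeff = 1 := (hp k).1
    rw [this]
    exact isUnit_one

lemma contDiff_eval (p : ℝ[X]) : ContDiff ℝ ∞ (fun t => p.eval t) := by
  simpa [coe_aeval_eq_eval] using p.contDiff_aeval (𝕜 := ℝ) ∞

lemma lapSphere_polynomial (W : Submodule ℝ E) {R : ℝ} (hR : 0 < R) (p : ℝ[X]) {ξ : E}
    (hξ : ξ ∈ W) {x : E} (hx : ‖W.starProjection x‖ = R) :
    -lapSphere W R (fun x => p.eval (inner ℝ ξ x)) x
      = (ridgeOp (finrank ℝ W) R (‖ξ‖ ^ 2) p).eval (inner ℝ ξ x) := by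
  have h1 : W.starProjection ξ = ξ := Submodule.starProjection_eq_self_iff.2 hξ
  have h2 : (inner ℝ ξ (W.starProjection x) : ℝ) = inner ℝ ξ x := by
    have h2 := Submodule.starProjection_inner_eq_zero (K := W) x ξ hξ
    rw [inner_sub_left, sub_eq_zero] at h2
    rw [real_inner_comm, ← h2, real_inner_comm]
  have h3 : deriv (fun t => p.eval t) = fun t => (derivative p).eval t := funext fun t => p.deriv
  have h4 : deriv (fun t => (derivative p).eval t) = fun t => (derivative (derivative p)).eval t :=
    funext fun t => (derivative p).deriv
  have hp : ContDiff ℝ ∞ (fun t => p.eval t) := contDiff_eval p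
  rw [lapSphere_ridge W hR hp ξ hx, h1, h2, h3, h4]
  simp [ridgeOp]
  ring

end Ridge

/-! ### Existence and completeness of the eigenfunctions depending on one coordinate. -/

section Eigenfunctions

open Module Polynomial

/-- Smooth functions on the whole space which restrict to eigenfunctions on the leaf `M`. -/
def smoothEigenspace {N : ℕ} (M : Leaf N) (W : Submodule ℝ (Vel N)) (R : ℝ) (l : ℝ) :
    Set (Vel N → ℝ) :=
  {φ | ContDiff ℝ ∞ φ ∧ ∀ x ∈ M.carrier, -lapSphere W R φ x = l * φ x}

namespace IsSphereLeaf

variable {N : ℕ} {M : Leaf N} {W : Submodule ℝ (Vel N)} {c : Vel N} {R : ℝ}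

lemma three_le_cast (h : IsSphereLeaf M W c R) : (3 : ℝ) ≤ finrank ℝ W := by
  exact_mod_cast h.three_le

lemma polynomial_mem_smoothEigenspace (h : IsSphereLeaf M W c R) {ξ : Vel N} (hξ : ξ ∈ W)
    {p : ℝ[X]} {l : ℝ} (hp : ridgeOp (finrank ℝ W) R (‖ξ‖ ^ 2) p = l • p) :
    (fun x => p.eval (inner ℝ ξ x)) ∈ smoothEigenspace M W R l := by
  refine ⟨contDiff_ridge (contDiff_eval p) ξ, fun x hx => ?_⟩
  rw [lapSphere_polynomial W h.radius_pos p hξ (h.mem_carrier.1 hx).2, hp]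
  simp

/-- A coordinate that takes infinitely many values on the leaf is needed so that a nonzero
polynomial in it cannot vanish identically there. The points lie on a great circle through two
orthonormal directions of `W`. -/
lemma exists_inner_eq (h : IsSphereLeaf M W c R) :
    ∃ ξ ∈ W, ∀ t ∈ Set.Icc (-1 : ℝ) 1, ∃ x ∈ M.carrier, (inner ℝ ξ x : ℝ) = R * t := by
  have h3 := h.three_le
  let i0 : Fin (finrank ℝ W) := ⟨0, by omega⟩
  let i1 : Fin (finrank ℝ W) := ⟨1, by omega⟩
  set a : Vel N := ((stdOrthonormalBasis ℝ W i0 : W) : Vel N)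
  set b : Vel N := ((stdOrthonormalBasis ℝ W i1 : W) : Vel N)
  have ha : ‖a‖ = 1 := (stdOrthonormalBasis ℝ W).orthonormal.1 i0
  have hb : ‖b‖ = 1 := (stdOrthonormalBasis ℝ W).orthonormal.1 i1
  have hab : inner ℝ a b = (0 : ℝ) := (stdOrthonormalBasis ℝ W).orthonormal.2 (by simp [i0, i1])
  have haW : a ∈ W := Subtype.coe_prop _
  have hbW : b ∈ W := Subtype.coe_prop _
  refine ⟨a, haW, fun t ht => ?_⟩
  have ht2 : 0 ≤ 1 - t ^ 2 := by nlinarith [ht.1, ht.2]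
  refine ⟨_, h.add_smul_mem_carrier (W.add_mem (W.smul_mem t haW) (W.smul_mem (√(1 - t ^ 2)) hbW))
    ?_, ?_⟩
  · rw [← sq_eq_sq₀ (norm_nonneg _) zero_le_one, norm_add_sq_real]
    simp only [real_inner_smul_left, real_inner_smul_right, hab, norm_smul, ha, hb,
      Real.norm_eq_abs, mul_one, sq_abs, Real.sq_sqrt ht2]
    ring
  · have hac : inner ℝ a c = (0 : ℝ) := h.center_mem a haW
    simp [inner_add_right, real_inner_smul_right, hac, hab, ha]

lemma exists_eigenfunction_ne_zero (h : IsSphereLeaf M W c R) (j : ℕ) :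
    ∃ φ ∈ smoothEigenspace M W R (sphereEigenvalue (finrank ℝ W) R j),
      ∃ x ∈ M.carrier, φ x ≠ 0 := by
  obtain ⟨ξ, hξ, hx⟩ := h.exists_inner_eq
  obtain ⟨p, hpm, -, hp⟩ := exists_monic_ridgeOp_eq (‖ξ‖ ^ 2) h.three_le_cast h.radius_pos j
  refine ⟨_, h.polynomial_mem_smoothEigenspace hξ hp, ?_⟩
  by_contra! hcon
  refine hpm.ne_zero (eq_zero_of_infinite_isRoot p ?_)
  refine Set.Infinite.mono (s := (fun t => R * t) '' Set.Icc (-1 : ℝ) 1) ?_ ?_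
  · rintro _ ⟨t, ht, rfl⟩
    obtain ⟨x, hxM, hxt⟩ := hx t ht
    have := hcon x hxM
    rwa [hxt] at this
  · exact (Set.Icc_infinite (by norm_num)).image
      (mul_right_injective₀ h.radius_pos.ne').injOn

lemma isEigenvalue (h : IsSphereLeaf M W c R) (j : ℕ) :
    M.IsEigenvalue (sphereEigenvalue (finrank ℝ W) R j) := by
  obtain ⟨φ, ⟨hφ, hφ'⟩, hx⟩ := h.exists_eigenfunction_ne_zero j
  refine ⟨φ, hφ, hx, fun x hx => ?_⟩
  rw [h.laplacian_eq_lapSphere hφ hx, hφ' x hx]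

/-- A real `L²` function orthogonal to all eigenfunctions vanishes. -/
lemma ae_eq_zero_of_orthogonal (h : IsSphereLeaf M W c R) {f : Vel N → ℝ}
    (hf : Integrable f M.unif)
    (hort : ∀ j, ∀ φ ∈ smoothEigenspace M W R (sphereEigenvalue (finrank ℝ W) R j),
      ∫ x, φ x * f x ∂M.unif = 0) : f =ᵐ[M.unif] 0 := by
  have hmul : ∀ {g : Vel N → ℝ}, Continuous g → Integrable (fun x => g x * f x) M.unif := by
    intro g hg
    obtain ⟨C, -, hC⟩ := h.exists_bound_of_continuous hg
    exact hf.bdd_mul hg.aestronglyMeasurable hC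
  refine ae_eq_zero_of_integral_inner_pow_eq_zero hf.1 (fun ξ => ?_) fun ξ k => ?_
  · have := (hmul (g := fun x => Real.exp |inner ℝ x ξ|) (by fun_prop)).norm
    simpa using this
  · set η := W.starProjection ξ
    have hη : η ∈ W := Submodule.starProjection_apply_mem _ _
    obtain ⟨p, hp, hspan⟩ := exists_ridge_eigenpolynomials (‖η‖ ^ 2) h.three_le_cast h.radius_pos
    have key : ∀ q ∈ Submodule.span ℝ (Set.range p),
        ∫ x, q.eval (inner ℝ η x) * f x ∂M.unif = 0 := by
      intro q hq
      induction hq using Submodule.span_induction with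
      | mem q hq =>
        obtain ⟨j, rfl⟩ := hq
        exact hort j _ (h.polynomial_mem_smoothEigenspace hη (hp j).2)
      | zero => simp
      | add q r _ _ hq hr =>
        simp only [eval_add, add_mul]
        rw [integral_add, hq, hr, add_zero]
        · exact hmul (contDiff_ridge (contDiff_eval q) η).continuous
        · exact hmul (contDiff_ridge (contDiff_eval r) η).continuous
      | smul a q _ hq =>
        simp only [eval_smul, smul_eq_mul, mul_assoc]
        rw [integral_const_mul, hq, mul_zero]
    -- On the leaf `⟨x, ξ⟩ = ⟨η, x⟩ + ⟨c, ξ⟩`, so every power of it is a polynomial in the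
    -- coordinate `⟨η, x⟩` with `η ∈ W`, to which the span of the eigenpolynomials applies.
    rw [← key ((X + C (inner ℝ c ξ)) ^ k) (by rw [hspan]; trivial)]
    refine integral_congr_ae ?_
    filter_upwards [h.ae_mem_carrier] with x hx
    have hx1 : x = c + W.starProjection x := by rw [← (h.mem_carrier.1 hx).1]; abel
    have h2 : (inner ℝ η x : ℝ) = inner ℝ (W.starProjection x) ξ := by
      rw [real_inner_comm, Submodule.inner_starProjection_left_eq_right]
    rw [eval_pow, eval_add, eval_X, eval_C, h2]
    congr 2
    nth_rw 1 [hx1]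
    rw [inner_add_left, add_comm]

end IsSphereLeaf

end Eigenfunctions

/-! ### The weak resolvent equation and the spectrum of one sphere. -/

section Spectrum

open Module

/-- In a Hilbert sum, the equation `(A - z) f = g` for a diagonal operator `A` with eigenvalues
staying away from `z` can be solved componentwise. -/
lemma exists_hasSum_resolvent {H : Type*} [NormedAddCommGroup H] [InnerProductSpace ℂ H]
    [CompleteSpace H] {V : ℕ → Submodule ℂ H} (hclosed : ∀ j, IsClosed (V j : Set H))
    (horth : ∀ i j, i ≠ j → ∀ f ∈ V i, ∀ g ∈ V j, inner ℂ f g = (0 : ℂ))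
    (htotal : ⊤ ≤ (⨆ j, V j).topologicalClosure) {a : ℕ → ℂ} {δ : ℝ} (hδ : 0 < δ)
    (ha : ∀ j, δ ≤ ‖a j‖) (g : H) :
    ∃ (f : H) (x : ℕ → H), (∀ j, x j ∈ V j) ∧ HasSum (fun j => a j • x j) g ∧ HasSum x f := by
  have : ∀ j, CompleteSpace (V j) := fun j => (hclosed j).completeSpace_coe
  have hV : IsHilbertSum ℂ (fun j => V j) fun j => (V j).subtypeₗᵢ :=
    IsHilbertSum.mkInternal V
      (fun i j hij f g => horth i j hij (f : H) f.2 (g : H) g.2) htotal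
  set y := hV.linearIsometryEquiv g with hy
  -- Since `‖a j‖ ≥ δ`, dividing the components by `a j` enlarges them at most by the factor `δ⁻¹`.
  have hmem : Memℓp (fun j => (a j)⁻¹ • y j) 2 := by
    refine memℓp_gen ?_
    have hs := (lp.memℓp y).summable (by norm_num)
    refine Summable.of_nonneg_of_le (fun j => by positivity) (fun j => ?_)
      (hs.mul_left ((δ⁻¹) ^ (2 : ENNReal).toReal))
    rw [norm_smul, Real.mul_rpow (norm_nonneg _) (norm_nonneg _)]
    refine mul_le_mul_of_nonneg_right ?_ (by positivity)
    refine Real.rpow_le_rpow (norm_nonneg _) ?_ (by norm_num)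
    rw [norm_inv]
    exact inv_anti₀ hδ (ha j)
  refine ⟨hV.linearIsometryEquiv.symm ⟨_, hmem⟩, fun j => (a j)⁻¹ • (y j : H),
    fun j => (V j).smul_mem _ (y j).2, ?_, hV.hasSum_linearIsometryEquiv_symm ⟨_, hmem⟩⟩
  have h1 := hV.hasSum_linearIsometryEquiv_symm y
  rw [hy, LinearIsometryEquiv.symm_apply_apply] at h1
  convert h1 using 2 with j
  have : a j ≠ 0 := norm_pos_iff.1 (hδ.trans_le (ha j))
  rw [smul_smul, mul_inv_cancel₀ this, one_smul]
  rfl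

namespace IsSphereLeaf

variable {N : ℕ} {M : Leaf N} {W : Submodule ℝ (Vel N)} {c : Vel N} {R : ℝ}

lemma memLp_ofReal (h : IsSphereLeaf M W c R) {φ : Vel N → ℝ} (hφ : Continuous φ) :
    MemLp (fun x => (φ x : ℂ)) 2 M.unif := by
  have := h.isProbabilityMeasure_unif
  obtain ⟨C, -, hC⟩ := h.exists_bound_of_continuous (Complex.continuous_ofReal.comp hφ)
  exact MemLp.of_bound (Complex.continuous_ofReal.comp hφ).aestronglyMeasurable C hC

/-- The class in `L²(M; ℂ)` of a continuous real function on the whole space. -/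
def toL2 (h : IsSphereLeaf M W c R) {φ : Vel N → ℝ} (hφ : Continuous φ) : Lp ℂ 2 M.unif :=
  (h.memLp_ofReal hφ).toLp

lemma inner_toL2 (h : IsSphereLeaf M W c R) {φ : Vel N → ℝ} (hφ : Continuous φ)
    (f : Lp ℂ 2 M.unif) : inner ℂ (h.toL2 hφ) f = ∫ x, f x * (φ x : ℂ) ∂M.unif := by
  rw [L2.inner_def]
  refine integral_congr_ae ?_
  filter_upwards [(h.memLp_ofReal hφ).coeFn_toLp] with x hx
  rw [toL2, hx, RCLike.inner_apply, Complex.conj_ofReal]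

lemma integrable_mul_ofReal (h : IsSphereLeaf M W c R) {φ : Vel N → ℝ} (hφ : Continuous φ)
    (f : Lp ℂ 2 M.unif) : Integrable (fun x => f x * (φ x : ℂ)) M.unif := by
  have := h.isProbabilityMeasure_unif
  exact (Lp.memLp f).integrable_mul (h.memLp_ofReal hφ)

lemma inner_toL2_toL2 (h : IsSphereLeaf M W c R) {φ ψ : Vel N → ℝ} (hφ : Continuous φ)
    (hψ : Continuous ψ) :
    inner ℂ (h.toL2 hφ) (h.toL2 hψ) = ((∫ x, φ x * ψ x ∂M.unif : ℝ) : ℂ) := by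
  rw [h.inner_toL2, ← integral_complex_ofReal]
  refine integral_congr_ae ?_
  filter_upwards [(h.memLp_ofReal hψ).coeFn_toLp] with x hx
  rw [toL2, hx]
  push_cast
  ring

lemma resolventEq_iff (h : IsSphereLeaf M W c R) {z : ℂ} {f g : Lp ℂ 2 M.unif} :
    M.ResolventEq z f g ↔ ∀ φ : Vel N → ℝ, ∀ hφ : ContDiff ℝ ∞ φ,
      -inner ℂ (h.toL2 (contDiff_lapSphere W R hφ).continuous) f
        - z * inner ℂ (h.toL2 hφ.continuous) f = inner ℂ (h.toL2 hφ.continuous) g := by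
  refine forall_congr' fun φ => forall_congr' fun hφ => ?_
  have h1 : ∫ x, f x * (((-(M.laplacian φ x) : ℝ) : ℂ) - z * (φ x : ℂ)) ∂M.unif
      = ∫ x, (-(f x * ((lapSphere W R φ x : ℝ) : ℂ)) - z * (f x * (φ x : ℂ))) ∂M.unif := by
    refine integral_congr_ae ?_
    filter_upwards [h.ae_mem_carrier] with x hx
    rw [h.laplacian_eq_lapSphere hφ hx]
    push_cast
    ring
  rw [h1, integral_sub, integral_neg, integral_const_mul, h.inner_toL2, h.inner_toL2, h.inner_toL2]
  · exact (h.integrable_mul_ofReal (contDiff_lapSphere W R hφ).continuous f).neg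
  · exact (h.integrable_mul_ofReal hφ.continuous f).const_mul z

/-- The closed span in `L²` of the smooth eigenfunctions with eigenvalue `l`. -/
def eigenspaceL2 (h : IsSphereLeaf M W c R) (l : ℝ) : Submodule ℂ (Lp ℂ 2 M.unif) :=
  (Submodule.span ℂ {f | ∃ (φ : Vel N → ℝ) (hφ : φ ∈ smoothEigenspace M W R l),
    f = h.toL2 hφ.1.continuous}).topologicalClosure

lemma toL2_mem_eigenspaceL2 (h : IsSphereLeaf M W c R) {l : ℝ} {φ : Vel N → ℝ}
    (hφ : φ ∈ smoothEigenspace M W R l) : h.toL2 hφ.1.continuous ∈ h.eigenspaceL2 l :=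
  Submodule.le_topologicalClosure _ (Submodule.subset_span ⟨φ, hφ, rfl⟩)

lemma eigenspaceL2_le (h : IsSphereLeaf M W c R) {l : ℝ} {K : Submodule ℂ (Lp ℂ 2 M.unif)}
    (hK : IsClosed (K : Set (Lp ℂ 2 M.unif)))
    (h1 : ∀ (φ : Vel N → ℝ) (hφ : φ ∈ smoothEigenspace M W R l), h.toL2 hφ.1.continuous ∈ K) :
    h.eigenspaceL2 l ≤ K := by
  refine Submodule.topologicalClosure_minimal _ (Submodule.span_le.2 ?_) hK
  rintro f ⟨φ, hφ, rfl⟩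
  exact h1 φ hφ

/-- For smooth eigenfunctions this is Green's identity. Both sides are continuous in `f`, so the
kernel of their difference is closed and contains the closed span. -/
lemma inner_lapSphere_of_mem (h : IsSphereLeaf M W c R) {l : ℝ} {f : Lp ℂ 2 M.unif}
    (hf : f ∈ h.eigenspaceL2 l) {φ : Vel N → ℝ} (hφ : ContDiff ℝ ∞ φ) :
    -inner ℂ (h.toL2 (contDiff_lapSphere W R hφ).continuous) f
      = (l : ℂ) * inner ℂ (h.toL2 hφ.continuous) f := by
  set u := h.toL2 (contDiff_lapSphere W R hφ).continuous
  set v := h.toL2 hφ.continuous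
  set T : Lp ℂ 2 M.unif →L[ℂ] ℂ := innerSL ℂ u + (l : ℂ) • innerSL ℂ v with hT
  have key : h.eigenspaceL2 l ≤ T.ker := by
    refine h.eigenspaceL2_le T.isClosed_ker fun ψ hψ => ?_
    rw [LinearMap.mem_ker]
    change inner ℂ u (h.toL2 hψ.1.continuous) + (l : ℂ) * inner ℂ v (h.toL2 hψ.1.continuous) = 0
    rw [h.inner_toL2_toL2, h.inner_toL2_toL2, h.integral_lapSphere_mul hφ hψ.1]
    have : ∫ x, φ x * lapSphere W R ψ x ∂M.unif = -(l * ∫ x, φ x * ψ x ∂M.unif) := by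
      rw [← integral_const_mul, ← integral_neg]
      refine integral_congr_ae ?_
      filter_upwards [h.ae_mem_carrier] with x hx
      linear_combination -φ x * hψ.2 x hx
    rw [this]
    push_cast
    ring
  have h2 : inner ℂ u f + (l : ℂ) * inner ℂ v f = 0 := key hf
  linear_combination -h2

lemma inner_lapSphere_eigenfunction (h : IsSphereLeaf M W c R) {l : ℝ} {φ : Vel N → ℝ}
    (hφ : φ ∈ smoothEigenspace M W R l) (g : Lp ℂ 2 M.unif) :
    inner ℂ (h.toL2 (contDiff_lapSphere W R hφ.1).continuous) g
      = -((l : ℂ) * inner ℂ (h.toL2 hφ.1.continuous) g) := by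
    rw [h.inner_toL2, h.inner_toL2, ← integral_const_mul, ← integral_neg]
    refine integral_congr_ae ?_
    filter_upwards [h.ae_mem_carrier] with x hx
    have := congrArg (fun r : ℝ => (r : ℂ)) (hφ.2 x hx)
    push_cast at this
    linear_combination -g x * this

/-- A smooth eigenfunction for `l`, inserted as a test function in the weak equation of `g`, yields
`l⟨φ, g⟩ = m⟨φ, g⟩`. -/
lemma eigenspaceL2_orthogonal (h : IsSphereLeaf M W c R) {l m : ℝ} (hlm : l ≠ m) :
    ∀ f ∈ h.eigenspaceL2 l, ∀ g ∈ h.eigenspaceL2 m, inner ℂ f g = (0 : ℂ) := by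
  intro f hf g hg
  have : h.eigenspaceL2 l ≤ (Submodule.span ℂ {g})ᗮ := by
    refine h.eigenspaceL2_le (Submodule.isClosed_orthogonal _) fun φ hφ => ?_
    rw [Submodule.mem_orthogonal_singleton_iff_inner_left]
    have h1 := h.inner_lapSphere_of_mem hg hφ.1
    rw [h.inner_lapSphere_eigenfunction hφ, neg_neg, ← sub_eq_zero, ← sub_mul] at h1
    refine (mul_eq_zero.1 h1).resolve_left ?_
    change (l : ℂ) - (m : ℂ) ≠ 0
    rw [sub_ne_zero]
    exact_mod_cast hlm
  exact Submodule.mem_orthogonal_singleton_iff_inner_left.1 (this hf)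

lemma eq_zero_of_inner_eigenfunction (h : IsSphereLeaf M W c R) {f : Lp ℂ 2 M.unif}
    (hf : ∀ j, ∀ (φ : Vel N → ℝ)
      (hφ : φ ∈ smoothEigenspace M W R (sphereEigenvalue (finrank ℝ W) R j)),
      inner ℂ (h.toL2 hφ.1.continuous) f = (0 : ℂ)) : f = 0 := by
  have := h.isProbabilityMeasure_unif
  have hfi : Integrable f M.unif := (Lp.memLp f).integrable (by norm_num)
  have hre : (fun x => (f x).re) =ᵐ[M.unif] 0 := by
    refine h.ae_eq_zero_of_orthogonal hfi.re fun j φ hφ => ?_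
    have h1 := hf j φ hφ
    rw [h.inner_toL2] at h1
    have h2 := congrArg Complex.re h1
    have h3 := integral_re (𝕜 := ℂ) (h.integrable_mul_ofReal hφ.1.continuous f)
    rw [Complex.zero_re] at h2
    rw [← h2]
    refine Eq.trans ?_ h3
    refine integral_congr_ae (ae_of_all _ fun x => ?_)
    simp [mul_comm]
  have him : (fun x => (f x).im) =ᵐ[M.unif] 0 := by
    refine h.ae_eq_zero_of_orthogonal hfi.im fun j φ hφ => ?_
    have h1 := hf j φ hφ
    rw [h.inner_toL2] at h1
    have h2 := congrArg Complex.im h1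
    have h3 := integral_im (𝕜 := ℂ) (h.integrable_mul_ofReal hφ.1.continuous f)
    rw [Complex.zero_im] at h2
    rw [← h2]
    refine Eq.trans ?_ h3
    refine integral_congr_ae (ae_of_all _ fun x => ?_)
    simp [mul_comm]
  rw [Lp.eq_zero_iff_ae_eq_zero]
  filter_upwards [hre, him] with x h1 h2 using Complex.ext h1 h2

lemma eigenspaceL2_total (h : IsSphereLeaf M W c R) :
    ⊤ ≤ (⨆ j, h.eigenspaceL2 (sphereEigenvalue (finrank ℝ W) R j)).topologicalClosure := by
  rw [top_le_iff, Submodule.topologicalClosure_eq_top_iff, Submodule.eq_bot_iff]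
  intro f hf
  refine h.eq_zero_of_inner_eigenfunction fun j φ hφ => ?_
  exact hf _ (Submodule.mem_iSup_of_mem j (h.toL2_mem_eigenspaceL2 hφ))

lemma sphereEigenvalue_ge (h : IsSphereLeaf M W c R) (j : ℕ) :
    (j : ℝ) / R ^ 2 ≤ sphereEigenvalue (finrank ℝ W) R j := by
  refine div_le_div_of_nonneg_right ?_ (by positivity)
  nlinarith [(Nat.cast_nonneg j : (0 : ℝ) ≤ j), h.three_le_cast,
    mul_nonneg (Nat.cast_nonneg j : (0 : ℝ) ≤ j) (Nat.cast_nonneg j : (0 : ℝ) ≤ j)]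

/-- The eigenvalues grow at least like `j / R²`, so all but finitely many have distance at least `1`
from `z`. -/
lemma exists_dist_sphereEigenvalue (h : IsSphereLeaf M W c R) {z : ℂ}
    (hz : ∀ j, ((sphereEigenvalue (finrank ℝ W) R j : ℝ) : ℂ) ≠ z) :
    ∃ δ > 0, ∀ j, δ ≤ ‖((sphereEigenvalue (finrank ℝ W) R j : ℝ) : ℂ) - z‖ := by
  obtain ⟨J, hJ⟩ := exists_nat_gt ((‖z‖ + 1) * R ^ 2)
  have hne : (Finset.range (J + 1)).Nonempty := ⟨0, by simp⟩
  set d : ℕ → ℝ := fun j => ‖((sphereEigenvalue (finrank ℝ W) R j : ℝ) : ℂ) - z‖ with hd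
  refine ⟨min 1 ((Finset.range (J + 1)).inf' hne d), lt_min one_pos ?_, fun j => ?_⟩
  · rw [Finset.lt_inf'_iff]
    exact fun j _ => norm_pos_iff.2 (sub_ne_zero.2 (hz j))
  · rcases lt_or_ge j (J + 1) with hj | hj
    · exact (min_le_right _ _).trans (Finset.inf'_le d (Finset.mem_range.2 hj))
    · refine (min_le_left _ _).trans ?_
      have h1 := h.sphereEigenvalue_ge j
      have hR := h.radius_pos
      have h2 : ‖z‖ + 1 ≤ j / R ^ 2 := by
        rw [le_div_iff₀ (by positivity)]
        have : (J : ℝ) ≤ j := by exact_mod_cast (by omega : J ≤ j)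
        linarith
      have h3 := norm_sub_norm_le ((sphereEigenvalue (finrank ℝ W) R j : ℝ) : ℂ) z
      rw [Complex.norm_real, Real.norm_eq_abs] at h3
      have h4 := le_abs_self (sphereEigenvalue (finrank ℝ W) R j)
      linarith

/-- Off the eigenvalues, solving the equation in each eigenspace gives existence; the difference of
two solutions is orthogonal to every eigenfunction, hence zero. At an eigenvalue uniqueness fails.
-/
lemma spectrum_eq (h : IsSphereLeaf M W c R) :
    M.spectrum = Set.range (fun j : ℕ => ((sphereEigenvalue (finrank ℝ W) R j : ℝ) : ℂ)) := by
  set lam := sphereEigenvalue (finrank ℝ W) R with hlam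
  ext z
  constructor
  · intro hz
    by_contra hcon
    have hne : ∀ j, ((lam j : ℝ) : ℂ) ≠ z := fun j hj => hcon ⟨j, hj⟩
    obtain ⟨δ, hδ, hδ'⟩ := h.exists_dist_sphereEigenvalue hne
    refine hz fun g => ?_
    obtain ⟨f, x, hx, hg, hf⟩ := exists_hasSum_resolvent
      (V := fun j => h.eigenspaceL2 (lam j))
      (fun j => Submodule.isClosed_topologicalClosure _)
      (fun i j hij => h.eigenspaceL2_orthogonal
        ((sphereEigenvalue_strictMono h.three_le_cast h.radius_pos).injective.ne hij))
      h.eigenspaceL2_total (a := fun j => (lam j : ℂ) - z) hδ hδ' g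
    have hsol : M.ResolventEq z f g := by
      rw [h.resolventEq_iff]
      intro φ hφ
      set u := h.toL2 (contDiff_lapSphere W R hφ).continuous
      set v := h.toL2 hφ.continuous
      have s1 := (innerSL ℂ v).hasSum hg
      have s2 := ((innerSL ℂ u).hasSum hf).neg.sub (((innerSL ℂ v).hasSum hf).mul_left z)
      refine s2.unique (s1.congr_fun ?_)
      intro j
      have := h.inner_lapSphere_of_mem (hx j) hφ
      simp only [innerSL_apply_apply, inner_smul_right]
      linear_combination this
    refine ⟨f, hsol, fun f' hf' => ?_⟩
    · rw [← sub_eq_zero]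
      refine h.eq_zero_of_inner_eigenfunction fun j φ hφ => ?_
      have e1 := h.resolventEq_iff.1 hf' φ hφ.1
      have e2 := h.resolventEq_iff.1 hsol φ hφ.1
      rw [h.inner_lapSphere_eigenfunction hφ] at e1 e2
      rw [inner_sub_right]
      refine (mul_eq_zero.1 (?_ : (((lam j : ℝ) : ℂ) - z) * _ = 0)).resolve_left
        (sub_ne_zero.2 (hne j))
      linear_combination e1 - e2
  -- The eigenfunction and `0` both solve the equation with right side `0`. They differ in `L²`
  -- because the eigenfunction is nonzero on an open set meeting the leaf, which has positive
  -- measure.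
  · rintro ⟨j, rfl⟩ hz
    obtain ⟨φ, hφ, x, hx, hφx⟩ := h.exists_eigenfunction_ne_zero j
    have h0 : M.ResolventEq ((lam j : ℝ) : ℂ) 0 0 := by
      rw [h.resolventEq_iff]; intro φ hφ; simp
    have h1 : M.ResolventEq ((lam j : ℝ) : ℂ) (h.toL2 hφ.1.continuous) 0 := by
      rw [h.resolventEq_iff]
      intro ψ hψ
      rw [h.inner_lapSphere_of_mem (h.toL2_mem_eigenspaceL2 hφ) hψ, sub_self, inner_zero_right]
    have h2 := (hz 0).unique h1 h0
    rw [toL2, Lp.eq_zero_iff_ae_eq_zero] at h2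
    have h3 : ∀ᵐ y ∂M.unif, φ y = 0 := by
      filter_upwards [h2, (h.memLp_ofReal hφ.1.continuous).coeFn_toLp] with y h4 h5
      rw [h5] at h4
      exact Complex.ofReal_eq_zero.1 h4
    refine h.measure_pos_of_isOpen (U := {y | φ y ≠ 0}) ?_ hx hφx h3
    exact isOpen_ne_fun hφ.1.continuous continuous_const

end IsSphereLeaf

end Spectrum

/-! ### The two physical manifolds as spheres, and the limits of their spectra. -/

section Leaves

open Module

lemma norm_sq_eq_energy {N : ℕ} (x : Vel N) : ‖x‖ ^ 2 = 2 * energy x := by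
  rw [EuclideanSpace.real_norm_sq_eq, Fintype.sum_prod_type, energy]
  ring

lemma inner_translation {N : ℕ} (a : Fin 3) (x : Vel N) :
    (inner ℝ (translation N a) x : ℝ) = momentum x a := by
  simp [translation, momentum, PiLp.inner_apply, Fintype.sum_prod_type]

lemma energyLeaf_isSphereLeaf {N : ℕ} (hN : 1 ≤ N) {ε : ℝ} (hε : 0 < ε) :
    IsSphereLeaf (energyLeaf N ε) ⊤ 0 √(2 * N * ε) := by
  have hN' : (1 : ℝ) ≤ N := by exact_mod_cast hN
  have hfr : finrank ℝ (⊤ : Submodule ℝ (Vel N)) = N * 3 := by simp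
  refine ⟨by positivity, Submodule.zero_mem _, by rw [hfr]; omega, ?_, ?_, fun y => ?_⟩
  · ext x
    have h0 : (0 : ℝ) ≤ 2 * N * ε := by positivity
    have h1 := norm_sq_eq_energy x
    simp only [energyLeaf, Set.mem_ofPred_eq, Submodule.starProjection_top,
      ContinuousLinearMap.id_apply, sub_self, true_and]
    rw [eq_comm (a := ‖x‖), Real.sqrt_eq_iff_mul_self_eq h0 (norm_nonneg _)]
    constructor <;> intro h <;> nlinarith
  · rw [hfr]; simp [energyLeaf]; ring
  · simp [energyLeaf, Submodule.starProjection_top]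

/-- The vector `(u, …, u)`. -/
def uniformVel (N : ℕ) (u : EuclideanSpace ℝ (Fin 3)) : Vel N := WithLp.toLp 2 fun p => u p.2

lemma uniformVel_eq_sum (N : ℕ) (u : EuclideanSpace ℝ (Fin 3)) :
    uniformVel N u = ∑ a, u a • translation N a := by
  ext p
  simp [uniformVel, translation]

lemma momentum_uniformVel (N : ℕ) (u : EuclideanSpace ℝ (Fin 3)) :
    momentum (uniformVel N u) = (N : ℝ) • u := by
  ext a
  simp [uniformVel, momentum]

lemma norm_sq_uniformVel (N : ℕ) (u : EuclideanSpace ℝ (Fin 3)) :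
    ‖uniformVel N u‖ ^ 2 = N * ‖u‖ ^ 2 := by
  rw [EuclideanSpace.real_norm_sq_eq, EuclideanSpace.real_norm_sq_eq, Fintype.sum_prod_type]
  simp [uniformVel]

/-- The velocities with vanishing total momentum. -/
def momentumZero (N : ℕ) : Submodule ℝ (Vel N) :=
  (Submodule.span ℝ (Set.range (translation N)))ᗮ

lemma mem_momentumZero {N : ℕ} {x : Vel N} : x ∈ momentumZero N ↔ momentum x = 0 := by
  rw [momentumZero, Submodule.mem_orthogonal]
  constructor
  · intro h
    ext a
    rw [← inner_translation]
    exact h _ (Submodule.subset_span ⟨a, rfl⟩)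
  · intro h v hv
    induction hv using Submodule.span_induction with
    | mem v hv => obtain ⟨a, rfl⟩ := hv; rw [inner_translation, h]; rfl
    | zero => simp
    | add v w _ _ hv hw => rw [inner_add_left, hv, hw, add_zero]
    | smul r v _ hv => rw [real_inner_smul_left, hv, mul_zero]

lemma finrank_momentumZero {N : ℕ} (hN : 1 ≤ N) : finrank ℝ (momentumZero N) = 3 * N - 3 := by
  have hli : LinearIndependent ℝ (translation N) := by
    rw [Fintype.linearIndependent_iff]
    intro g hg a
    have := congrArg (fun x : Vel N => x (⟨0, hN⟩, a)) hg
    simpa [translation] using this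
  have h1 := (Submodule.span ℝ (Set.range (translation N))).finrank_add_finrank_orthogonal
  rw [finrank_span_eq_card hli] at h1
  simp only [Fintype.card_fin, finrank_euclideanSpace, Fintype.card_prod] at h1
  rw [momentumZero]
  omega

lemma momentum_sub {N : ℕ} (x y : Vel N) : momentum (x - y) = momentum x - momentum y := by
  ext a
  simp [momentum]

lemma uniformVel_mem_orthogonal (N : ℕ) (u : EuclideanSpace ℝ (Fin 3)) :
    uniformVel N u ∈ (momentumZero N)ᗮ := by
  rw [momentumZero, Submodule.orthogonal_orthogonal, uniformVel_eq_sum]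
  exact Submodule.sum_mem _ fun a _ => Submodule.smul_mem _ _ (Submodule.subset_span ⟨a, rfl⟩)

lemma sub_starProjection_eq_uniformVel_iff {N : ℕ} {u : EuclideanSpace ℝ (Fin 3)} {x : Vel N} :
    x - (momentumZero N).starProjection x = uniformVel N u ↔ momentum x = (N : ℝ) • u := by
  constructor
  · intro h
    have h1 := mem_momentumZero.1 (Submodule.starProjection_apply_mem (momentumZero N) x)
    have h2 : momentum (x - (momentumZero N).starProjection x) = (N : ℝ) • u := by
      rw [h, momentum_uniformVel]
    rwa [momentum_sub, h1, sub_zero] at h2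
  · intro h
    have h1 : x - uniformVel N u ∈ momentumZero N := by
      rw [mem_momentumZero, momentum_sub, h, momentum_uniformVel, sub_self]
    have h2 := Submodule.starProjection_eq_self_iff.2 h1
    rw [map_sub, (Submodule.starProjection_apply_eq_zero_iff _).2 (uniformVel_mem_orthogonal N u),
      sub_zero] at h2
    rw [h2]
    abel

/-- Fixing the momentum fixes the component orthogonal to `momentumZero N` to be `(u, …, u)`, of
squared norm `N‖u‖²`. By Pythagoras the energy constraint then reads `‖Px‖² = 2Nε₀`. For `N ≥ 2` the
dimension `3N - 3` is at least `3`. -/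
lemma energyMomentumLeaf_isSphereLeaf {N : ℕ} (hN : 2 ≤ N) (u : EuclideanSpace ℝ (Fin 3))
    {ε ε₀ : ℝ} (hε : ‖u‖ ^ 2 / 2 < ε) (hε₀ : ε₀ = ε - ‖u‖ ^ 2 / 2) :
    IsSphereLeaf (energyMomentumLeaf N u ε) (momentumZero N) (uniformVel N u) √(2 * N * ε₀) := by
  have hN' : (2 : ℝ) ≤ N := by exact_mod_cast hN
  have hpos : 0 < ε₀ := by linarith
  have hfr := finrank_momentumZero (N := N) (by omega)
  refine ⟨by positivity, uniformVel_mem_orthogonal N u, by rw [hfr]; omega, ?_, ?_, fun y => ?_⟩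
  · ext x
    have h0 : (0 : ℝ) ≤ 2 * N * ε₀ := by positivity
    have h1 := norm_sq_eq_energy x
    simp only [energyMomentumLeaf, Set.mem_ofPred_eq]
    rw [sub_starProjection_eq_uniformVel_iff, and_congr_right_iff]
    intro hx
    have h2 := sub_starProjection_eq_uniformVel_iff.2 hx
    have h3 : inner ℝ ((momentumZero N).starProjection x) (uniformVel N u) = (0 : ℝ) :=
      uniformVel_mem_orthogonal N u _ (Submodule.starProjection_apply_mem _ _)
    have h4 : x = (momentumZero N).starProjection x + uniformVel N u := by rw [← h2]; abel
    have h5 : ‖x‖ ^ 2 = ‖(momentumZero N).starProjection x‖ ^ 2 + N * ‖u‖ ^ 2 := by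
      nth_rw 1 [h4]
      rw [norm_add_sq_real, h3, norm_sq_uniformVel]
      ring
    rw [eq_comm (b := √(2 * N * ε₀)), Real.sqrt_eq_iff_mul_self_eq h0 (norm_nonneg _)]
    constructor <;> intro h <;> nlinarith
  · rw [hfr, Nat.cast_sub (by omega)]
    simp [energyMomentumLeaf]
    ring
  · ext v
    simp only [energyMomentumLeaf]
    rw [Submodule.span_union, ← Submodule.inf_orthogonal, inf_comm, ← momentumZero,
      Submodule.mem_inf, Submodule.mem_inf, and_congr_right_iff]
    intro hv
    rw [Submodule.mem_orthogonal_singleton_iff_inner_right,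
      Submodule.mem_orthogonal_singleton_iff_inner_right]
    have := Submodule.starProjection_inner_eq_zero (K := momentumZero N) y v hv
    rw [inner_sub_left, sub_eq_zero] at this
    rw [this]

/-- Here `k` is the codimension of `W N`, namely `0` or `3`. Hypothesis `hk` keeps the numerator of
`ev N j` at least `j * N` for `j ≥ 1`, which yields a lower bound on the spectrum uniform in `N`. -/
lemma spectraConverge_of_isSphereLeaf {M : (N : ℕ) → Leaf N} {N₀ : ℕ} {ev : ℕ → ℕ → ℝ} {ε k : ℝ}
    (hε : 0 < ε) {W : (N : ℕ) → Submodule ℝ (Vel N)} {c : (N : ℕ) → Vel N} (hN₀ : 1 ≤ N₀)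
    (hM : ∀ N, N₀ ≤ N → IsSphereLeaf (M N) (W N) (c N) √(2 * N * ε))
    (hW : ∀ N, N₀ ≤ N → (finrank ℝ (W N) : ℝ) = 3 * N - k)
    (hk : ∀ N : ℕ, N₀ ≤ N → (N : ℝ) ≤ 3 * N - k - 1)
    (hev : ∀ N j : ℕ, ev N j = j * (j + (3 * N - k) - 2) / (2 * N * ε)) :
    SpectraConverge M N₀ ev ε := by
  have hNpos : ∀ N, N₀ ≤ N → (0 : ℝ) < N := fun N hN => by
    exact_mod_cast (by omega : 0 < N)
  have hev' : ∀ N, N₀ ≤ N → ev N = sphereEigenvalue (finrank ℝ (W N)) √(2 * N * ε) := by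
    intro N hN
    have := hNpos N hN
    ext j
    rw [hev, sphereEigenvalue, hW N hN, Real.sq_sqrt (by positivity)]
  have hspec : ∀ N, N₀ ≤ N → (M N).spectrum = Set.range (fun j : ℕ => ((ev N j : ℝ) : ℂ)) := by
    intro N hN
    rw [(hM N hN).spectrum_eq, hev' N hN]
  have hlow : ∀ N, N₀ ≤ N → ∀ j : ℕ, (j : ℝ) / (2 * ε) ≤ ev N j := by
    intro N hN j
    have h1 := hNpos N hN
    rw [hev, div_le_div_iff₀ (by positivity) (by positivity)]
    rcases Nat.eq_zero_or_pos j with rfl | hj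
    · simp
    · have hj' : (1 : ℝ) ≤ j := by exact_mod_cast hj
      have h2 : (N : ℝ) ≤ j + (3 * N - k) - 2 := by linarith [hk N hN]
      have h3 : (0 : ℝ) ≤ 2 * ε * j := by positivity
      nlinarith [mul_le_mul_of_nonneg_left h2 h3]
  have hlim : ∀ j : ℕ, Tendsto (fun N => ev N j) atTop (𝓝 (3 * (j : ℝ) / (2 * ε))) := by
    intro j
    have h1 : Tendsto (fun N : ℕ => j * (j - k - 2) / (2 * ε) * ((N : ℝ))⁻¹ + 3 * (j : ℝ) / (2 * ε))
        atTop (𝓝 (j * (j - k - 2) / (2 * ε) * 0 + 3 * (j : ℝ) / (2 * ε))) :=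
      (tendsto_natCast_atTop_atTop.inv_tendsto_atTop.const_mul _).add_const _
    rw [mul_zero, zero_add] at h1
    refine h1.congr' ?_
    filter_upwards [eventually_ge_atTop N₀] with N hN
    have := hNpos N hN
    rw [hev]
    field_simp
    ring
  refine ⟨fun N hN => ⟨hspec N hN, fun j => ?_, ?_, ?_⟩, hlim, ?_, ?_⟩
  · rw [hev' N hN]
    exact (hM N hN).isEigenvalue j
  · rw [hev]; simp
  · rw [hev' N hN]
    exact sphereEigenvalue_strictMono (hM N hN).three_le_cast (hM N hN).radius_pos
  · intro z hz w hw
    by_contra! hcon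
    -- By the uniform bound, eigenvalues with index at least `J` stay outside the unit ball about
    -- `w`. Only finitely many indices remain, and each of these sequences converges to a limit
    -- different from `w`.
    obtain ⟨J, hJ⟩ := exists_nat_gt ((‖w‖ + 1) * (2 * ε))
    have hsep : ∀ j : ℕ, ∃ U ∈ 𝓝 w, ∀ᶠ N in atTop, ((ev N j : ℝ) : ℂ) ∉ U := by
      intro j
      obtain ⟨U, hU, V, hV, hUV⟩ := Filter.disjoint_iff.1 (disjoint_nhds_nhds.2 (hcon j))
      refine ⟨U, hU, ?_⟩
      have h1 : Tendsto (fun N => ((ev N j : ℝ) : ℂ)) atTop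
          (𝓝 ((3 * (j : ℝ) / (2 * ε) : ℝ) : ℂ)) :=
        (Complex.continuous_ofReal.tendsto _).comp (hlim j)
      filter_upwards [h1 hV] with N hN hNU
      exact Set.disjoint_left.1 hUV hNU hN
    choose U hU hUev using hsep
    have hmem : Metric.ball w 1 ∩ ⋂ j ∈ Finset.range J, U j ∈ 𝓝 w :=
      inter_mem (Metric.ball_mem_nhds w one_pos)
        ((Filter.biInter_finset_mem _).2 fun j _ => hU j)
    have hfreq := mapClusterPt_iff_frequently.1 hw _ hmem
    have hevent : ∀ᶠ N in atTop, ∀ j ∈ Finset.range J, ((ev N j : ℝ) : ℂ) ∉ U j :=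
      (Filter.eventually_all_finset _).2 fun j _ => hUev j
    obtain ⟨N, ⟨hN1, hN2⟩, hN3, hN4⟩ :=
      (hfreq.and_eventually (hevent.and (eventually_ge_atTop N₀))).exists
    have hzN := hz N hN4
    rw [hspec N hN4] at hzN
    obtain ⟨j, hj⟩ := hzN
    simp only at hj
    rcases lt_or_ge j J with hjJ | hjJ
    · refine hN3 j (Finset.mem_range.2 hjJ) ?_
      rw [hj]
      exact Set.mem_iInter₂.1 hN2 j (Finset.mem_range.2 hjJ)
    · rw [Metric.mem_ball, dist_eq_norm, ← hj] at hN1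
      have h1 := norm_sub_norm_le ((ev N j : ℝ) : ℂ) w
      rw [Complex.norm_real, Real.norm_eq_abs] at h1
      have h2 := le_abs_self (ev N j)
      have h3 := hlow N hN4 j
      have h4 : ‖w‖ + 1 < (j : ℝ) / (2 * ε) := by
        rw [lt_div_iff₀ (by positivity)]
        have : (J : ℝ) ≤ j := by exact_mod_cast hjJ
        linarith
      linarith
  · refine ⟨1 / (2 * ε), by positivity, fun N hN z hz hz0 => ?_⟩
    rw [hspec N hN] at hz
    obtain ⟨j, rfl⟩ := hz
    simp only [Complex.ofReal_re]
    have hj : 1 ≤ j := by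
      rcases Nat.eq_zero_or_pos j with rfl | hj
      · exact absurd (by simp [hev]) hz0
      · exact hj
    refine le_trans ?_ (hlow N hN j)
    gcongr
    exact_mod_cast hj

lemma spectraConverge_energyLeaf {ε : ℝ} (hε : 0 < ε) :
    SpectraConverge (fun N => energyLeaf N ε) 1 (energyEigenvalue ε) ε := by
  refine spectraConverge_of_isSphereLeaf (k := 0) hε le_rfl
    (fun N hN => energyLeaf_isSphereLeaf hN hε) (fun N _ => ?_) (fun N hN => ?_) fun N j => ?_
  · simp; ring
  · have : (1 : ℝ) ≤ N := by exact_mod_cast hN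
    linarith
  · rw [energyEigenvalue]; ring

lemma spectraConverge_energyMomentumLeaf (u : EuclideanSpace ℝ (Fin 3)) {ε ε₀ : ℝ}
    (hε : ‖u‖ ^ 2 / 2 < ε) (hε₀ : ε₀ = ε - ‖u‖ ^ 2 / 2) :
    SpectraConverge (fun N => energyMomentumLeaf N u ε) 2 (energyMomentumEigenvalue ε₀) ε₀ := by
  refine spectraConverge_of_isSphereLeaf (k := 3) (by linarith) one_le_two
    (fun N hN => energyMomentumLeaf_isSphereLeaf hN u hε hε₀) (fun N hN => ?_) (fun N hN => ?_)
    fun N j => ?_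
  · rw [finrank_momentumZero (by omega), Nat.cast_sub (by omega)]
    push_cast; ring
  · have : (2 : ℝ) ≤ N := by exact_mod_cast hN
    linarith
  · rw [energyMomentumEigenvalue]; ring

end Leaves

/-! ### Hermite polynomials and the standard Gaussian on the line. -/

section HermiteOneDim

open ProbabilityTheory Polynomial

lemma integrable_eval_gaussianReal (q : ℝ[X]) :
    Integrable (fun x => q.eval x) (gaussianReal 0 1) := by
  induction q using Polynomial.induction_on' with
  | add p q hp hq => exact (hp.add hq).congr (ae_of_all _ fun x => by simp)
  | monomial k a =>
    simp only [eval_monomial]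
    refine Integrable.const_mul ?_ a
    have h := (memLp_id_gaussianReal (μ := 0) (v := 1) (k : NNReal)).integrable_norm_pow'
    refine Integrable.mono' h (by fun_prop) (ae_of_all _ fun x => ?_)
    simp

lemma integrable_eval_mul_exp_gaussianReal (q : ℝ[X]) (ξ : ℝ) :
    Integrable (fun x : ℝ => ((q.eval x : ℝ) : ℂ) * Complex.exp (x * ξ * Complex.I))
      (gaussianReal 0 1) := by
  refine (integrable_eval_gaussianReal q).norm.mono' ?_ (ae_of_all _ fun x => ?_)
  · refine Continuous.aestronglyMeasurable ?_
    have := q.continuous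
    fun_prop
  · rw [norm_mul, ← Complex.ofReal_mul, Complex.norm_exp_ofReal_mul_I, mul_one,
      Complex.norm_real]

lemma integrable_gaussianPDFReal_smul {f : ℝ → ℂ} (hf : Integrable f (gaussianReal 0 1)) :
    Integrable (fun x => gaussianPDFReal 0 1 x • f x) := by
  rw [gaussianReal_of_var_ne_zero 0 one_ne_zero, integrable_withDensity_iff_integrable_smul'
    (measurable_gaussianPDF 0 1) (ae_of_all _ fun _ => gaussianPDF_lt_top)] at hf
  simpa only [toReal_gaussianPDF] using hf

lemma hasDerivAt_gaussianPDFReal (x : ℝ) :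
    HasDerivAt (gaussianPDFReal 0 1) (-x * gaussianPDFReal 0 1 x) x := by
  have h : HasDerivAt (fun x : ℝ => (√(2 * Real.pi * (1 : NNReal)))⁻¹ *
      Real.exp (-(x - 0) ^ 2 / (2 * (1 : NNReal)))) (-x * gaussianPDFReal 0 1 x) x := by
    have h1 : HasDerivAt (fun x : ℝ => -(x - 0) ^ 2 / (2 * ((1 : NNReal) : ℝ))) (-x) x := by
      have := (((hasDerivAt_id x).sub_const 0).pow 2).neg.div_const (2 * ((1 : NNReal) : ℝ))
      refine this.congr_deriv ?_
      simp
      ring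
    have := h1.exp.const_mul (√(2 * Real.pi * (1 : NNReal)))⁻¹
    refine this.congr_deriv ?_
    simp only [gaussianPDFReal]
    ring
  exact h

/-- Gaussian integration by parts against a polynomial times a character. -/
lemma integral_stein_gaussianReal (q : ℝ[X]) (ξ : ℝ) :
    ∫ x : ℝ, (((X * q - derivative q).eval x : ℝ) : ℂ) * Complex.exp (x * ξ * Complex.I)
        ∂(gaussianReal 0 1)
      = ξ * Complex.I * ∫ x : ℝ, ((q.eval x : ℝ) : ℂ) * Complex.exp (x * ξ * Complex.I)
        ∂(gaussianReal 0 1) := by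
  set e : ℝ → ℂ := fun x => Complex.exp (x * ξ * Complex.I) with he
  have hed : ∀ x, HasDerivAt e (ξ * Complex.I * e x) x := by
    intro x
    have h1 : HasDerivAt (fun x : ℝ => (x : ℂ) * ξ * Complex.I) (1 * ξ * Complex.I) x :=
      ((Complex.ofRealCLM.hasDerivAt (x := x)).mul_const (ξ : ℂ)).mul_const Complex.I
    convert h1.cexp using 1
    rw [he]; ring
  have hqd : ∀ x, HasDerivAt (fun x => ((q.eval x : ℝ) : ℂ)) ((derivative q).eval x : ℝ) x :=
    fun x => (q.hasDerivAt x).ofReal_comp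
  have hρ : ∀ x, HasDerivAt (fun x => ((gaussianPDFReal 0 1 x : ℝ) : ℂ))
      ((-x * gaussianPDFReal 0 1 x : ℝ) : ℂ) x :=
    fun x => (hasDerivAt_gaussianPDFReal x).ofReal_comp
  have hint := integrable_eval_mul_exp_gaussianReal
  -- The integral over the line of the derivative of density times polynomial times character
  -- vanishes; the derivative of the density produces the factor `-x`.
  have key := integral_eq_zero_of_hasDerivAt_of_integrable
    (f := fun x => ((gaussianPDFReal 0 1 x : ℝ) : ℂ) * (((q.eval x : ℝ) : ℂ) * e x))
    (f' := fun x => gaussianPDFReal 0 1 x • (ξ * Complex.I * (((q.eval x : ℝ) : ℂ) * e x)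
      - (((X * q - derivative q).eval x : ℝ) : ℂ) * e x)) ?_ ?_ ?_
  · rw [← integral_gaussianReal_eq_integral_smul one_ne_zero, integral_sub, integral_const_mul,
      sub_eq_zero] at key
    · exact key.symm
    · exact (hint q ξ).const_mul _
    · exact hint _ ξ
  · intro x
    refine ((hρ x).mul ((hqd x).mul (hed x))).congr_deriv ?_
    simp only [eval_sub, eval_mul, eval_X, Complex.real_smul, Pi.mul_apply]
    push_cast
    ring
  · exact integrable_gaussianPDFReal_smul (((hint q ξ).const_mul _).sub (hint _ ξ))
  · exact integrable_gaussianPDFReal_smul (hint q ξ)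

/-- The probabilists' Hermite polynomial over `ℝ`. -/
def realHermite (m : ℕ) : ℝ[X] := (hermite m).map (Int.castRingHom ℝ)

lemma aeval_hermite (m : ℕ) (x : ℝ) : aeval x (hermite m) = (realHermite m).eval x := by
  rw [realHermite, ← eval_map_algebraMap]
  rfl

lemma realHermite_zero : realHermite 0 = 1 := by simp [realHermite]

lemma realHermite_succ (m : ℕ) :
    realHermite (m + 1) = X * realHermite m - derivative (realHermite m) := by
  simp [realHermite, hermite_succ, derivative_map]

lemma derivative_realHermite_succ (m : ℕ) :
    derivative (realHermite (m + 1)) = (m + 1 : ℝ[X]) * realHermite m := by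
  induction m with
  | zero => simp [realHermite_succ, realHermite_zero]
  | succ m ih =>
    rw [realHermite_succ (m + 1), derivative_sub, derivative_mul, derivative_X, ih]
    have : derivative ((m + 1 : ℝ[X]) * realHermite m) = (m + 1) * derivative (realHermite m) := by
      simp [derivative_mul]
    rw [this, realHermite_succ m]
    push_cast
    ring

/-- For `m = 0` the truncated index `m - 1` is harmless, since its coefficient is `0`. -/
lemma X_mul_realHermite (m : ℕ) :
    X * realHermite m = realHermite (m + 1) + (m : ℝ[X]) * realHermite (m - 1) := by
  rw [realHermite_succ]
  rcases m with _ | m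
  · simp [realHermite_zero]
  · rw [derivative_realHermite_succ]
    push_cast
    simp

/-- Each application of `X - D`, which raises the Hermite degree, multiplies the Fourier transform
by `iξ`. -/
lemma charFun_realHermite (m : ℕ) (ξ : ℝ) :
    ∫ x : ℝ, (((realHermite m).eval x : ℝ) : ℂ) * Complex.exp (x * ξ * Complex.I)
      ∂(gaussianReal 0 1) = (ξ * Complex.I) ^ m * Complex.exp (-(ξ ^ 2 / 2)) := by
  induction m with
  | zero =>
    have := charFun_gaussianReal (μ := 0) (v := 1) ξ
    rw [charFun_apply_real] at this
    simp only [realHermite_zero, eval_one, Complex.ofReal_one, one_mul, pow_zero]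
    simpa [mul_comm, neg_div] using this
  | succ m ih =>
    rw [realHermite_succ, integral_stein_gaussianReal, ih]
    ring

lemma integral_stein_real (q : ℝ[X]) :
    ∫ x, (X * q - derivative q).eval x ∂(gaussianReal 0 1) = 0 := by
  have := integral_stein_gaussianReal q 0
  simp only [Complex.ofReal_zero, mul_zero, zero_mul, Complex.exp_zero, mul_one] at this
  rw [integral_complex_ofReal] at this
  exact_mod_cast this

lemma integral_realHermite_succ_mul (m : ℕ) (r : ℝ[X]) :
    ∫ x, (realHermite (m + 1) * r).eval x ∂(gaussianReal 0 1)
      = ∫ x, (realHermite m * derivative r).eval x ∂(gaussianReal 0 1) := by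
  have h := integral_stein_real (realHermite m * r)
  have h2 : X * (realHermite m * r) - derivative (realHermite m * r)
      = realHermite (m + 1) * r - realHermite m * derivative r := by
    rw [realHermite_succ, derivative_mul]; ring
  rw [h2] at h
  simp only [eval_sub] at h
  rwa [integral_sub (integrable_eval_gaussianReal _) (integrable_eval_gaussianReal _),
    sub_eq_zero] at h

/-- `X - D` is the adjoint of `D` for the Gaussian, and `D` lowers the degree by `H'_{k+1} = (k + 1)
H_k`. Induction lowers both indices together, and the factors `k + 1` build the factorial. -/
lemma integral_realHermite_mul (m k : ℕ) :
    ∫ x, (realHermite m).eval x * (realHermite k).eval x ∂(gaussianReal 0 1)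
      = if m = k then (m.factorial : ℝ) else 0 := by
  simp only [← eval_mul]
  induction m generalizing k with
  | zero =>
    rcases k with _ | k
    · simp [realHermite_zero]
    · have := integral_realHermite_succ_mul k 1
      simp only [mul_one, derivative_one, mul_zero, eval_zero, integral_zero] at this
      simp [realHermite_zero, this]
  | succ m ih =>
    rw [integral_realHermite_succ_mul]
    rcases k with _ | k
    · simp [realHermite_zero]
    · rw [derivative_realHermite_succ]
      have : ∀ x, (realHermite m * ((k + 1 : ℝ[X]) * realHermite k)).eval x
          = (k + 1 : ℝ) * (realHermite m * realHermite k).eval x := by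
        intro x; simp; ring
      simp only [this]
      rw [integral_const_mul, ih]
      rcases eq_or_ne m k with rfl | h
      · simp [Nat.factorial_succ]
      · simp [h]

end HermiteOneDim

/-! ### The Maxwellian as an affine image of a product of standard Gaussians. -/

section Maxwell

open ProbabilityTheory Polynomial

variable {n : ℕ} {u : EuclideanSpace ℝ (Fin 3)} {ε : ℝ}

/-- The standard deviation `√(2 ε / 3)` of a velocity component. -/
def thermalSpeed (ε : ℝ) : ℝ := √(2 * ε / 3)

lemma thermalSpeed_pos (hε : 0 < ε) : 0 < thermalSpeed ε := by
  unfold thermalSpeed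
  positivity

lemma thermalSpeed_sq (hε : 0 < ε) : thermalSpeed ε ^ 2 = 2 * ε / 3 :=
  Real.sq_sqrt (by positivity)

/-- The affine map from standardized variables to velocities. -/
def velOfStd (n : ℕ) (u : EuclideanSpace ℝ (Fin 3)) (ε : ℝ) (x : Fin n × Fin 3 → ℝ) : Vel n :=
  WithLp.toLp 2 fun p => u p.2 + thermalSpeed ε * x p

lemma continuous_velOfStd : Continuous (velOfStd n u ε) := by
  unfold velOfStd
  fun_prop

lemma maxwellian_eq_prod (hε : 0 < ε) (v : Vel n) :
    maxwellian n u ε v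
      = ∏ p : Fin n × Fin 3, gaussianPDFReal (u p.2) (Real.toNNReal (2 * ε / 3)) (v p) := by
  have hs : ((Real.toNNReal (2 * ε / 3) : NNReal) : ℝ) = 2 * ε / 3 :=
    Real.coe_toNNReal _ (by positivity)
  rw [maxwellian, Fintype.prod_prod_type]
  refine Finset.prod_congr rfl fun k _ => ?_
  simp only [gaussianPDFReal, hs, Finset.prod_mul_distrib, Finset.prod_const, Finset.card_univ,
    Fintype.card_fin, ← Real.exp_sum]
  congr 1
  · rw [Real.sqrt_eq_rpow, ← Real.rpow_neg (by positivity), ← Real.rpow_mul_natCast (by positivity),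
      show 3 / (4 * Real.pi * ε) = (2 * Real.pi * (2 * ε / 3))⁻¹ by field_simp; norm_num,
      Real.inv_rpow (by positivity), ← Real.rpow_neg (by positivity)]
    norm_num
  · congr 1
    rw [Finset.mul_sum]
    refine Finset.sum_congr rfl fun a _ => ?_
    field_simp
    ring

lemma maxwellian_pos (hε : 0 < ε) (v : Vel n) : 0 < maxwellian n u ε v := by
  rw [maxwellian_eq_prod hε]
  refine Finset.prod_pos fun p _ => gaussianPDFReal_pos _ _ _ ?_
  simp only [ne_eq, Real.toNNReal_eq_zero, not_le]
  positivity

lemma continuous_maxwellian : Continuous (maxwellian n u ε) := by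
  unfold maxwellian
  fun_prop

lemma integral_maxwellian_mul_prod (hε : 0 < ε) (F : Fin n × Fin 3 → ℝ → ℂ) :
    ∫ v : Vel n, maxwellian n u ε v • ∏ p, F p (v p)
      = ∏ p, ∫ x, F p x ∂(gaussianReal (u p.2) (Real.toNNReal (2 * ε / 3))) := by
  have hne : Real.toNNReal (2 * ε / 3) ≠ 0 := by
    simp only [ne_eq, Real.toNNReal_eq_zero, not_le]; positivity
  rw [← (PiLp.volume_preserving_toLp (Fin n × Fin 3)).integral_comp
    (MeasurableEquiv.toLp 2 _).measurableEmbedding]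
  simp only [maxwellian_eq_prod hε, Complex.real_smul, Complex.ofReal_prod,
    ← Finset.prod_mul_distrib]
  rw [integral_fintype_prod_volume_eq_prod
    (fun p x => ((gaussianPDFReal (u p.2) (Real.toNNReal (2 * ε / 3)) x : ℝ) : ℂ) * F p x)]
  refine Finset.prod_congr rfl fun p _ => ?_
  rw [integral_gaussianReal_eq_integral_smul hne]
  rfl

lemma integrable_maxwellian (hε : 0 < ε) : Integrable (maxwellian n u ε) := by
  rw [← (PiLp.volume_preserving_toLp (Fin n × Fin 3)).integrable_comp_emb
    (MeasurableEquiv.toLp 2 _).measurableEmbedding]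
  refine (Integrable.fintype_prod (𝕜 := ℝ) (f := fun (p : Fin n × Fin 3) x =>
    gaussianPDFReal (u p.2) (Real.toNNReal (2 * ε / 3)) x) (μ := fun _ => volume)
    fun p => integrable_gaussianPDFReal _ _).congr (ae_of_all _ fun x => ?_)
  exact (maxwellian_eq_prod hε _).symm

lemma isFiniteMeasure_maxwellMeasure (hε : 0 < ε) : IsFiniteMeasure (maxwellMeasure n u ε) :=
  isFiniteMeasure_withDensity (integrable_maxwellian hε).lintegral_lt_top.ne

lemma integral_maxwellMeasure {F : Type*} [NormedAddCommGroup F] [NormedSpace ℝ F] (hε : 0 < ε)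
    (f : Vel n → F) : ∫ v, f v ∂(maxwellMeasure n u ε) = ∫ v, maxwellian n u ε v • f v := by
  rw [maxwellMeasure, integral_withDensity_eq_integral_toReal_smul
    continuous_maxwellian.measurable.ennreal_ofReal (ae_of_all _ fun _ => ENNReal.ofReal_lt_top)]
  simp only [ENNReal.toReal_ofReal (maxwellian_pos hε _).le]

/-- Both characteristic functions factor over the coordinates, and each factor is that of an affine
image of a standard Gaussian. -/
lemma maxwellMeasure_eq_map (hε : 0 < ε) :
    maxwellMeasure n u ε
      = (Measure.pi fun _ : Fin n × Fin 3 => gaussianReal 0 1).map (velOfStd n u ε) := by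
  have := isFiniteMeasure_maxwellMeasure (n := n) (u := u) hε
  have hm : Measurable (velOfStd n u ε) := continuous_velOfStd.measurable
  have : IsFiniteMeasure ((Measure.pi fun _ : Fin n × Fin 3 => gaussianReal 0 1).map
    (velOfStd n u ε)) := Measure.isFiniteMeasure_map _ _
  refine Measure.ext_of_charFun (funext fun t => ?_)
  rw [charFun_apply, charFun_apply, integral_maxwellMeasure hε,
    integral_map hm.aemeasurable (Continuous.aestronglyMeasurable (by fun_prop))]
  have h1 : ∀ v : Vel n, Complex.exp ((inner ℝ v t : ℝ) * Complex.I)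
      = ∏ p, Complex.exp (v p * t p * Complex.I) := by
    intro v
    rw [← Complex.exp_sum, ← Finset.sum_mul, PiLp.inner_apply]
    push_cast
    simp [mul_comm]
  simp only [h1]
  rw [integral_maxwellian_mul_prod hε (fun p x => Complex.exp (x * t p * Complex.I))]
  have h2 := integral_fintype_prod_eq_prod (𝕜 := ℂ) (μ := fun _ : Fin n × Fin 3 => gaussianReal 0 1)
    (fun p x => Complex.exp ((u p.2 + thermalSpeed ε * x : ℝ) * t p * Complex.I))
  refine Eq.trans ?_ h2.symm
  refine Finset.prod_congr rfl fun p _ => ?_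
  have h3 : gaussianReal (u p.2) (Real.toNNReal (2 * ε / 3))
      = (gaussianReal 0 1).map (fun x => u p.2 + thermalSpeed ε * x) := by
    have e1 : (gaussianReal 0 1).map (fun x => thermalSpeed ε * x)
        = gaussianReal 0 (Real.toNNReal (2 * ε / 3)) := by
      rw [gaussianReal_map_const_mul, mul_zero, mul_one]
      congr 1
      ext
      rw [Real.coe_toNNReal _ (by positivity), ← thermalSpeed_sq hε]
      rfl
    have e2 := gaussianReal_map_const_add (μ := 0) (v := Real.toNNReal (2 * ε / 3)) (u p.2)
    rw [← e1, Measure.map_map (by fun_prop) (by fun_prop), zero_add] at e2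
    exact e2.symm
  rw [h3, integral_map (by fun_prop) (Continuous.aestronglyMeasurable (by fun_prop))]

lemma isProbabilityMeasure_maxwellMeasure (hε : 0 < ε) :
    IsProbabilityMeasure (maxwellMeasure n u ε) := by
  rw [maxwellMeasure_eq_map hε]
  exact Measure.isProbabilityMeasure_map continuous_velOfStd.measurable.aemeasurable

/-- The standardized variables. -/
def stdOfVel (u : EuclideanSpace ℝ (Fin 3)) (ε : ℝ) (v : Vel n) (p : Fin n × Fin 3) : ℝ :=
  (v p - u p.2) / thermalSpeed ε

lemma stdOfVel_velOfStd (hε : 0 < ε) (x : Fin n × Fin 3 → ℝ) :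
    stdOfVel u ε (velOfStd n u ε x) = x := by
  have := (thermalSpeed_pos hε).ne'
  ext p
  simp only [stdOfVel, velOfStd]
  field_simp
  ring

lemma hermiteProd_eq (m : Fin n × Fin 3 → ℕ) (v : Vel n) :
    hermiteProd u ε m v = ∏ p, (realHermite (m p)).eval (stdOfVel u ε v p) := by
  simp only [hermiteProd, aeval_hermite]
  rfl

lemma continuous_hermiteProd (m : Fin n × Fin 3 → ℕ) : Continuous (hermiteProd u ε m) := by
  unfold hermiteProd
  refine continuous_finsetProd _ fun p _ => ?_
  exact (Polynomial.continuous_aeval _).comp (by fun_prop)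

lemma integrable_prod_eval_maxwellMeasure (hε : 0 < ε) (q : Fin n × Fin 3 → ℝ[X]) :
    Integrable (fun v => ∏ p, (q p).eval (stdOfVel u ε v p)) (maxwellMeasure n u ε) := by
  rw [maxwellMeasure_eq_map hε, integrable_map_measure _ continuous_velOfStd.measurable.aemeasurable]
  · refine (Integrable.fintype_prod (𝕜 := ℝ) (f := fun (p : Fin n × Fin 3) x => (q p).eval x)
      (μ := fun _ => gaussianReal 0 1) fun p => integrable_eval_gaussianReal _).congr
      (ae_of_all _ fun x => ?_)
    simp only [Function.comp, stdOfVel_velOfStd hε]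
  · refine Continuous.aestronglyMeasurable (continuous_finsetProd _ fun p _ => ?_)
    refine (q p).continuous.comp ?_
    unfold stdOfVel
    fun_prop

lemma memLp_hermiteProd (hε : 0 < ε) (m : Fin n × Fin 3 → ℕ) :
    MemLp (hermiteProd u ε m) 2 (maxwellMeasure n u ε) := by
  rw [memLp_two_iff_integrable_sq (continuous_hermiteProd m).aestronglyMeasurable]
  refine (integrable_prod_eval_maxwellMeasure hε fun p => realHermite (m p) ^ 2).congr
    (ae_of_all _ fun v => ?_)
  simp only [hermiteProd_eq, eval_pow, Finset.prod_pow]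

lemma integral_hermiteProd_mul (hε : 0 < ε) (m k : Fin n × Fin 3 → ℕ) :
    ∫ v, hermiteProd u ε m v * hermiteProd u ε k v ∂(maxwellMeasure n u ε)
      = if m = k then ∏ p, ((m p).factorial : ℝ) else 0 := by
  rw [maxwellMeasure_eq_map hε, integral_map continuous_velOfStd.measurable.aemeasurable
    (Continuous.aestronglyMeasurable (by have := continuous_hermiteProd (u := u) (ε := ε) m; have := continuous_hermiteProd (u := u) (ε := ε) k; fun_prop))]
  simp only [hermiteProd_eq, stdOfVel_velOfStd hε, ← Finset.prod_mul_distrib]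
  rw [integral_fintype_prod_eq_prod (𝕜 := ℝ)
    (fun p x => (realHermite (m p)).eval x * (realHermite (k p)).eval x)]
  simp only [integral_realHermite_mul]
  split_ifs with h
  · simp [h]
  · obtain ⟨p, hp⟩ := Function.ne_iff.1 h
    exact Finset.prod_eq_zero (Finset.mem_univ p) (if_neg hp)

/-- The characteristic function of a Hermite mode. -/
lemma integral_exp_mul_hermiteProd (hε : 0 < ε) (m : Fin n × Fin 3 → ℕ) (ξ : Vel n) :
    ∫ v, Complex.exp ((inner ℝ v ξ : ℝ) * Complex.I) * (hermiteProd u ε m v : ℂ)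
        ∂(maxwellMeasure n u ε)
      = Complex.exp ((inner ℝ (uniformVel n u) ξ : ℝ) * Complex.I)
        * ((∏ p, (thermalSpeed ε * ξ p * Complex.I) ^ m p)
          * Complex.exp (-((thermalSpeed ε * ‖ξ‖) ^ 2 / 2 : ℝ))) := by
  have hc := continuous_hermiteProd (u := u) (ε := ε) m
  rw [maxwellMeasure_eq_map hε, integral_map continuous_velOfStd.measurable.aemeasurable
    (Continuous.aestronglyMeasurable (by fun_prop))]
  simp only [hermiteProd_eq, stdOfVel_velOfStd hε]
  have h1 : ∀ x : Fin n × Fin 3 → ℝ,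
      Complex.exp ((inner ℝ (velOfStd n u ε x) ξ : ℝ) * Complex.I)
        * ((∏ p, (realHermite (m p)).eval (x p) : ℝ) : ℂ)
      = Complex.exp ((inner ℝ (uniformVel n u) ξ : ℝ) * Complex.I) *
        ∏ p, (((realHermite (m p)).eval (x p) : ℝ) : ℂ)
          * Complex.exp (x p * (thermalSpeed ε * ξ p : ℝ) * Complex.I) := by
    intro x
    rw [Finset.prod_mul_distrib, ← Complex.exp_sum, Complex.ofReal_prod, mul_comm,
      mul_left_comm, ← Complex.exp_add]
    congr 2
    rw [← Finset.sum_mul, ← add_mul]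
    congr 1
    rw [PiLp.inner_apply, PiLp.inner_apply]
    push_cast
    rw [← Finset.sum_add_distrib]
    refine Finset.sum_congr rfl fun p _ => ?_
    simp [velOfStd, uniformVel]
    ring
  simp only [h1]
  rw [integral_const_mul, integral_fintype_prod_eq_prod (𝕜 := ℂ)
    (fun p x => (((realHermite (m p)).eval x : ℝ) : ℂ)
          * Complex.exp (x * (thermalSpeed ε * ξ p : ℝ) * Complex.I))]
  simp only [charFun_realHermite]
  rw [Finset.prod_mul_distrib, ← Complex.exp_sum]
  congr 3
  · push_cast; rfl
  · rw [mul_pow, EuclideanSpace.real_norm_sq_eq, Finset.mul_sum, Finset.sum_div]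
    push_cast
    rw [← Finset.sum_neg_distrib]
    refine Finset.sum_congr rfl fun p _ => ?_
    ring

end Maxwell

/-! ### Orthogonality and completeness of the Hermite products. -/

section HermiteBasis

open ProbabilityTheory Polynomial

variable {n : ℕ} {u : EuclideanSpace ℝ (Fin 3)} {ε : ℝ}

lemma inner_toLp {α : Type*} {mα : MeasurableSpace α} {μ : Measure α} {f : α → ℝ}
    (hf : MemLp f 2 μ) (g : Lp ℝ 2 μ) : inner ℝ hf.toLp g = ∫ x, f x * g x ∂μ := by
  rw [L2.inner_def]
  refine integral_congr_ae ?_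
  filter_upwards [hf.coeFn_toLp] with x hx
  rw [hx, RCLike.inner_apply, conj_trivial, mul_comm]

lemma integrable_exp_inner_maxwellMeasure (hε : 0 < ε) (ξ : Vel n) :
    Integrable (fun v => Real.exp (inner ℝ v ξ)) (maxwellMeasure n u ε) := by
  rw [maxwellMeasure_eq_map hε, integrable_map_measure
    (Continuous.aestronglyMeasurable (by fun_prop)) continuous_velOfStd.measurable.aemeasurable]
  have h1 := (Integrable.fintype_prod (𝕜 := ℝ)
    (f := fun (p : Fin n × Fin 3) x => Real.exp (thermalSpeed ε * ξ p * x))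
    (μ := fun _ => gaussianReal 0 1) fun p => integrable_exp_mul_gaussianReal _).const_mul
      (Real.exp (inner ℝ (uniformVel n u) ξ))
  refine h1.congr (ae_of_all _ fun x => ?_)
  simp only [Function.comp]
  rw [← Real.exp_sum, ← Real.exp_add]
  congr 1
  rw [PiLp.inner_apply, PiLp.inner_apply, ← Finset.sum_add_distrib]
  refine Finset.sum_congr rfl fun p _ => ?_
  simp [velOfStd, uniformVel]
  ring

/-- The bound is `e^{2|s|} ≤ e^{2s} + e^{-2s}`. It supplies the exponential moments required by the
moment criterion. -/
lemma memLp_exp_abs_inner_maxwellMeasure (hε : 0 < ε) (ξ : Vel n) :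
    MemLp (fun v => Real.exp |inner ℝ v ξ|) 2 (maxwellMeasure n u ε) := by
  rw [memLp_two_iff_integrable_sq (Continuous.aestronglyMeasurable (by fun_prop))]
  refine ((integrable_exp_inner_maxwellMeasure (u := u) hε ((2 : ℝ) • ξ)).add
    (integrable_exp_inner_maxwellMeasure (u := u) hε (-(2 : ℝ) • ξ))).mono'
    (Continuous.aestronglyMeasurable (by fun_prop)) (ae_of_all _ fun v => ?_)
  rw [Real.norm_eq_abs, abs_of_nonneg (by positivity), ← Real.exp_nat_mul]
  simp only [Pi.add_apply, real_inner_smul_right]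
  rcases abs_cases (inner ℝ v ξ : ℝ) with ⟨h, -⟩ | ⟨h, -⟩
  · rw [h]
    push_cast
    exact le_add_of_nonneg_right (Real.exp_nonneg _)
  · rw [h]
    push_cast
    rw [show (2 : ℝ) * -inner ℝ v ξ = -2 * inner ℝ v ξ by ring]
    exact le_add_of_nonneg_left (Real.exp_nonneg _)

lemma hermiteProd_update (m : Fin n × Fin 3 → ℕ) (p : Fin n × Fin 3) (k : ℕ) (v : Vel n) :
    hermiteProd u ε (Function.update m p k) v
      = (realHermite k).eval (stdOfVel u ε v p)
        * ∏ q ∈ Finset.univ.erase p, (realHermite (m q)).eval (stdOfVel u ε v q) := by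
  rw [hermiteProd_eq, ← Finset.mul_prod_erase _ _ (Finset.mem_univ p)]
  congr 1
  · simp
  · refine Finset.prod_congr rfl fun q hq => ?_
    rw [Function.update_of_ne (Finset.ne_of_mem_erase hq)]

lemma stdOfVel_mul_hermiteProd (m : Fin n × Fin 3 → ℕ) (p : Fin n × Fin 3) (v : Vel n) :
    stdOfVel u ε v p * hermiteProd u ε m v
      = hermiteProd u ε (Function.update m p (m p + 1)) v
        + m p * hermiteProd u ε (Function.update m p (m p - 1)) v := by
  have h0 : hermiteProd u ε m v = hermiteProd u ε (Function.update m p (m p)) v := by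
    rw [Function.update_eq_self]
  rw [h0, hermiteProd_update, hermiteProd_update, hermiteProd_update]
  have h := congrArg (fun q : ℝ[X] => q.eval (stdOfVel u ε v p)) (X_mul_realHermite (m p))
  simp only [eval_mul, eval_add, eval_X, eval_natCast] at h
  rw [← mul_assoc, h]
  ring

/-- Multiplication by a coordinate is an affine combination of Hermite products by the three term
recurrence. Hence the span contains all powers of linear forms. -/
lemma coordinate_mul_mem_span (hε : 0 < ε) (p : Fin n × Fin 3) {q : Vel n → ℝ}
    (hq : q ∈ Submodule.span ℝ (Set.range (hermiteProd (n := n) u ε))) :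
    (fun v : Vel n => v p * q v) ∈ Submodule.span ℝ (Set.range (hermiteProd (n := n) u ε)) := by
  have hs := (thermalSpeed_pos hε).ne'
  induction hq using Submodule.span_induction with
  | mem q hq =>
    obtain ⟨m, rfl⟩ := hq
    have : (fun v : Vel n => v p * hermiteProd u ε m v)
        = u p.2 • hermiteProd u ε m
          + thermalSpeed ε • (hermiteProd u ε (Function.update m p (m p + 1))
            + (m p : ℝ) • hermiteProd u ε (Function.update m p (m p - 1))) := by
      ext v
      simp only [Pi.add_apply, Pi.smul_apply, smul_eq_mul]
      rw [← stdOfVel_mul_hermiteProd, stdOfVel]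
      field_simp
      ring
    rw [this]
    have hmem : ∀ m, hermiteProd u ε m ∈ Submodule.span ℝ (Set.range (hermiteProd (n := n) u ε)) :=
      fun m => Submodule.subset_span ⟨m, rfl⟩
    exact Submodule.add_mem _ (Submodule.smul_mem _ _ (hmem _)) (Submodule.smul_mem _ _
      (Submodule.add_mem _ (hmem _) (Submodule.smul_mem _ _ (hmem _))))
  | zero =>
    convert Submodule.zero_mem (Submodule.span ℝ (Set.range (hermiteProd (n := n) u ε))) using 1
    ext v; simp
  | add q r _ _ hq hr =>
    convert Submodule.add_mem _ hq hr using 1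
    ext v; simp [mul_add]
  | smul a q _ hq =>
    convert Submodule.smul_mem _ a hq using 1
    ext v; simp [mul_left_comm]

lemma hermiteProd_zero (v : Vel n) : hermiteProd u ε 0 v = 1 := by
  simp [hermiteProd_eq, realHermite_zero]

lemma inner_pow_mem_span (hε : 0 < ε) (ξ : Vel n) (k : ℕ) :
    (fun v : Vel n => (inner ℝ v ξ : ℝ) ^ k)
      ∈ Submodule.span ℝ (Set.range (hermiteProd (n := n) u ε)) := by
  induction k with
  | zero =>
    refine Submodule.subset_span ⟨0, ?_⟩
    ext v
    simp [hermiteProd_zero]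
  | succ k ih =>
    have : (fun v : Vel n => (inner ℝ v ξ : ℝ) ^ (k + 1))
        = ∑ p, ξ p • fun v : Vel n => v p * (inner ℝ v ξ : ℝ) ^ k := by
      ext v
      rw [pow_succ']
      nth_rw 1 [PiLp.inner_apply]
      rw [Finset.sum_mul, Finset.sum_apply]
      refine Finset.sum_congr rfl fun p _ => ?_
      simp [mul_assoc]
    rw [this]
    exact Submodule.sum_mem _ fun p _ => Submodule.smul_mem _ _ (coordinate_mul_mem_span hε p ih)

/-- Orthogonality to the Hermite products passes to their span, which contains every `⟨v, ξ⟩ ^ k`;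
the exponential moments then determine the function. -/
lemma eq_zero_of_integral_hermiteProd (hε : 0 < ε) {f : Vel n → ℝ}
    (hf : MemLp f 2 (maxwellMeasure n u ε))
    (h : ∀ m, ∫ v, hermiteProd u ε m v * f v ∂(maxwellMeasure n u ε) = 0) :
    f =ᵐ[maxwellMeasure n u ε] 0 := by
  have key : ∀ q ∈ Submodule.span ℝ (Set.range (hermiteProd (n := n) u ε)),
      MemLp q 2 (maxwellMeasure n u ε) ∧ ∫ v, q v * f v ∂(maxwellMeasure n u ε) = 0 := by
    intro q hq
    induction hq using Submodule.span_induction with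
    | mem q hq => obtain ⟨m, rfl⟩ := hq; exact ⟨memLp_hermiteProd hε m, h m⟩
    | zero => exact ⟨MemLp.zero, by simp⟩
    | add q r _ _ hq hr =>
      refine ⟨hq.1.add hr.1, ?_⟩
      have hqi : Integrable (fun v => q v * f v) (maxwellMeasure n u ε) := hq.1.integrable_mul hf
      have hri : Integrable (fun v => r v * f v) (maxwellMeasure n u ε) := hr.1.integrable_mul hf
      simp only [Pi.add_apply, add_mul]
      rw [integral_add hqi hri, hq.2, hr.2, add_zero]
    | smul a q _ hq =>
      refine ⟨hq.1.const_smul a, ?_⟩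
      simp only [Pi.smul_apply, smul_eq_mul, mul_assoc]
      rw [integral_const_mul, hq.2, mul_zero]
  refine ae_eq_zero_of_integral_inner_pow_eq_zero hf.1 (fun ξ => ?_) fun ξ k =>
    (key _ (inner_pow_mem_span hε ξ k)).2
  exact (memLp_exp_abs_inner_maxwellMeasure hε ξ).integrable_mul hf.abs

/-- The norm of a Hermite mode. -/
def hermiteNorm {n : ℕ} (m : Fin n × Fin 3 → ℕ) : ℝ := √(∏ p, ((m p).factorial : ℝ))

lemma hermiteNorm_pos (m : Fin n × Fin 3 → ℕ) : 0 < hermiteNorm m :=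
  Real.sqrt_pos.2 (Finset.prod_pos fun p _ => by exact_mod_cast (m p).factorial_pos)

lemma hermiteNorm_sq (m : Fin n × Fin 3 → ℕ) :
    hermiteNorm m * hermiteNorm m = ∏ p, ((m p).factorial : ℝ) :=
  Real.mul_self_sqrt (Finset.prod_nonneg fun p _ => by positivity)

/-- The Hermite modes as elements of `L²` of the Maxwellian. -/
def hermiteLp (u : EuclideanSpace ℝ (Fin 3)) (hε : 0 < ε) (m : Fin n × Fin 3 → ℕ) :
    Lp ℝ 2 (maxwellMeasure n u ε) := (memLp_hermiteProd hε m).toLp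

lemma inner_hermiteLp (hε : 0 < ε) (m k : Fin n × Fin 3 → ℕ) :
    inner ℝ (hermiteLp u hε m) (hermiteLp u hε k)
      = if m = k then ∏ p, ((m p).factorial : ℝ) else 0 := by
  rw [hermiteLp, inner_toLp, ← integral_hermiteProd_mul (u := u) hε]
  refine integral_congr_ae ?_
  filter_upwards [(memLp_hermiteProd (u := u) hε k).coeFn_toLp] with v hv
  rw [hermiteLp, hv]

lemma orthonormal_hermiteLp (hε : 0 < ε) :
    Orthonormal ℝ (fun m : Fin n × Fin 3 → ℕ => (hermiteNorm m)⁻¹ • hermiteLp u hε m) := by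
  rw [orthonormal_iff_ite]
  intro m k
  rw [real_inner_smul_left, real_inner_smul_right, inner_hermiteLp]
  split_ifs with h
  · subst h
    rw [← hermiteNorm_sq]
    have := (hermiteNorm_pos m).ne'
    field_simp
  · simp

/-- The normalized Hermite modes form a Hilbert basis of `L²` of the Maxwellian. -/
def hermiteBasis (n : ℕ) (u : EuclideanSpace ℝ (Fin 3)) (hε : 0 < ε) :
    HilbertBasis (Fin n × Fin 3 → ℕ) ℝ (Lp ℝ 2 (maxwellMeasure n u ε)) :=
  HilbertBasis.mkOfOrthogonalEqBot (orthonormal_hermiteLp (u := u) hε) (by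
    rw [Submodule.eq_bot_iff]
    intro f hf
    rw [Lp.eq_zero_iff_ae_eq_zero]
    refine eq_zero_of_integral_hermiteProd hε (Lp.memLp f) fun m => ?_
    have h1 := hf _ (Submodule.subset_span ⟨m, rfl⟩)
    rw [real_inner_smul_left, hermiteLp, inner_toLp] at h1
    exact (mul_eq_zero.1 h1).resolve_left (inv_ne_zero (hermiteNorm_pos m).ne'))

lemma hermiteBasis_apply (hε : 0 < ε) (m : Fin n × Fin 3 → ℕ) :
    hermiteBasis n u hε m = (hermiteNorm m)⁻¹ • hermiteLp u hε m := by
  rw [hermiteBasis, HilbertBasis.coe_mkOfOrthogonalEqBot]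

end HermiteBasis

/-! ### Recognizing densities of positive measures from Fourier transforms. -/

section WithDensityCharFun

open scoped ENNReal

lemma charFun_withDensity_ofReal {E : Type*} [NormedAddCommGroup E] [InnerProductSpace ℝ E]
    [MeasurableSpace E] {μ : Measure E} {g : E → ℝ} (hg : AEMeasurable g μ) (ξ : E) :
    charFun (μ.withDensity fun v => ENNReal.ofReal (g v)) ξ
      = ∫ v, Complex.exp ((inner ℝ v ξ : ℝ) * Complex.I) * ((max (g v) 0 : ℝ) : ℂ) ∂μ := by
  rw [charFun_apply, integral_withDensity_eq_integral_toReal_smul₀ hg.ennreal_ofReal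
    (ae_of_all _ fun _ => ENNReal.ofReal_lt_top)]
  refine integral_congr_ae (ae_of_all _ fun v => ?_)
  simp only [ENNReal.toReal_ofReal', Complex.real_smul]
  ring

lemma norm_exp_inner_mul {E : Type*} [NormedAddCommGroup E] [InnerProductSpace ℝ E]
    (v ξ : E) (a : ℂ) : ‖Complex.exp ((inner ℝ v ξ : ℝ) * Complex.I) * a‖ = ‖a‖ := by
  rw [norm_mul, Complex.norm_exp_ofReal_mul_I, one_mul]

lemma integrable_exp_inner_mul {E : Type*} [NormedAddCommGroup E] [InnerProductSpace ℝ E]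
    [MeasurableSpace E] [BorelSpace E] [SecondCountableTopology E] {μ : Measure E} {g : E → ℝ}
    (hg : Integrable g μ) (ξ : E) :
    Integrable (fun v => Complex.exp ((inner ℝ v ξ : ℝ) * Complex.I) * (g v : ℂ)) μ := by
  refine hg.norm.mono' ((Continuous.aestronglyMeasurable (by fun_prop)).mul
    (Complex.continuous_ofReal.comp_aestronglyMeasurable hg.1)) (ae_of_all _ fun v => ?_)
  rw [norm_exp_inner_mul, Complex.norm_real]

/-- A real density whose Fourier transform is that of a positive measure is nonnegative, and is
the density of that measure. -/
lemma eq_withDensity_of_charFun_eq {E : Type*} [NormedAddCommGroup E] [InnerProductSpace ℝ E]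
    [CompleteSpace E] [MeasurableSpace E] [BorelSpace E] [SecondCountableTopology E]
    {μ ν : Measure E} [IsFiniteMeasure ν] {g : E → ℝ} (hg : Integrable g μ)
    (h : ∀ ξ, charFun ν ξ
      = ∫ v, Complex.exp ((inner ℝ v ξ : ℝ) * Complex.I) * (g v : ℂ) ∂μ) :
    0 ≤ᵐ[μ] g ∧ ν = μ.withDensity fun v => ENNReal.ofReal (g v) := by
  have hfin : ∀ f : E → ℝ, Integrable f μ →
      IsFiniteMeasure (μ.withDensity fun v => ENNReal.ofReal (f v)) := fun f hf =>
    isFiniteMeasure_withDensity hf.lintegral_lt_top.ne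
  have hneg : Integrable (fun v => -g v) μ := hg.neg
  have := hfin g hg
  have := hfin (fun v => -g v) hneg
  -- Moving the negative part of `g` to the other side leaves an identity between positive finite
  -- measures, which characteristic functions decide.
  have heq : ν + μ.withDensity (fun v => ENNReal.ofReal (-g v))
      = μ.withDensity fun v => ENNReal.ofReal (g v) := by
    refine Measure.ext_of_charFun ?_
    ext ξ
    have hi : ∀ (ρ : Measure E) [IsFiniteMeasure ρ],
        Integrable (fun v => Complex.exp ((inner ℝ v ξ : ℝ) * Complex.I)) ρ := fun ρ _ =>
      (integrable_const (1 : ℝ)).mono' (Continuous.aestronglyMeasurable (by fun_prop))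
        (ae_of_all _ fun v => (Complex.norm_exp_ofReal_mul_I _).le)
    rw [charFun_apply, integral_add_measure (hi _) (hi _), ← charFun_apply, ← charFun_apply, h,
      charFun_withDensity_ofReal hg.aemeasurable, charFun_withDensity_ofReal hneg.aemeasurable,
      ← integral_add (integrable_exp_inner_mul hg ξ)
        (integrable_exp_inner_mul hneg.pos_part ξ)]
    refine integral_congr_ae (ae_of_all _ fun v => ?_)
    simp only
    rw [← mul_add, ← Complex.ofReal_add]
    congr 2
    rcases le_total (g v) 0 with h' | h'
    · rw [max_eq_left (neg_nonneg.2 h'), max_eq_right h']; ring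
    · rw [max_eq_right (neg_nonpos.2 h'), max_eq_left h']; ring
  have hnn : 0 ≤ᵐ[μ] g := by
    obtain ⟨g', hg', hgg'⟩ := hg.aestronglyMeasurable
    have hS : MeasurableSet {v | g' v < 0} := hg'.measurable measurableSet_Iio
    -- On the set where `g` is negative the right side of `heq` has no mass, so the negative part
    -- has none there either.
    have h1 : μ.withDensity (fun v => ENNReal.ofReal (g v)) {v | g' v < 0} = 0 := by
      rw [withDensity_apply _ hS, setLIntegral_congr_fun_ae hS (g := 0), Pi.zero_def, lintegral_zero]
      filter_upwards [hgg'] with v hv hv'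
      rw [hv]
      exact ENNReal.ofReal_of_nonpos hv'.le
    rw [← heq, Measure.add_apply, add_eq_zero, withDensity_apply _ hS,
      lintegral_eq_zero_iff' hneg.aemeasurable.ennreal_ofReal.restrict] at h1
    have h2 := (ae_restrict_iff' hS).1 h1.2
    filter_upwards [h2, hgg'] with v hv hv'
    by_contra hlt
    simp only [Pi.zero_apply, not_le] at hlt
    have := hv (by simpa [← hv'] using hlt)
    simp only [Pi.zero_apply, ENNReal.ofReal_eq_zero, Left.neg_nonpos_iff] at this
    linarith
  refine ⟨hnn, ?_⟩
  rw [← heq]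
  have : μ.withDensity (fun v => ENNReal.ofReal (-g v)) = 0 := by
    rw [withDensity_congr_ae (g := 0), withDensity_zero]
    filter_upwards [hnn] with v hv
    exact ENNReal.ofReal_of_nonpos (neg_nonpos.2 hv)
  rw [this, add_zero]

end WithDensityCharFun

/-! ### The Mehler semigroup on Hermite series and its Fourier transform. -/

section Mehler

variable {n : ℕ} {u : EuclideanSpace ℝ (Fin 3)} {ε : ℝ}

/-- The Fourier transform of an `L²` function with respect to the Maxwellian, at a given
frequency, as a continuous linear functional. -/
def fourierMaxwell (u : EuclideanSpace ℝ (Fin 3)) (hε : 0 < ε) (ξ : Vel n) :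
    Lp ℝ 2 (maxwellMeasure n u ε) →L[ℝ] ℂ :=
  haveI := isProbabilityMeasure_maxwellMeasure (n := n) (u := u) hε
  LinearMap.mkContinuous
    { toFun := fun h => ∫ v, Complex.exp ((inner ℝ v ξ : ℝ) * Complex.I) * (h v : ℂ)
        ∂(maxwellMeasure n u ε)
      map_add' := fun f g => by
        have hf := integrable_exp_inner_mul ((Lp.memLp f).integrable one_le_two) ξ
        have hg := integrable_exp_inner_mul ((Lp.memLp g).integrable one_le_two) ξ
        rw [← integral_add hf hg]
        refine integral_congr_ae ?_
        filter_upwards [Lp.coeFn_add f g] with v hv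
        rw [hv, Pi.add_apply]
        push_cast
        ring
      map_smul' := fun a f => by
        rw [RingHom.id_apply, ← integral_smul]
        refine integral_congr_ae ?_
        filter_upwards [Lp.coeFn_smul a f] with v hv
        rw [hv, Pi.smul_apply, smul_eq_mul, Complex.real_smul]
        push_cast
        ring }
    1 fun h => by
      simp only [LinearMap.coe_mk, AddHom.coe_mk, one_mul]
      refine (norm_integral_le_integral_norm _).trans ?_
      simp only [norm_exp_inner_mul, Complex.norm_real]
      rw [integral_norm_eq_lintegral_enorm (Lp.memLp h).1, Lp.norm_def,
        ← eLpNorm_one_eq_lintegral_enorm]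
      exact ENNReal.toReal_mono (Lp.eLpNorm_ne_top h)
        (eLpNorm_le_eLpNorm_of_exponent_le one_le_two (Lp.memLp h).1)

lemma fourierMaxwell_apply (hε : 0 < ε) (ξ : Vel n) (h : Lp ℝ 2 (maxwellMeasure n u ε)) :
    fourierMaxwell u hε ξ h = ∫ v, Complex.exp ((inner ℝ v ξ : ℝ) * Complex.I) * (h v : ℂ)
        ∂(maxwellMeasure n u ε) := rfl

lemma fourierMaxwell_hermiteLp (hε : 0 < ε) (ξ : Vel n) (m : Fin n × Fin 3 → ℕ) :
    fourierMaxwell u hε ξ (hermiteLp u hε m)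
      = Complex.exp ((inner ℝ (uniformVel n u) ξ : ℝ) * Complex.I)
        * ((∏ p, (thermalSpeed ε * ξ p * Complex.I) ^ m p)
          * Complex.exp (-((thermalSpeed ε * ‖ξ‖) ^ 2 / 2 : ℝ))) := by
  rw [fourierMaxwell_apply, ← integral_exp_mul_hermiteProd hε]
  refine integral_congr_ae ?_
  filter_upwards [(memLp_hermiteProd (u := u) hε m).coeFn_toLp] with v hv
  rw [hermiteLp, hv]

/-- The coefficients of the Hermite expansion of an `L²` function. -/
def hermiteCoeff (u : EuclideanSpace ℝ (Fin 3)) (hε : 0 < ε) (h : Lp ℝ 2 (maxwellMeasure n u ε))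
    (m : Fin n × Fin 3 → ℕ) : ℝ := (hermiteNorm m)⁻¹ * (hermiteBasis n u hε).repr h m

/-- The Mehler semigroup: multiplication of the Hermite modes of degree `j` by `r ^ j`. -/
def mehler (u : EuclideanSpace ℝ (Fin 3)) (hε : 0 < ε) {r : ℝ} (hr : |r| ≤ 1)
    (h : Lp ℝ 2 (maxwellMeasure n u ε)) : Lp ℝ 2 (maxwellMeasure n u ε) :=
  (hermiteBasis n u hε).repr.symm
    ⟨fun m => r ^ (∑ p, m p) * (hermiteBasis n u hε).repr h m, by
      have h1 := (lp.memℓp ((hermiteBasis n u hε).repr h)).summable (by norm_num)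
      refine memℓp_gen (Summable.of_nonneg_of_le (fun m => by positivity) (fun m => ?_) h1)
      refine Real.rpow_le_rpow (norm_nonneg _) ?_ (by norm_num)
      rw [norm_mul, norm_pow, Real.norm_eq_abs]
      exact mul_le_of_le_one_left (norm_nonneg _) (pow_le_one₀ (abs_nonneg r) hr)⟩

variable {r : ℝ}

lemma repr_mehler (hε : 0 < ε) (hr : |r| ≤ 1) (h : Lp ℝ 2 (maxwellMeasure n u ε))
    (m : Fin n × Fin 3 → ℕ) :
    (hermiteBasis n u hε).repr (mehler u hε hr h) m
      = r ^ (∑ p, m p) * (hermiteBasis n u hε).repr h m := by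
  rw [mehler, LinearIsometryEquiv.apply_symm_apply]

lemma hasSum_mehler (hε : 0 < ε) (hr : |r| ≤ 1) (h : Lp ℝ 2 (maxwellMeasure n u ε)) :
    HasSum (fun m => (hermiteCoeff u hε h m * r ^ (∑ p, m p)) • hermiteLp u hε m)
      (mehler u hε hr h) := by
  refine ((hermiteBasis n u hε).hasSum_repr (mehler u hε hr h)).congr_fun fun m => ?_
  rw [repr_mehler, hermiteBasis_apply, smul_smul, hermiteCoeff]
  congr 1
  ring

lemma mehler_one (hε : 0 < ε) (hr : |(1 : ℝ)| ≤ 1) (h : Lp ℝ 2 (maxwellMeasure n u ε)) :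
    mehler u hε hr h = h := by
  refine (hermiteBasis n u hε).repr.injective ?_
  ext m
  rw [repr_mehler]
  simp

lemma hermiteNorm_zero : hermiteNorm (0 : Fin n × Fin 3 → ℕ) = 1 := by
  simp [hermiteNorm]

lemma hermiteCoeff_zero (hε : 0 < ε) (h : Lp ℝ 2 (maxwellMeasure n u ε)) :
    hermiteCoeff u hε h 0 = ∫ v, h v ∂(maxwellMeasure n u ε) := by
  rw [hermiteCoeff, HilbertBasis.repr_apply_apply, hermiteBasis_apply, hermiteNorm_zero, inv_one,
    one_smul, one_mul, hermiteLp, inner_toLp]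
  simp only [hermiteProd_zero, one_mul]

/-- The Mehler semigroup contracts the component orthogonal to the constants. -/
lemma norm_mehler_sub_le (hε : 0 < ε) (hr : |r| ≤ 1) {h : Lp ℝ 2 (maxwellMeasure n u ε)}
    (h0 : ∫ v, h v ∂(maxwellMeasure n u ε) = 1) :
    ‖mehler u hε hr h - hermiteLp u hε 0‖ ≤ |r| * ‖h - hermiteLp u hε 0‖ := by
  classical
  set b := hermiteBasis n u hε
  have hb0 : hermiteLp u hε 0 = b 0 := by
    rw [hermiteBasis_apply, hermiteNorm_zero, inv_one, one_smul]
  have hc0 : b.repr h 0 = 1 := by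
    have := hermiteCoeff_zero hε h
    rwa [h0, hermiteCoeff, hermiteNorm_zero, inv_one, one_mul] at this
  rw [← b.repr.norm_map, ← b.repr.norm_map (h - _), ← Real.norm_eq_abs, ← norm_smul]
  refine lp.norm_mono (by norm_num) fun m => ?_
  simp only [map_sub, hb0, b.repr_self, lp.coeFn_sub, lp.coeFn_smul, Pi.sub_apply, Pi.smul_apply,
    b, repr_mehler, norm_smul]
  by_cases hm : m = 0
  · subst hm
    simp only [lp.single_apply_self]
    rw [show (hermiteBasis n u hε).repr h 0 = 1 from hc0]
    simp
  · rw [lp.single_apply_ne _ _ _ hm, sub_zero, sub_zero, norm_mul, norm_pow, Real.norm_eq_abs]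
    refine mul_le_mul_of_nonneg_right ?_ (norm_nonneg _)
    have : ∑ p, m p ≠ 0 := by
      intro h
      apply hm
      ext p
      exact Finset.sum_eq_zero_iff.1 h p (Finset.mem_univ p)
    exact pow_le_of_le_one (abs_nonneg r) hr this

/-- The Fourier transform of the Mehler semigroup. -/
lemma fourierMaxwell_mehler (hε : 0 < ε) (hr : |r| ≤ 1) (h : Lp ℝ 2 (maxwellMeasure n u ε))
    (ξ : Vel n) :
    fourierMaxwell u hε ξ (mehler u hε hr h)
      = Complex.exp (((1 - r) * inner ℝ (uniformVel n u) ξ : ℝ) * Complex.I)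
        * Complex.exp (-((1 - r ^ 2) * (thermalSpeed ε * ‖ξ‖) ^ 2 / 2 : ℝ))
        * fourierMaxwell u hε (r • ξ) h := by
  have h1 := (fourierMaxwell u hε ξ).hasSum (hasSum_mehler hε hr h)
  -- The Hermite series of `h` itself, which is the case `r = 1`, is evaluated at frequency `r ξ`:
  -- the factor `r ^ |m|` of the semigroup equals the homogeneity of the mode in `ξ`, so the two
  -- series agree termwise up to the prefactor.
  have h2 := (fourierMaxwell u hε (r • ξ)).hasSum (hasSum_mehler hε (r := 1) (by norm_num) h)
  rw [mehler_one] at h2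
  have h3 := h2.mul_left (Complex.exp (((1 - r) * inner ℝ (uniformVel n u) ξ : ℝ) * Complex.I)
        * Complex.exp (-((1 - r ^ 2) * (thermalSpeed ε * ‖ξ‖) ^ 2 / 2 : ℝ)))
  refine h1.unique (h3.congr_fun fun m => ?_)
  simp only [map_smul, fourierMaxwell_hermiteLp, Complex.real_smul, one_pow, mul_one, inner_smul_right,
    norm_smul, PiLp.smul_apply, smul_eq_mul]
  have e1 : ∏ p, ((thermalSpeed ε : ℂ) * ((r * ξ p : ℝ) : ℂ) * Complex.I) ^ m p
      = (r : ℂ) ^ (∑ p, m p) * ∏ p, ((thermalSpeed ε : ℂ) * ξ p * Complex.I) ^ m p := by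
    rw [← Finset.prod_pow_eq_pow_sum, ← Finset.prod_mul_distrib]
    refine Finset.prod_congr rfl fun p _ => ?_
    rw [← mul_pow]
    push_cast
    ring
  have e2 : Complex.exp ((inner ℝ (uniformVel n u) ξ : ℝ) * Complex.I)
      = Complex.exp (((1 - r) * inner ℝ (uniformVel n u) ξ : ℝ) * Complex.I)
        * Complex.exp ((r * inner ℝ (uniformVel n u) ξ : ℝ) * Complex.I) := by
    rw [← Complex.exp_add]
    congr 1
    push_cast
    ring
  have e3 : Complex.exp (-((thermalSpeed ε * ‖ξ‖) ^ 2 / 2 : ℝ))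
      = Complex.exp (-((1 - r ^ 2) * (thermalSpeed ε * ‖ξ‖) ^ 2 / 2 : ℝ))
        * Complex.exp (-((thermalSpeed ε * (‖r‖ * ‖ξ‖)) ^ 2 / 2 : ℝ)) := by
    rw [← Complex.exp_add]
    congr 1
    rw [show (thermalSpeed ε * (‖r‖ * ‖ξ‖)) ^ 2 = ‖r‖ ^ 2 * (thermalSpeed ε * ‖ξ‖) ^ 2 by ring,
      Real.norm_eq_abs, sq_abs]
    push_cast
    ring
  rw [e1, e2, e3]
  push_cast
  ring

end Mehler

/-! ### Positivity, normalization and decay of the limiting density. -/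

section RelaxedDensity

open scoped ENNReal

variable {n : ℕ} {u : EuclideanSpace ℝ (Fin 3)} {ε : ℝ}

lemma charFun_maxwellMeasure (hε : 0 < ε) (ξ : Vel n) :
    charFun (maxwellMeasure n u ε) ξ
      = Complex.exp ((inner ℝ (uniformVel n u) ξ : ℝ) * Complex.I)
        * Complex.exp (-((thermalSpeed ε * ‖ξ‖) ^ 2 / 2 : ℝ)) := by
  have h := integral_exp_mul_hermiteProd (u := u) hε (0 : Fin n × Fin 3 → ℕ) ξ
  simp only [hermiteProd_zero, Complex.ofReal_one, mul_one, Pi.zero_apply, pow_zero,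
    Finset.prod_const_one, one_mul] at h
  rw [charFun_apply, h]

lemma charFun_withDensity_of_nonneg (hε : 0 < ε) {h : Lp ℝ 2 (maxwellMeasure n u ε)}
    (h0 : 0 ≤ᵐ[maxwellMeasure n u ε] h) (ξ : Vel n) :
    charFun ((maxwellMeasure n u ε).withDensity fun v => ENNReal.ofReal (h v)) ξ
      = fourierMaxwell u hε ξ h := by
  rw [charFun_withDensity_ofReal (Lp.memLp h).1.aemeasurable, fourierMaxwell_apply]
  refine integral_congr_ae ?_
  filter_upwards [h0] with v hv
  rw [max_eq_left (show 0 ≤ h v from hv)]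

/-- The Fourier transform of the result is that of a positive measure: the convolution of the
dilation by `r` of `h f_M` with the dilation by `√(1 - r²)` of the Maxwellian, translated so that
the drift `u` is restored. Then `eq_withDensity_of_charFun_eq` applies. -/
lemma mehler_nonneg (hε : 0 < ε) {r : ℝ} (hr : |r| ≤ 1) {h : Lp ℝ 2 (maxwellMeasure n u ε)}
    (h0 : 0 ≤ᵐ[maxwellMeasure n u ε] h) : 0 ≤ᵐ[maxwellMeasure n u ε] mehler u hε hr h := by
  have := isProbabilityMeasure_maxwellMeasure (n := n) (u := u) hε
  have hr2 : 0 ≤ 1 - r ^ 2 := by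
    rw [← sq_abs]
    nlinarith [abs_nonneg r]
  have : IsFiniteMeasure ((maxwellMeasure n u ε).withDensity fun v => ENNReal.ofReal (h v)) :=
    isFiniteMeasure_withDensity ((Lp.memLp h).integrable one_le_two).lintegral_lt_top.ne
  refine (eq_withDensity_of_charFun_eq (ν := ((((maxwellMeasure n u ε).withDensity
    fun v => ENNReal.ofReal (h v)).map (r • ·)).conv ((maxwellMeasure n u ε).map
      (√(1 - r ^ 2) • ·))).map (· + ((1 - r) - √(1 - r ^ 2)) • uniformVel n u))
    ((Lp.memLp _).integrable one_le_two) fun ξ => ?_).1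
  rw [charFun_map_add_const, charFun_conv, charFun_map_smul, charFun_map_smul,
    charFun_withDensity_of_nonneg hε h0, ← fourierMaxwell_apply hε, fourierMaxwell_mehler,
    charFun_maxwellMeasure hε]
  rw [mul_comm (fourierMaxwell u hε (r • ξ) h), mul_right_comm]
  congr 1
  rw [← Complex.exp_add, ← Complex.exp_add, ← Complex.exp_add]
  congr 1
  rw [norm_smul, Real.norm_eq_abs, mul_left_comm, mul_pow, sq_abs, Real.sq_sqrt hr2, inner_smul_right,
    inner_smul_left]
  push_cast
  simp only [conj_trivial]
  push_cast
  ring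

lemma volume_absolutelyContinuous_maxwellMeasure (hε : 0 < ε) :
    (volume : Measure (Vel n)) ≪ maxwellMeasure n u ε :=
  withDensity_absolutelyContinuous' continuous_maxwellian.measurable.ennreal_ofReal.aemeasurable
    (ae_of_all _ fun v => (ENNReal.ofReal_pos.2 (maxwellian_pos hε v)).ne')

lemma integrable_maxwellian_mul (hε : 0 < ε) {g : Vel n → ℝ}
    (hg : Integrable g (maxwellMeasure n u ε)) : Integrable fun v => maxwellian n u ε v * g v := by
  have := (integrable_withDensity_iff_integrable_smul'
    continuous_maxwellian.measurable.ennreal_ofReal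
    (ae_of_all _ fun _ => ENNReal.ofReal_lt_top)).1 hg
  simpa only [ENNReal.toReal_ofReal (maxwellian_pos hε _).le, smul_eq_mul] using this

lemma withDensity_maxwellian_mul (hε : 0 < ε) {g : Vel n → ℝ}
    (hg : AEMeasurable g (maxwellMeasure n u ε)) :
    (volume.withDensity fun v => ENNReal.ofReal (maxwellian n u ε v * g v))
      = (maxwellMeasure n u ε).withDensity fun v => ENNReal.ofReal (g v) := by
  rw [maxwellMeasure, ← withDensity_mul₀ continuous_maxwellian.measurable.ennreal_ofReal.aemeasurable
    (hg.mono_ac (volume_absolutelyContinuous_maxwellMeasure hε)).ennreal_ofReal]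
  congr 1
  ext v
  rw [Pi.mul_apply, ENNReal.ofReal_mul (maxwellian_pos hε v).le]

/-- The left side is the `L¹` norm for the Maxwellian, a probability measure, so the `L²` norm
dominates it. -/
lemma eLpNorm_maxwellian_mul (hε : 0 < ε) (g : Vel n → ℝ)
    (hg : AEStronglyMeasurable g (maxwellMeasure n u ε)) :
    eLpNorm (fun v => maxwellian n u ε v * g v) 1 volume
      ≤ eLpNorm g 2 (maxwellMeasure n u ε) := by
  have := isProbabilityMeasure_maxwellMeasure (n := n) (u := u) hε
  refine le_trans (le_of_eq ?_) (eLpNorm_le_eLpNorm_of_exponent_le one_le_two hg)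
  rw [eLpNorm_one_eq_lintegral_enorm, eLpNorm_one_eq_lintegral_enorm, maxwellMeasure,
    lintegral_withDensity_eq_lintegral_mul_non_measurable _
      continuous_maxwellian.measurable.ennreal_ofReal
      (ae_of_all _ fun _ => ENNReal.ofReal_lt_top)]
  refine lintegral_congr fun v => ?_
  rw [Pi.mul_apply, enorm_mul, Real.enorm_eq_ofReal (maxwellian_pos hε v).le]

/-- The density obtained by letting the Mehler semigroup act on `f₀ / f_M`, with its expansion, its
Fourier transform and its rate of convergence to the Maxwellian. -/
theorem exists_relaxed_density (hε : 0 < ε) {f₀ : Vel n → ℝ} (hf₀ : ∀ v, 0 ≤ f₀ v)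
    (hL : MemLp (fun v => f₀ v / maxwellian n u ε v) 2 (maxwellMeasure n u ε))
    (hmass : ∫ v, f₀ v = 1) :
    ∃ (f : ℝ → Vel n → ℝ) (c : (Fin n × Fin 3 → ℕ) → ℝ), f 0 = f₀ ∧ c 0 = 1 ∧
    ∀ t : ℝ, 0 ≤ t →
      (∀ v, 0 ≤ f t v) ∧ Integrable (f t) ∧ ∫ v, f t v = 1 ∧
      MemLp (fun v => f t v / maxwellian n u ε v) 2 (maxwellMeasure n u ε) ∧
      (∀ ξ, charFun (volume.withDensity fun v => ENNReal.ofReal (f t v)) ξ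
        = Complex.exp (((1 - Real.exp (-(3 / (2 * ε)) * t)) * inner ℝ (uniformVel n u) ξ : ℝ)
            * Complex.I)
          * Complex.exp (-((1 - Real.exp (-(3 / (2 * ε)) * t) ^ 2) * (thermalSpeed ε * ‖ξ‖) ^ 2 / 2
            : ℝ))
          * charFun (volume.withDensity fun v => ENNReal.ofReal (f₀ v))
            (Real.exp (-(3 / (2 * ε)) * t) • ξ)) ∧
      HasHermiteExpansion u ε
        (fun m => c m * Real.exp (-(3 * ((∑ p, m p : ℕ) : ℝ) / (2 * ε)) * t)) (f t) ∧
      eLpNorm (fun v => f t v / maxwellian n u ε v - 1) 2 (maxwellMeasure n u ε)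
        ≤ ENNReal.ofReal (Real.exp (-(3 / (2 * ε)) * t)) *
          eLpNorm (fun v => f₀ v / maxwellian n u ε v - 1) 2 (maxwellMeasure n u ε) ∧
      eLpNorm (fun v => f t v - maxwellian n u ε v) 1 volume
        ≤ ENNReal.ofReal (Real.exp (-(3 / (2 * ε)) * t)) *
          eLpNorm (fun v => f₀ v / maxwellian n u ε v - 1) 2 (maxwellMeasure n u ε) := by
  have := isProbabilityMeasure_maxwellMeasure (n := n) (u := u) hε
  have hM := fun v => (maxwellian_pos (n := n) (u := u) hε v).ne'
  have hfM : ∀ v, maxwellian n u ε v * (f₀ v / maxwellian n u ε v) = f₀ v := fun v =>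
    mul_div_cancel₀ _ (hM v)
  set h : Lp ℝ 2 (maxwellMeasure n u ε) := hL.toLp with hh
  have hhf : h =ᵐ[maxwellMeasure n u ε] fun v => f₀ v / maxwellian n u ε v := hL.coeFn_toLp
  have h0 : 0 ≤ᵐ[maxwellMeasure n u ε] h := by
    filter_upwards [hhf] with v hv
    rw [hv]
    exact div_nonneg (hf₀ v) (maxwellian_pos hε v).le
  have h1 : ∫ v, h v ∂(maxwellMeasure n u ε) = 1 := by
    rw [integral_congr_ae hhf, integral_maxwellMeasure hε, ← hmass]
    simp only [smul_eq_mul, hfM]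
  have hr : ∀ t : ℝ, 0 ≤ t → |Real.exp (-(3 / (2 * ε)) * t)| ≤ 1 := fun t ht => by
    rw [abs_of_pos (Real.exp_pos _), Real.exp_le_one_iff]
    have : 0 ≤ 3 / (2 * ε) * t := by positivity
    linarith
  classical
  -- A representative is chosen at each time: at `t = 0` the given quotient, so that `f 0 = f₀`
  -- holds everywhere; for `t > 0` the positive part, so that nonnegativity holds at every point;
  -- for `t < 0` the irrelevant value `0`.
  set g : ℝ → Vel n → ℝ := fun t => if t = 0 then fun v => f₀ v / maxwellian n u ε v else
    if ht : 0 ≤ t then fun v => max (mehler u hε (hr t ht) h v) 0 else 0 with hgdef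
  have hg0 : ∀ t v, 0 ≤ g t v := fun t v => by
    simp only [hgdef]
    split_ifs
    · exact div_nonneg (hf₀ v) (maxwellian_pos hε v).le
    · exact le_max_right _ _
    · exact le_rfl
  have hg : ∀ t (ht : 0 ≤ t), g t =ᵐ[maxwellMeasure n u ε] mehler u hε (hr t ht) h := by
    intro t ht
    by_cases h' : t = 0
    · subst h'
      have : mehler u hε (hr 0 ht) h = h := by
        have key : ∀ (r : ℝ) (hr : |r| ≤ 1), r = 1 → mehler u hε hr h = h := by
          rintro r hr rfl
          exact mehler_one hε hr h
        exact key _ _ (by simp)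
      rw [this]
      simp only [hgdef, if_true]
      exact hhf.symm
    · simp only [hgdef, if_neg h', dif_pos ht]
      filter_upwards [mehler_nonneg hε (hr t ht) h0] with v hv
      exact max_eq_left hv
  have hgL : ∀ t, 0 ≤ t → MemLp (g t) 2 (maxwellMeasure n u ε) := fun t ht =>
    (memLp_congr_ae (hg t ht)).2 (Lp.memLp _)
  have hdiv : ∀ t v, maxwellian n u ε v * g t v / maxwellian n u ε v = g t v := fun t v =>
    mul_div_cancel_left₀ _ (hM v)
  have hone : (hermiteLp u hε 0 : Vel n → ℝ) =ᵐ[maxwellMeasure n u ε] fun _ => 1 := by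
    refine (memLp_hermiteProd hε 0).coeFn_toLp.trans (ae_of_all _ fun v => ?_)
    exact hermiteProd_zero v
  have hcoeff : ∀ t : ℝ, ∀ m : Fin n × Fin 3 → ℕ,
      Real.exp (-(3 * ((∑ p, m p : ℕ) : ℝ) / (2 * ε)) * t)
        = Real.exp (-(3 / (2 * ε)) * t) ^ (∑ p, m p) := fun t m => by
    rw [← Real.exp_nat_mul]
    congr 1
    ring
  have hL2 : ∀ t, 0 ≤ t → eLpNorm (fun v => g t v - 1) 2 (maxwellMeasure n u ε)
        ≤ ENNReal.ofReal (Real.exp (-(3 / (2 * ε)) * t)) *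
          eLpNorm (fun v => f₀ v / maxwellian n u ε v - 1) 2 (maxwellMeasure n u ε) := by
    intro t ht
    have e1 : eLpNorm (fun v => g t v - 1) 2 (maxwellMeasure n u ε)
        = ‖mehler u hε (hr t ht) h - hermiteLp u hε 0‖ₑ := by
      rw [Lp.enorm_def]
      refine eLpNorm_congr_ae ?_
      filter_upwards [hg t ht, hone, Lp.coeFn_sub (mehler u hε (hr t ht) h) (hermiteLp u hε 0)]
        with v e1 e2 e3
      rw [e1, e3, Pi.sub_apply, e2]
    have e2 : eLpNorm (fun v => f₀ v / maxwellian n u ε v - 1) 2 (maxwellMeasure n u ε)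
        = ‖h - hermiteLp u hε 0‖ₑ := by
      rw [Lp.enorm_def]
      refine eLpNorm_congr_ae ?_
      filter_upwards [hhf, hone, Lp.coeFn_sub h (hermiteLp u hε 0)] with v e1 e2 e3
      rw [e3, Pi.sub_apply, e1, e2]
    rw [e1, e2, ← ofReal_norm, ← ofReal_norm,
      ← ENNReal.ofReal_mul (Real.exp_pos _).le]
    refine ENNReal.ofReal_le_ofReal ?_
    have := norm_mehler_sub_le hε (hr t ht) h1
    rwa [abs_of_pos (Real.exp_pos _)] at this
  have hWD : ∀ t (ht : 0 ≤ t), ∀ ξ,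
      charFun (volume.withDensity fun v => ENNReal.ofReal (maxwellian n u ε v * g t v)) ξ
        = fourierMaxwell u hε ξ (mehler u hε (hr t ht) h) := by
    intro t ht ξ
    rw [withDensity_maxwellian_mul hε (hgL t ht).1.aemeasurable,
      ← charFun_withDensity_of_nonneg hε (mehler_nonneg hε (hr t ht) h0)]
    congr 1
    refine withDensity_congr_ae ?_
    filter_upwards [hg t ht] with v hv
    rw [hv]
  have hWD0 : ∀ ξ, charFun (volume.withDensity fun v => ENNReal.ofReal (f₀ v)) ξ
        = fourierMaxwell u hε ξ h := by
    intro ξ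
    rw [← charFun_withDensity_of_nonneg hε h0]
    have := withDensity_maxwellian_mul hε hL.1.aemeasurable
    simp only [hfM] at this
    rw [this]
    congr 1
    refine withDensity_congr_ae ?_
    filter_upwards [hhf] with v hv
    rw [hv]
  refine ⟨fun t v => maxwellian n u ε v * g t v, hermiteCoeff u hε h, ?_, ?_, fun t ht =>
    ⟨fun v => mul_nonneg (maxwellian_pos hε v).le (hg0 t v),
      integrable_maxwellian_mul hε ((hgL t ht).integrable one_le_two), ?_, ?_, fun ξ => ?_, ?_, ?_,
      ?_⟩⟩
  · ext v
    simp only [hgdef, if_true, hfM]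
  · rw [hermiteCoeff_zero, h1]
  · have e := integral_maxwellMeasure (u := u) hε (g t)
    simp only [smul_eq_mul] at e
    rw [← e, integral_congr_ae (hg t ht), ← hermiteCoeff_zero hε, hermiteCoeff, repr_mehler]
    simp only [Pi.zero_apply, Finset.sum_const_zero, pow_zero, one_mul]
    rw [← hermiteCoeff, hermiteCoeff_zero, h1]
  · simp only [hdiv]
    exact hgL t ht
  · rw [hWD t ht, hWD0, fourierMaxwell_mehler]
  · have hs := hasSum_mehler hε (hr t ht) h
    rw [HasSum, tendsto_iff_edist_tendsto_0] at hs
    refine hs.congr fun s => ?_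
    rw [edist_comm, Lp.edist_def]
    refine eLpNorm_congr_ae ?_
    have e := Lp.coeFn_finsetSum s fun m => (hermiteCoeff u hε h m
      * Real.exp (-(3 / (2 * ε)) * t) ^ (∑ p, m p)) • hermiteLp u hε m
    have e' : ∀ᵐ v ∂(maxwellMeasure n u ε), ∀ m : Fin n × Fin 3 → ℕ,
        ((hermiteCoeff u hε h m * Real.exp (-(3 / (2 * ε)) * t) ^ (∑ p, m p))
          • hermiteLp u hε m : Lp ℝ 2 (maxwellMeasure n u ε)) v
        = (hermiteCoeff u hε h m * Real.exp (-(3 / (2 * ε)) * t) ^ (∑ p, m p))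
          * hermiteProd u ε m v := by
      rw [ae_all_iff]
      intro m
      filter_upwards [Lp.coeFn_smul (hermiteCoeff u hε h m
        * Real.exp (-(3 / (2 * ε)) * t) ^ (∑ p, m p)) (hermiteLp u hε m),
        (memLp_hermiteProd (u := u) hε m).coeFn_toLp] with v e1 e2
      rw [e1, Pi.smul_apply, smul_eq_mul, hermiteLp, e2]
    filter_upwards [hg t ht, e, e'] with v e1 e2 e3
    simp only [Pi.sub_apply, hdiv]
    simp only [e1, e2, Finset.sum_apply, e3, hcoeff]
  · simp only [hdiv]
    exact hL2 t ht
  · refine le_trans ?_ (hL2 t ht)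
    refine le_trans (le_of_eq ?_) (eLpNorm_maxwellian_mul (u := u) hε _
      ((hgL t ht).1.sub aestronglyMeasurable_const))
    congr 1
    ext v
    ring

end RelaxedDensity

/-! ### Truncation to the first particles, and relabelling. -/

section FirstVelocities

open Leaf

variable {n N : ℕ}

lemma firstVel_castLE (hn : n ≤ N) (x : Vel N) (k : Fin n) (a : Fin 3) :
    firstVel n x (k, a) = x (Fin.castLE hn k, a) := by
  have : (k : ℕ) < N := k.2.trans_le hn
  simp [firstVel, this, Fin.castLE]

/-- For `n ≤ N`, `firstVel N` pads by zeros and is the adjoint of the truncation `firstVel n`. Plane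
waves in the first `n` velocities are thereby plane waves on the full space. -/
lemma inner_firstVel (hn : n ≤ N) (ξ : Vel n) (x : Vel N) :
    inner ℝ (firstVel N ξ) x = inner ℝ ξ (firstVel n x) := by
  obtain ⟨m, rfl⟩ := Nat.exists_eq_add_of_le hn
  rw [PiLp.inner_apply, PiLp.inner_apply, Fintype.sum_prod_type, Fintype.sum_prod_type,
    Fin.sum_univ_add]
  have h2 : ∑ k : Fin m, ∑ a : Fin 3,
      inner ℝ (firstVel (n + m) ξ (Fin.natAdd n k, a)) (x (Fin.natAdd n k, a)) = 0 := by
    refine Finset.sum_eq_zero fun k _ => Finset.sum_eq_zero fun a _ => ?_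
    simp [firstVel]
  rw [h2, add_zero]
  refine Finset.sum_congr rfl fun k _ => Finset.sum_congr rfl fun a _ => ?_
  rw [firstVel_castLE hn]
  simp [firstVel, Fin.castAdd]

lemma firstVel_firstVel (hn : n ≤ N) (ξ : Vel n) : firstVel n (firstVel N ξ) = ξ := by
  ext ⟨k, a⟩
  rw [firstVel_castLE hn]
  simp [firstVel]

lemma norm_firstVel (hn : n ≤ N) (ξ : Vel n) : ‖firstVel N ξ‖ = ‖ξ‖ := by
  rw [← sq_eq_sq₀ (norm_nonneg _) (norm_nonneg _), ← real_inner_self_eq_norm_sq,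
    inner_firstVel hn, firstVel_firstVel hn, real_inner_self_eq_norm_sq]

lemma firstVel_uniformVel (hn : n ≤ N) (u : EuclideanSpace ℝ (Fin 3)) :
    firstVel n (uniformVel N u) = uniformVel n u := by
  ext ⟨k, a⟩
  rw [firstVel_castLE hn]
  rfl

lemma continuous_firstVel : Continuous (firstVel n : Vel N → Vel n) := by
  unfold firstVel
  refine (PiLp.continuous_toLp 2 _).comp (continuous_pi fun p => ?_)
  split_ifs <;> fun_prop

lemma norm_sq_firstVel_sub (hn : n ≤ N) (x y : Vel N) :
    ‖firstVel n x - firstVel n y‖ ^ 2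
      = ∑ k : Fin n, ∑ a : Fin 3, (x (Fin.castLE hn k, a) - y (Fin.castLE hn k, a)) ^ 2 := by
  rw [EuclideanSpace.real_norm_sq_eq, Fintype.sum_prod_type]
  simp only [PiLp.sub_apply, firstVel_castLE hn]

/-- Relabelling of the particles as a linear isometry. -/
def permuteEquiv (π : Equiv.Perm (Fin N)) : Vel N ≃ₗᵢ[ℝ] Vel N :=
  LinearIsometryEquiv.piLpCongrLeft 2 ℝ ℝ ((Equiv.prodCongr π (Equiv.refl (Fin 3))).symm)

lemma permuteEquiv_apply (π : Equiv.Perm (Fin N)) (x : Vel N) : permuteEquiv π x = permute π x := by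
  ext p
  rfl

lemma energy_permute (π : Equiv.Perm (Fin N)) (x : Vel N) : energy (permute π x) = energy x := by
  simp only [energy, permute]
  rw [Equiv.sum_comp π fun k => ∑ a : Fin 3, x (k, a) ^ 2]

lemma momentum_permute (π : Equiv.Perm (Fin N)) (x : Vel N) :
    momentum (permute π x) = momentum x := by
  ext a
  simp only [momentum, permute]
  exact Equiv.sum_comp π fun k => x (k, a)

end FirstVelocities

/-! ### Time dependent observables and the second moment of an ensemble. -/

section Ensembles

open Leaf Module

variable {N : ℕ} {M : Leaf N} {W : Submodule ℝ (Vel N)} {c : Vel N} {R : ℝ}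
  {F : ℝ → Vel N → ℝ}

namespace IsSphereLeaf

lemma integrable_mul_ensemble (h : IsSphereLeaf M W c R) (hF : M.IsEnsemble F) {g : Vel N → ℝ}
    (hg : Continuous g) {s : ℝ} (hs : 0 ≤ s) : Integrable (fun x => g x * F s x) M.unif := by
  have := h.isProbabilityMeasure_unif
  obtain ⟨C, -, hC⟩ := h.exists_bound_of_continuous hg
  exact ((hF.memLp s hs).integrable one_le_two).bdd_mul hg.aestronglyMeasurable hC

lemma abs_integral_mul_ensemble_le (h : IsSphereLeaf M W c R) (hF : M.IsEnsemble F)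
    {g G : Vel N → ℝ} (hG : Continuous G) {s : ℝ} (hs : 0 ≤ s)
    (hgG : ∀ x ∈ M.carrier, |g x| ≤ G x) :
    |∫ x, g x * F s x ∂M.unif| ≤ ∫ x, G x * F s x ∂M.unif := by
  rw [← Real.norm_eq_abs]
  refine norm_integral_le_of_norm_le (h.integrable_mul_ensemble hF hG hs) ?_
  filter_upwards [h.ae_mem_carrier, hF.nonneg s hs] with x hx hx'
  rw [norm_mul, Real.norm_eq_abs, Real.norm_of_nonneg hx']
  exact mul_le_mul_of_nonneg_right (hgG x hx) hx'

/-- Time derivative of the ensemble average of a time dependent observable. -/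
lemma hasDerivWithinAt_integral_mul (h : IsSphereLeaf M W c R) (hF : M.IsEnsemble F)
    {Ψ D : ℝ → Vel N → ℝ} (hΨ : ∀ s, ContDiff ℝ ∞ (Ψ s)) (hD : ∀ s, ContDiff ℝ ∞ (D s))
    (hd : ∀ s x, HasDerivAt (fun r => Ψ r x) (D s x) s)
    (hc : Continuous fun p : ℝ × Vel N => D p.1 p.2) {s : ℝ} (hs : 0 ≤ s) :
    HasDerivWithinAt (fun r => ∫ x, Ψ r x * F r x ∂M.unif)
      (∫ x, D s x * F s x ∂M.unif + ∫ x, M.laplacian (Ψ s) x * F s x ∂M.unif) (Set.Ici 0) s := by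
  -- `F` is differentiable in time only in the weak sense, so the increment is split in three: the
  -- master equation for the frozen observable `Ψ s`, the Taylor remainder of `Ψ` integrated against
  -- `F r`, and `r - s` times the increment of the average of `D s`.
  have hA := hF.master (Ψ s) (hΨ s) s hs
  have hC := (hF.master (D s) (hD s) s hs).continuousWithinAt
  rw [hasDerivWithinAt_iff_isLittleO] at hA ⊢
  have hB : (fun r => ∫ x, (Ψ r x - Ψ s x - (r - s) * D s x) * F r x ∂M.unif)
      =o[𝓝[Set.Ici 0] s] fun r => r - s := by
    rw [Asymptotics.isLittleO_iff]
    intro η hη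
    have hunif : ∀ᶠ r in 𝓝 s, ∀ x ∈ M.carrier, |D r x - D s x| < η := by
      have := (h.isCompact_carrier.mem_uniformity_of_prod (f := D) (s := Set.univ) (q := s)
        (by exact hc.continuousOn) (Set.mem_univ _) (Metric.dist_mem_uniformity hη))
      rw [nhdsWithin_univ] at this
      obtain ⟨v, hv, hv'⟩ := this
      filter_upwards [hv] with r hr x hx
      have := hv' r hr x hx
      simpa [Real.dist_eq, abs_sub_comm] using this
    obtain ⟨δ, hδ, hball⟩ := Metric.eventually_nhds_iff_ball.1 hunif
    filter_upwards [self_mem_nhdsWithin, mem_nhdsWithin_of_mem_nhds (Metric.ball_mem_nhds s hδ)]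
      with r hr0 hr
    have hbound : ∀ x ∈ M.carrier, |Ψ r x - Ψ s x - (r - s) * D s x| ≤ η * |r - s| := by
      intro x hx
      -- Mean value inequality for `r ↦ Ψ r x - r * D s x`, whose derivative is uniformly small on
      -- the compact leaf. As `F r` has mass one, the averaged remainder obeys the same bound.
      have := (convex_ball s δ).norm_image_sub_le_of_norm_hasDerivWithin_le
        (f := fun r => Ψ r x - r * D s x) (f' := fun r => D r x - D s x) (C := η)
        (x := s) (y := r)
        (fun q _ => by
          have := ((hd q x).sub ((hasDerivAt_id q).mul_const (D s x))).hasDerivWithinAt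
            (s := Metric.ball s δ)
          rwa [one_mul] at this)
        (fun q hq => (hball q hq x hx).le) (Metric.mem_ball_self hδ) hr
      rw [Real.norm_eq_abs, Real.norm_eq_abs] at this
      convert this using 2
      ring
    refine (h.abs_integral_mul_ensemble_le hF continuous_const hr0 hbound).trans (le_of_eq ?_)
    rw [integral_const_mul, hF.mass r hr0, mul_one]
    rfl
  have hC' : (fun r => (r - s) * (∫ x, D s x * F r x ∂M.unif - ∫ x, D s x * F s x ∂M.unif))
      =o[𝓝[Set.Ici 0] s] fun r => r - s := by
    have h1 : (fun r => ∫ x, D s x * F r x ∂M.unif - ∫ x, D s x * F s x ∂M.unif)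
        =o[𝓝[Set.Ici 0] s] fun _ => (1 : ℝ) := by
      rw [Asymptotics.isLittleO_one_iff]
      have := hC.tendsto.sub_const (∫ x, D s x * F s x ∂M.unif)
      rwa [sub_self] at this
    simpa using (Asymptotics.isBigO_refl (fun r : ℝ => r - s) _).mul_isLittleO h1
  refine ((hA.add hB).add hC').congr' ?_ EventuallyEq.rfl
  filter_upwards [self_mem_nhdsWithin] with r hr
  have hi : ∀ g : Vel N → ℝ, ContDiff ℝ ∞ g → Integrable (fun x => g x * F r x) M.unif :=
    fun g hg => h.integrable_mul_ensemble hF hg.continuous hr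
  have : ∫ x, (Ψ r x - Ψ s x - (r - s) * D s x) * F r x ∂M.unif
      = ∫ x, Ψ r x * F r x ∂M.unif - ∫ x, Ψ s x * F r x ∂M.unif
        - (r - s) * ∫ x, D s x * F r x ∂M.unif := by
    have hsub : Integrable (fun x => Ψ r x * F r x - Ψ s x * F r x) M.unif :=
      (hi _ (hΨ r)).sub (hi _ (hΨ s))
    rw [← integral_const_mul, ← integral_sub (hi _ (hΨ r)) (hi _ (hΨ s)),
      ← integral_sub hsub ((hi _ (hD s)).const_mul _)]
    congr 1
    ext x
    ring
  rw [this]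
  simp only [smul_eq_mul]
  ring

/-- The mean energy per particle, in the frame of the centre of the sphere. -/
lemma integral_norm_sq_firstVel (h : IsSphereLeaf M W c R)
    (hperm : ∀ π x, permute π x ∈ M.carrier ↔ x ∈ M.carrier)
    {u : EuclideanSpace ℝ (Fin 3)} (hu : c = uniformVel N u) (hF : M.IsEnsemble F) {n : ℕ}
    (hn : n ≤ N) (hN : 1 ≤ N) {s : ℝ} (hs : 0 ≤ s) :
    ∫ x, ‖firstVel n x - uniformVel n u‖ ^ 2 * F s x ∂M.unif = n * (R ^ 2 / N) := by
  set e : Fin N → Vel N → ℝ := fun k x => ∑ a : Fin 3, (x (k, a) - u a) ^ 2 with he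
  have hec : ∀ k, Continuous (e k) := fun k => by fun_prop
  have hsum : ∀ x ∈ M.carrier, ∑ k, e k x = R ^ 2 := by
    intro x hx
    obtain ⟨h1, h2⟩ := h.mem_carrier.1 hx
    rw [← h2, ← sub_sub_self x (W.starProjection x), h1, hu, EuclideanSpace.real_norm_sq_eq,
      Fintype.sum_prod_type]
    rfl
  -- By symmetry all particles have the same mean centred square speed, and on the leaf these add up
  -- to `R²`; each mean is therefore `R² / N`.
  have hswap : ∀ π : Equiv.Perm (Fin N), ∀ k,
      ∫ x, e (π k) x * F s x ∂M.unif = ∫ x, e k x * F s x ∂M.unif := by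
    intro π k
    have hmp := h.measurePreserving (permuteEquiv π) (by
      ext x
      rw [Set.mem_preimage, permuteEquiv_apply, hperm])
    rw [← hmp.integral_comp (permuteEquiv π).toHomeomorph.measurableEmbedding
      fun x => e k x * F s x]
    refine integral_congr_ae ?_
    filter_upwards [hF.symmetric s hs π] with x hx
    simp only [permuteEquiv_apply, hx]
    rfl
  have hall : ∀ k l, ∫ x, e k x * F s x ∂M.unif = ∫ x, e l x * F s x ∂M.unif := fun k l => by
    have := hswap (Equiv.swap l k) l
    rwa [Equiv.swap_apply_left] at this
  have hi : ∀ k, Integrable (fun x => e k x * F s x) M.unif := fun k =>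
    h.integrable_mul_ensemble hF (hec k) hs
  have hone : ∀ k, ∫ x, e k x * F s x ∂M.unif = R ^ 2 / N := by
    intro k
    have h1 : ∑ l, ∫ x, e l x * F s x ∂M.unif = R ^ 2 := by
      rw [← integral_finsetSum _ fun l _ => hi l]
      calc ∫ x, ∑ l, e l x * F s x ∂M.unif = ∫ x, R ^ 2 * F s x ∂M.unif := by
            refine integral_congr_ae ?_
            filter_upwards [h.ae_mem_carrier] with x hx
            rw [← Finset.sum_mul, hsum x hx]
        _ = R ^ 2 := by rw [integral_const_mul, hF.mass s hs, mul_one]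
    rw [Finset.sum_congr rfl fun l _ => hall l k, Finset.sum_const, Finset.card_univ,
      Fintype.card_fin, nsmul_eq_mul] at h1
    have : (N : ℝ) ≠ 0 := by positivity
    field_simp
    linarith
  have hexp : ∀ x : Vel N, ‖firstVel n x - uniformVel n u‖ ^ 2 * F s x
      = ∑ k : Fin n, e (Fin.castLE hn k) x * F s x := fun x => by
    rw [← firstVel_uniformVel hn, norm_sq_firstVel_sub hn, ← Finset.sum_mul]
    rfl
  simp only [hexp]
  rw [integral_finsetSum _ fun k _ => hi _, Finset.sum_congr rfl fun k _ => hone _]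
  simp

end IsSphereLeaf

end Ensembles

/-! ### Plane waves as approximate solutions of the backward equation. -/

section CharacteristicEvolution

open Leaf Module

variable {N : ℕ} {M : Leaf N} {W : Submodule ℝ (Vel N)} {c : Vel N} {R : ℝ}
  {F : ℝ → Vel N → ℝ}

namespace IsSphereLeaf

/-- The Laplacian of a plane wave. -/
lemma laplacian_cos (h : IsSphereLeaf M W c R) (ξ : Vel N) (a b θ : ℝ) {x : Vel N}
    (hx : x ∈ M.carrier) :
    M.laplacian (fun y => a * Real.cos (b * (inner ℝ ξ y - inner ℝ ξ c) + θ)) x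
      = a * (-(b ^ 2 * Real.cos (b * (inner ℝ ξ x - inner ℝ ξ c) + θ) * ‖W.starProjection ξ‖ ^ 2)
        + b ^ 2 * Real.cos (b * (inner ℝ ξ x - inner ℝ ξ c) + θ)
          * ((inner ℝ ξ x - inner ℝ ξ c) ^ 2 / R ^ 2)
        + (finrank ℝ W - 1) / R ^ 2 * (b * (inner ℝ ξ x - inner ℝ ξ c)
          * Real.sin (b * (inner ℝ ξ x - inner ℝ ξ c) + θ))) := by
  set g : ℝ → ℝ := fun r => a * Real.cos (b * (r - inner ℝ ξ c) + θ) with hgdef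
  have hg : ContDiff ℝ ∞ g := by
    have := Real.contDiff_cos (n := ∞)
    fun_prop
  have hl : ∀ r, HasDerivAt (fun r => b * (r - inner ℝ ξ c) + θ) b r := fun r => by
    simpa using (((hasDerivAt_id r).sub_const (inner ℝ ξ c)).const_mul b).add_const θ
  have h1 : deriv g = fun r => a * (-Real.sin (b * (r - inner ℝ ξ c) + θ) * b) := by
    ext r
    exact ((hl r).cos.const_mul a).deriv
  have h2 : deriv (deriv g)
      = fun r => a * (-(Real.cos (b * (r - inner ℝ ξ c) + θ) * b) * b) := by
    rw [h1]
    ext r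
    exact (((hl r).sin.neg.mul_const b).const_mul a).deriv
  obtain ⟨e1, e2⟩ := h.mem_carrier.1 hx
  have hP : (inner ℝ ξ (W.starProjection x) : ℝ) = inner ℝ ξ x - inner ℝ ξ c := by
    rw [← inner_sub_right, ← e1, sub_sub_self]
  rw [h.laplacian_eq_lapSphere (contDiff_ridge hg ξ) hx, lapSphere_ridge W h.radius_pos hg ξ e2,
    h2, h1, hP]
  simp only
  ring

/-- Approximate evolution of the characteristic function of the component of the ensemble in a
given direction. -/
theorem abs_integral_cos_sub_le (h : IsSphereLeaf M W c R) (hF : M.IsEnsemble F) (ξ : Vel N)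
    {κ t S : ℝ} (θ : ℝ) (hκ : 0 < κ) (ht : 0 ≤ t)
    (hS : ∀ s, 0 ≤ s → ∫ x, (inner ℝ ξ x - inner ℝ ξ c) ^ 2 * F s x ∂M.unif ≤ S) :
    |∫ x, Real.cos (inner ℝ ξ x - inner ℝ ξ c + θ) * F t x ∂M.unif
      - Real.exp (-(‖ξ‖ ^ 2 * (1 - Real.exp (-κ * t) ^ 2) / (2 * κ)))
        * ∫ x, Real.cos (Real.exp (-κ * t) * (inner ℝ ξ x - inner ℝ ξ c) + θ) * F 0 x ∂M.unif|
      ≤ ((‖ξ‖ ^ 2 - ‖W.starProjection ξ‖ ^ 2) + S / R ^ 2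
        + |(finrank ℝ W - 1) / R ^ 2 - κ| * (1 + S)) * t := by
  -- Frequency and amplitude solve `b' = κ b` and `a' = ‖ξ‖² b² a` with value `1` at time `t`. Then
  -- `∂ₛΨ` cancels the Ornstein–Uhlenbeck operator `‖ξ‖² ∂² - κ τ ∂` acting on `Ψ`, the formal limit
  -- of the Laplacian.
  set b : ℝ → ℝ := fun s => Real.exp (κ * (s - t)) with hbdef
  set a : ℝ → ℝ := fun s => Real.exp (-(‖ξ‖ ^ 2 * (1 - b s ^ 2) / (2 * κ))) with hadef
  set τ : Vel N → ℝ := fun x => inner ℝ ξ x - inner ℝ ξ c with hτ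
  set Ψ : ℝ → Vel N → ℝ := fun s x => a s * Real.cos (b s * τ x + θ) with hΨdef
  set D : ℝ → Vel N → ℝ := fun s x => a s * (‖ξ‖ ^ 2 * b s ^ 2 * Real.cos (b s * τ x + θ)
    - κ * (b s * τ x * Real.sin (b s * τ x + θ))) with hDdef
  have hb : ∀ s, HasDerivAt b (b s * κ) s := fun s => by
    have := (((hasDerivAt_id s).sub_const t).const_mul κ).exp
    simpa using this
  have ha : ∀ s, HasDerivAt a (a s * (‖ξ‖ ^ 2 * b s ^ 2)) s := fun s => by
    have := (((((hb s).pow 2).const_sub 1).const_mul (‖ξ‖ ^ 2)).div_const (2 * κ)).neg.exp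
    refine HasDerivAt.congr_deriv (f := a) this ?_
    change a s * _ = _
    push_cast
    field_simp
  have hd : ∀ s x, HasDerivAt (fun r => Ψ r x) (D s x) s := fun s x => by
    have := (ha s).mul (((hb s).mul_const (τ x)).add_const θ).cos
    refine HasDerivAt.congr_deriv (f := fun r => Ψ r x) this ?_
    simp only [hDdef]
    ring
  have hτc : ContDiff ℝ ∞ τ := by
    have := (innerSL ℝ ξ).contDiff (n := ∞)
    exact this.sub contDiff_const
  have hΨ : ∀ s, ContDiff ℝ ∞ (Ψ s) := fun s => by
    have := Real.contDiff_cos (n := ∞)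
    fun_prop
  have hD : ∀ s, ContDiff ℝ ∞ (D s) := fun s => by
    have := Real.contDiff_cos (n := ∞)
    have := Real.contDiff_sin (n := ∞)
    fun_prop
  have hDc : Continuous fun p : ℝ × Vel N => D p.1 p.2 := by
    have := hτc.continuous
    fun_prop
  have hderiv := fun s (hs : 0 ≤ s) => h.hasDerivWithinAt_integral_mul hF hΨ hD hd hDc hs
  set δ := ‖ξ‖ ^ 2 - ‖W.starProjection ξ‖ ^ 2 with hδdef
  set d := ((finrank ℝ W : ℝ) - 1) / R ^ 2 - κ with hddef
  have hδ : 0 ≤ δ := by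
    have := W.norm_starProjection_apply_le ξ
    have := norm_nonneg (W.starProjection ξ)
    rw [hδdef]
    nlinarith
  have hR := h.radius_pos
  -- Three defects survive the cancellation: the norm lost by projecting `ξ` to `W`, the curvature
  -- term `τ² / R²`, and the difference `d` of the drift rates, which multiplies a term bounded
  -- through `|τ| ≤ 1 + τ²`. Only the second moment of `τ` is needed.
  have hbound : ∀ s ∈ Set.Icc 0 t, ∀ x ∈ M.carrier, |D s x + M.laplacian (Ψ s) x|
      ≤ δ + τ x ^ 2 / R ^ 2 + |d| * (1 + τ x ^ 2) := by
    intro s hs x hx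
    have hb0 : 0 < b s := Real.exp_pos _
    have hb1 : b s ≤ 1 := Real.exp_le_one_iff.2
      (mul_nonpos_of_nonneg_of_nonpos hκ.le (sub_nonpos.2 hs.2))
    have hb2 : b s ^ 2 ≤ 1 := pow_le_one₀ hb0.le hb1
    have ha0 : 0 < a s := Real.exp_pos _
    have ha1 : a s ≤ 1 := by
      refine Real.exp_le_one_iff.2 (neg_nonpos.2 ?_)
      have := sub_nonneg.2 hb2
      positivity
    have hL := h.laplacian_cos ξ (a s) (b s) θ hx
    have key : D s x + M.laplacian (Ψ s) x
        = a s * (b s ^ 2 * Real.cos (b s * τ x + θ) * (δ + τ x ^ 2 / R ^ 2)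
          + d * (b s * (τ x * Real.sin (b s * τ x + θ)))) := by
      rw [hL]
      simp only [hDdef, hδdef, hddef, hτ]
      ring
    have hc1 : |b s ^ 2 * Real.cos (b s * τ x + θ)| ≤ 1 := by
      rw [abs_mul, abs_of_pos (pow_pos hb0 2)]
      exact mul_le_one₀ hb2 (abs_nonneg _) (Real.abs_cos_le_one _)
    have hc2 : |b s * (τ x * Real.sin (b s * τ x + θ))| ≤ 1 + τ x ^ 2 := by
      rw [abs_mul, abs_mul, abs_of_pos hb0]
      have h3 : |τ x| * |Real.sin (b s * τ x + θ)| ≤ |τ x| :=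
        mul_le_of_le_one_right (abs_nonneg _) (Real.abs_sin_le_one _)
      have h4 : b s * (|τ x| * |Real.sin (b s * τ x + θ)|) ≤ |τ x| * |Real.sin (b s * τ x + θ)| :=
        mul_le_of_le_one_left (by positivity) hb1
      have h5 : |τ x| ≤ 1 + τ x ^ 2 := by
        rw [← sq_abs]
        nlinarith [sq_nonneg (|τ x| - 1)]
      linarith
    rw [key, abs_mul, abs_of_pos ha0]
    have hsum : |b s ^ 2 * Real.cos (b s * τ x + θ) * (δ + τ x ^ 2 / R ^ 2)
          + d * (b s * (τ x * Real.sin (b s * τ x + θ)))|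
        ≤ (δ + τ x ^ 2 / R ^ 2) + |d| * (1 + τ x ^ 2) := by
      refine (abs_add_le _ _).trans (add_le_add ?_ ?_)
      · have : 0 ≤ δ + τ x ^ 2 / R ^ 2 := by positivity
        rw [abs_mul, abs_of_nonneg this]
        exact mul_le_of_le_one_left this hc1
      · rw [abs_mul]
        exact mul_le_mul_of_nonneg_left hc2 (abs_nonneg _)
    exact (mul_le_of_le_one_left (abs_nonneg _) ha1).trans hsum
  have hi : ∀ s, 0 ≤ s → ∀ g : Vel N → ℝ, Continuous g →
      Integrable (fun x => g x * F s x) M.unif :=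
    fun s hs g hg => h.integrable_mul_ensemble hF hg hs
  have hmv := norm_image_sub_le_of_norm_deriv_le_segment'
    (f := fun r => ∫ x, Ψ r x * F r x ∂M.unif) (a := 0) (b := t)
    (C := δ + S / R ^ 2 + |d| * (1 + S))
    (fun s hs => (hderiv s hs.1).mono Set.Icc_subset_Ici_self) (fun s hs => by
      have e1 : ∫ x, D s x * F s x ∂M.unif + ∫ x, M.laplacian (Ψ s) x * F s x ∂M.unif
          = ∫ x, (D s x + M.laplacian (Ψ s) x) * F s x ∂M.unif := by
        have hlap : Integrable (fun x => M.laplacian (Ψ s) x * F s x) M.unif := by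
          refine (hi s hs.1 _ (contDiff_lapSphere W R (hΨ s)).continuous).congr ?_
          filter_upwards [h.ae_mem_carrier] with x hx
          rw [h.laplacian_eq_lapSphere (hΨ s) hx]
        rw [← integral_add (hi s hs.1 _ (hD s).continuous) hlap]
        simp only [add_mul]
      have hτi := hi s hs.1 (fun x => τ x ^ 2) (hτc.continuous.pow 2)
      have h1i := hi s hs.1 (fun _ => 1) continuous_const
      rw [e1, Real.norm_eq_abs]
      have hGc : Continuous fun x => δ + τ x ^ 2 / R ^ 2 + |d| * (1 + τ x ^ 2) := by
        have := hτc.continuous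
        fun_prop
      refine (h.abs_integral_mul_ensemble_le hF hGc hs.1
        (hbound s (Set.Ico_subset_Icc_self hs))).trans ?_
      have e2 : ∫ x, (δ + τ x ^ 2 / R ^ 2 + |d| * (1 + τ x ^ 2)) * F s x ∂M.unif
          = (δ + |d|) * ∫ x, F s x ∂M.unif + (1 / R ^ 2 + |d|) * ∫ x, τ x ^ 2 * F s x ∂M.unif := by
        rw [← integral_const_mul, ← integral_const_mul, ← integral_add]
        · congr 1
          ext x
          ring
        · simpa using h1i.const_mul (δ + |d|)
        · exact hτi.const_mul _
      rw [e2, hF.mass s hs.1]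
      have := mul_le_mul_of_nonneg_left (hS s hs.1) (show 0 ≤ 1 / R ^ 2 + |d| by positivity)
      calc _ ≤ (δ + |d|) * 1 + (1 / R ^ 2 + |d|) * S := by gcongr
        _ = _ := by ring) t (Set.right_mem_Icc.2 ht)
  rw [sub_zero, Real.norm_eq_abs] at hmv
  have hbt : b t = 1 := by simp [hbdef]
  have hat : a t = 1 := by simp [hadef, hbt]
  have hb0 : b 0 = Real.exp (-κ * t) := by simp [hbdef]
  simp only [hΨdef, hat, hbt, one_mul, mul_assoc, integral_const_mul] at hmv
  simp only [hadef, hb0] at hmv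
  exact hmv

end IsSphereLeaf

end CharacteristicEvolution

/-! ### Marginals, their characteristic functions and weak convergence. -/

section Marginals

open Leaf Module

variable {n N : ℕ} {M : Leaf N} {W : Submodule ℝ (Vel N)} {c : Vel N} {R : ℝ}
  {F : ℝ → Vel N → ℝ}

lemma isProbabilityMeasure_withDensity_ofReal {α : Type*} {mα : MeasurableSpace α} {μ : Measure α}
    {f : α → ℝ} (hf : Integrable f μ) (h0 : 0 ≤ᵐ[μ] f) (h1 : ∫ x, f x ∂μ = 1) :
    IsProbabilityMeasure (μ.withDensity fun x => ENNReal.ofReal (f x)) := by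
  refine ⟨?_⟩
  rw [withDensity_apply _ MeasurableSet.univ, Measure.restrict_univ, ← ofReal_integral_eq_lintegral_ofReal hf h0, h1, ENNReal.ofReal_one]

lemma IsSphereLeaf.isProbabilityMeasure_marginal (h : IsSphereLeaf M W c R) (hF : M.IsEnsemble F)
    (n : ℕ) {s : ℝ} (hs : 0 ≤ s) : IsProbabilityMeasure (M.marginal n (F s)) := by
  have := h.isProbabilityMeasure_unif
  have := isProbabilityMeasure_withDensity_ofReal ((hF.memLp s hs).integrable one_le_two)
    (hF.nonneg s hs) (hF.mass s hs)
  exact Measure.isProbabilityMeasure_map continuous_firstVel.measurable.aemeasurable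

lemma Leaf.IsEnsemble.integral_marginal (hF : M.IsEnsemble F) {s : ℝ} (hs : 0 ≤ s)
    {φ : Vel n → ℝ} (hφ : Continuous φ) :
    ∫ v, φ v ∂(M.marginal n (F s)) = ∫ x, φ (firstVel n x) * F s x ∂M.unif := by
  rw [Leaf.marginal, integral_map continuous_firstVel.measurable.aemeasurable
    hφ.aestronglyMeasurable, integral_withDensity_eq_integral_toReal_smul₀
    (hF.memLp s hs).1.aemeasurable.ennreal_ofReal (ae_of_all _ fun _ => ENNReal.ofReal_lt_top)]
  refine integral_congr_ae ?_
  filter_upwards [hF.nonneg s hs] with x hx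
  rw [ENNReal.toReal_ofReal hx, smul_eq_mul, mul_comm]

/-- The characteristic function in terms of phase shifted plane waves centred at `w`. -/
lemma charFun_eq_integral_cos {E : Type*} [NormedAddCommGroup E] [InnerProductSpace ℝ E]
    [MeasurableSpace E] [BorelSpace E] [SecondCountableTopology E] (μ : Measure E)
    [IsFiniteMeasure μ] (ξ w : E) (b : ℝ) :
    charFun μ (b • ξ) = Complex.exp ((b * inner ℝ w ξ : ℝ) * Complex.I)
      * ((∫ v, Real.cos (b * (inner ℝ ξ v - inner ℝ ξ w) + 0) ∂μ : ℝ)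
        + (∫ v, Real.cos (b * (inner ℝ ξ v - inner ℝ ξ w) + -(Real.pi / 2)) ∂μ : ℝ)
          * Complex.I) := by
  have hi : ∀ θ, Integrable (fun v => Real.cos (b * (inner ℝ ξ v - inner ℝ ξ w) + θ)) μ := fun θ =>
    (integrable_const (1 : ℝ)).mono' (Continuous.aestronglyMeasurable (by fun_prop))
      (ae_of_all _ fun v => Real.abs_cos_le_one _)
  rw [charFun_apply, ← integral_complex_ofReal, ← integral_complex_ofReal, ← integral_mul_const,
    ← integral_add (hi _).ofReal ((hi _).ofReal.mul_const _), ← integral_const_mul]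
  refine integral_congr_ae (ae_of_all _ fun v => ?_)
  simp only
  rw [add_zero, ← sub_eq_add_neg, Real.cos_sub_pi_div_two, Complex.ofReal_cos, Complex.ofReal_sin,
    ← Complex.exp_mul_I, ← Complex.exp_add, inner_smul_right, real_inner_comm ξ v,
    real_inner_comm ξ w]
  congr 1
  push_cast
  ring

/-- The constant `1` is an admissible test function, so no mass is lost in the limit. -/
lemma TendstoDensity.isProbabilityMeasure {μ : ℕ → Measure (Vel n)} {f : Vel n → ℝ}
    (h : TendstoDensity μ f) (hμ : ∀ᶠ N in atTop, IsProbabilityMeasure (μ N)) :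
    IsProbabilityMeasure (volume.withDensity fun v => ENNReal.ofReal (f v)) := by
  have h1 := h (BoundedContinuousFunction.const _ 1)
  have h2 : Tendsto (fun N => ∫ v, BoundedContinuousFunction.const (Vel n) (1 : ℝ) v ∂(μ N)) atTop
      (𝓝 1) := by
    refine tendsto_const_nhds.congr' ?_
    filter_upwards [hμ] with N hN
    simp
  have h3 := tendsto_nhds_unique h1 h2
  simp only [BoundedContinuousFunction.const_apply, integral_const, smul_eq_mul, mul_one] at h3
  exact ⟨(ENNReal.toReal_eq_one_iff _).1 h3⟩

/-- Lévy's theorem for weak convergence to a density. -/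
lemma tendstoDensity_of_tendsto_charFun {μ : ℕ → Measure (Vel n)} {f : Vel n → ℝ}
    (hμ : ∀ᶠ N in atTop, IsProbabilityMeasure (μ N))
    (hf : IsProbabilityMeasure (volume.withDensity fun v => ENNReal.ofReal (f v)))
    (h : ∀ ξ, Tendsto (fun N => charFun (μ N) ξ) atTop
      (𝓝 (charFun (volume.withDensity fun v => ENNReal.ofReal (f v)) ξ))) :
    TendstoDensity μ f := by
  classical
  set ν : ProbabilityMeasure (Vel n) := ⟨volume.withDensity fun v => ENNReal.ofReal (f v), hf⟩
  -- The finitely many members that may fail to be probability measures are replaced by the limit,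
  -- which does not affect convergence.
  set ρ : ℕ → ProbabilityMeasure (Vel n) := fun N =>
    if hN : IsProbabilityMeasure (μ N) then ⟨μ N, hN⟩ else ν
  have hρ : ∀ᶠ N in atTop, (ρ N : Measure (Vel n)) = μ N := by
    filter_upwards [hμ] with N hN
    have : ρ N = ⟨μ N, hN⟩ := dif_pos hN
    rw [this]
    rfl
  have h1 : Tendsto ρ atTop (𝓝 ν) := by
    refine ProbabilityMeasure.tendsto_of_tendsto_charFun fun ξ => (h ξ).congr' ?_
    filter_upwards [hρ] with N hN
    rw [hN]
  rw [ProbabilityMeasure.tendsto_iff_forall_integral_tendsto] at h1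
  intro φ
  refine (h1 φ).congr' ?_
  filter_upwards [hρ] with N hN
  rw [hN]

end Marginals

/-! ### The limit `N → ∞` and relaxation of the marginals. -/

section Relaxation

open Leaf Module

variable {M : (N : ℕ) → Leaf N} {W : (N : ℕ) → Submodule ℝ (Vel N)} {N₀ : ℕ}
  {u : EuclideanSpace ℝ (Fin 3)} {ε : ℝ}

/-- Convergence of the characteristic functions of the marginals, up to a phase. -/
lemma tendsto_integral_cos_marginal (hε : 0 < ε)
    (hM : ∀ N, N₀ ≤ N → IsSphereLeaf (M N) (W N) (uniformVel N u) √(2 * N * ε))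
    (hperm : ∀ N, N₀ ≤ N → ∀ π x, permute π x ∈ (M N).carrier ↔ x ∈ (M N).carrier)
    (hdim : Tendsto (fun N => (finrank ℝ (W N) : ℝ) / N) atTop (𝓝 3))
    (hproj : ∀ (n : ℕ) (ξ : Vel n),
      Tendsto (fun N => ‖(W N).starProjection (firstVel N ξ)‖ ^ 2) atTop (𝓝 (‖ξ‖ ^ 2)))
    {F : (N : ℕ) → ℝ → Vel N → ℝ} (hF : ∀ N, N₀ ≤ N → (M N).IsEnsemble (F N)) {n : ℕ}
    {f₀ : Vel n → ℝ} (hf₀ : TendstoDensity (fun N => (M N).marginal n (F N 0)) f₀)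
    {t : ℝ} (ht : 0 ≤ t) (ξ : Vel n) (θ : ℝ) :
    Tendsto (fun N => ∫ v, Real.cos (1 * (inner ℝ ξ v - inner ℝ ξ (uniformVel n u)) + θ)
        ∂((M N).marginal n (F N t))) atTop
      (𝓝 (Real.exp (-(‖ξ‖ ^ 2 * (1 - Real.exp (-(3 / (2 * ε)) * t) ^ 2) / (2 * (3 / (2 * ε)))))
        * ∫ v, Real.cos (Real.exp (-(3 / (2 * ε)) * t)
            * (inner ℝ ξ v - inner ℝ ξ (uniformVel n u)) + θ)
          ∂(volume.withDensity fun v => ENNReal.ofReal (f₀ v)))) := by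
  set κ := 3 / (2 * ε) with hκdef
  have hκ : 0 < κ := by positivity
  set a := Real.exp (-(‖ξ‖ ^ 2 * (1 - Real.exp (-κ * t) ^ 2) / (2 * κ)))
  have hcont : ∀ b : ℝ, Continuous fun v : Vel n =>
      Real.cos (b * (inner ℝ ξ v - inner ℝ ξ (uniformVel n u)) + θ) := fun b => by fun_prop
  have h0 := (hf₀ (BoundedContinuousFunction.ofNormedAddCommGroup _ (hcont (Real.exp (-κ * t))) 1
    fun v => Real.abs_cos_le_one _)).const_mul a
  simp only [BoundedContinuousFunction.coe_ofNormedAddCommGroup] at h0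
  have hlarge : ∀ᶠ N in atTop, N₀ ≤ N ∧ n ≤ N ∧ 1 ≤ N :=
    (eventually_ge_atTop N₀).and ((eventually_ge_atTop n).and (eventually_ge_atTop 1))
  -- Bound for the second moment, independent of `N`: by Cauchy–Schwarz and symmetry it is at most
  -- `‖ξ‖²` times `n R² / N = 2nε`.
  set S := ‖ξ‖ ^ 2 * (n * (2 * ε)) with hSdef
  set err : ℕ → ℝ := fun N => ((‖ξ‖ ^ 2 - ‖(W N).starProjection (firstVel N ξ)‖ ^ 2)
    + S / (2 * N * ε) + |(finrank ℝ (W N) - 1) / (2 * N * ε) - κ| * (1 + S)) * t with herr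
  have hest : ∀ᶠ N in atTop,
      |∫ v, Real.cos (1 * (inner ℝ ξ v - inner ℝ ξ (uniformVel n u)) + θ)
          ∂((M N).marginal n (F N t))
        - a * ∫ v, Real.cos (Real.exp (-κ * t) * (inner ℝ ξ v - inner ℝ ξ (uniformVel n u)) + θ)
          ∂((M N).marginal n (F N 0))| ≤ err N := by
    filter_upwards [hlarge] with N hN
    obtain ⟨hN0, hn, hN1⟩ := hN
    have hR : √(2 * N * ε) ^ 2 = 2 * N * ε := Real.sq_sqrt (by positivity)
    have hτ : ∀ x : Vel N, (inner ℝ (firstVel N ξ) x - inner ℝ (firstVel N ξ) (uniformVel N u) : ℝ)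
        = inner ℝ ξ (firstVel n x) - inner ℝ ξ (uniformVel n u) := fun x => by
      rw [inner_firstVel hn, inner_firstVel hn, firstVel_uniformVel hn]
    have hS : ∀ s, 0 ≤ s → ∫ x, (inner ℝ (firstVel N ξ) x
        - inner ℝ (firstVel N ξ) (uniformVel N u)) ^ 2 * F N s x ∂(M N).unif ≤ S := by
      intro s hs
      have hfc : Continuous (firstVel n : Vel N → Vel n) := continuous_firstVel
      have h1 := (hM N hN0).integral_norm_sq_firstVel (hperm N hN0) rfl (hF N hN0) hn hN1 hs
      have hNpos : (0 : ℝ) < N := by exact_mod_cast hN1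
      rw [hR, show 2 * (N : ℝ) * ε / N = 2 * ε by field_simp] at h1
      rw [hSdef, ← h1, ← integral_const_mul]
      refine (le_abs_self _).trans (((hM N hN0).abs_integral_mul_ensemble_le (hF N hN0)
        (G := fun x => ‖ξ‖ ^ 2 * ‖firstVel n x - uniformVel n u‖ ^ 2) (by fun_prop) hs
        fun x _ => ?_).trans (le_of_eq ?_))
      · rw [hτ, ← inner_sub_right, abs_of_nonneg (sq_nonneg _), ← mul_pow, ← sq_abs]
        exact pow_le_pow_left₀ (abs_nonneg _) (abs_real_inner_le_norm _ _) 2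
      · simp only [mul_assoc]
    have := (hM N hN0).abs_integral_cos_sub_le (hF N hN0) (firstVel N ξ) θ hκ ht hS
    rw [norm_firstVel hn, hR] at this
    simp only [hτ] at this
    rw [(hF N hN0).integral_marginal ht (hcont 1), (hF N hN0).integral_marginal le_rfl (hcont _)]
    simpa only [one_mul] using this
  have herr0 : Tendsto err atTop (𝓝 0) := by
    have hinv : Tendsto (fun N : ℕ => ((N : ℝ))⁻¹) atTop (𝓝 0) :=
      tendsto_inv_atTop_zero.comp tendsto_natCast_atTop_atTop
    have h1 : Tendsto (fun N => ‖ξ‖ ^ 2 - ‖(W N).starProjection (firstVel N ξ)‖ ^ 2) atTop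
        (𝓝 (‖ξ‖ ^ 2 - ‖ξ‖ ^ 2)) := tendsto_const_nhds.sub (hproj n ξ)
    have h2 : Tendsto (fun N : ℕ => S / (2 * ε) * (N : ℝ)⁻¹) atTop (𝓝 (S / (2 * ε) * 0)) :=
      hinv.const_mul _
    -- The drift rate on the sphere, `(dim W - 1) / R²`, tends to `3 / (2ε) = κ`, so this defect
    -- disappears as well.
    have h3 : Tendsto (fun N : ℕ => |((finrank ℝ (W N) : ℝ) / N - (N : ℝ)⁻¹) / (2 * ε) - κ|
        * (1 + S)) atTop (𝓝 (|(3 - 0) / (2 * ε) - κ| * (1 + S))) :=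
      ((((hdim.sub hinv).div_const _).sub_const κ).abs).mul_const _
    have h4 := ((h1.add h2).add h3).mul_const t
    simp only [sub_zero, sub_self, mul_zero, add_zero, hκdef, abs_zero, zero_mul] at h4
    refine h4.congr fun N => ?_
    rw [herr, hκdef]
    simp only
    congr 3
    · rw [← div_eq_mul_inv, div_div, mul_right_comm]
    · rw [inv_eq_one_div, ← sub_div (_ : ℝ) 1 (N : ℝ), div_div, show (N : ℝ) * (2 * ε) = 2 * N * ε by ring]
  have hdiff := squeeze_zero' (Eventually.of_forall fun N => abs_nonneg _) hest herr0
  simpa only [sub_add_cancel, zero_add]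
    using ((tendsto_zero_iff_abs_tendsto_zero _).2 hdiff).add h0

/-- The limit of the characteristic functions along the evolution coincides with the Fourier
transform of the Mehler evolved density, so Lévy's theorem identifies the weak limit. The remaining
claims concern that density alone. -/
theorem limitMarginalsRelax_of_isSphereLeaf (hε : 0 < ε)
    (hM : ∀ N, N₀ ≤ N → IsSphereLeaf (M N) (W N) (uniformVel N u) √(2 * N * ε))
    (hperm : ∀ N, N₀ ≤ N → ∀ π x, permute π x ∈ (M N).carrier ↔ x ∈ (M N).carrier)
    (hdim : Tendsto (fun N => (finrank ℝ (W N) : ℝ) / N) atTop (𝓝 3))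
    (hproj : ∀ (n : ℕ) (ξ : Vel n),
      Tendsto (fun N => ‖(W N).starProjection (firstVel N ξ)‖ ^ 2) atTop (𝓝 (‖ξ‖ ^ 2))) :
    LimitMarginalsRelax M N₀ u ε := by
  intro F hF n f₀ hf₀ hL hconv
  have hprob : ∀ t, 0 ≤ t → ∀ᶠ N in atTop, IsProbabilityMeasure ((M N).marginal n (F N t)) := by
    intro t ht
    filter_upwards [eventually_ge_atTop N₀] with N hN
    exact (hM N hN).isProbabilityMeasure_marginal (hF N hN) n ht
  have hν := hconv.isProbabilityMeasure (hprob 0 le_rfl)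
  have hmass : ∫ v, f₀ v = 1 := by
    have hmeas : AEStronglyMeasurable f₀ volume := by
      have h1 := (continuous_maxwellian (n := n) (u := u) (ε := ε)).aestronglyMeasurable.mul
        (hL.1.mono_ac (volume_absolutelyContinuous_maxwellMeasure hε))
      refine h1.congr (ae_of_all _ fun v => ?_)
      exact mul_div_cancel₀ _ (maxwellian_pos hε v).ne'
    rw [integral_eq_lintegral_of_nonneg_ae (ae_of_all _ hf₀) hmeas,
      ← setLIntegral_univ, ← withDensity_apply _ MeasurableSet.univ, measure_univ,
      ENNReal.toReal_one]
  obtain ⟨f, c, h0, hc, hf⟩ := exists_relaxed_density hε hf₀ hL hmass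
  refine ⟨f, c, h0, hc, fun t ht => ?_⟩
  obtain ⟨h1, h2, h3, h4, h5, h6, h7, h8⟩ := hf t ht
  refine ⟨h1, h2, h3, h4, ?_, h6, h7, h8⟩
  refine tendstoDensity_of_tendsto_charFun (hprob t ht)
    (isProbabilityMeasure_withDensity_ofReal h2 (ae_of_all _ h1) h3) fun ξ => ?_
  -- The phases `0` and `-π/2` turn the cosine into the real and imaginary parts of the centred
  -- characteristic function.
  have hlim := fun θ => (Complex.continuous_ofReal.tendsto _).comp
    (tendsto_integral_cos_marginal hε hM hperm hdim hproj hF hconv ht ξ θ)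
  have hlim2 := ((hlim 0).add ((hlim (-(Real.pi / 2))).mul_const Complex.I)).const_mul
    (Complex.exp ((1 * inner ℝ (uniformVel n u) ξ : ℝ) * Complex.I))
  have hval : charFun (volume.withDensity fun v => ENNReal.ofReal (f t v)) ξ
      = Complex.exp ((1 * inner ℝ (uniformVel n u) ξ : ℝ) * Complex.I)
        * (((Real.exp (-(‖ξ‖ ^ 2 * (1 - Real.exp (-(3 / (2 * ε)) * t) ^ 2)
            / (2 * (3 / (2 * ε)))))
          * ∫ v, Real.cos (Real.exp (-(3 / (2 * ε)) * t)
            * (inner ℝ ξ v - inner ℝ ξ (uniformVel n u)) + 0)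
          ∂(volume.withDensity fun v => ENNReal.ofReal (f₀ v)) : ℝ) : ℂ)
        + ((Real.exp (-(‖ξ‖ ^ 2 * (1 - Real.exp (-(3 / (2 * ε)) * t) ^ 2)
            / (2 * (3 / (2 * ε)))))
          * ∫ v, Real.cos (Real.exp (-(3 / (2 * ε)) * t)
            * (inner ℝ ξ v - inner ℝ ξ (uniformVel n u)) + -(Real.pi / 2))
          ∂(volume.withDensity fun v => ENNReal.ofReal (f₀ v)) : ℝ) : ℂ) * Complex.I) := by
    have e1 : Complex.exp ((1 * inner ℝ (uniformVel n u) ξ : ℝ) * Complex.I)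
        = Complex.exp (((1 - Real.exp (-(3 / (2 * ε)) * t)) * inner ℝ (uniformVel n u) ξ : ℝ)
            * Complex.I)
          * Complex.exp ((Real.exp (-(3 / (2 * ε)) * t) * inner ℝ (uniformVel n u) ξ : ℝ)
            * Complex.I) := by
      rw [← Complex.exp_add]
      congr 1
      push_cast
      ring
    -- The Gaussian factors agree because the thermal variance `2ε/3` is the reciprocal of the drift
    -- rate `3/(2ε)`.
    have e2 : Complex.exp (-((1 - Real.exp (-(3 / (2 * ε)) * t) ^ 2)
          * (thermalSpeed ε * ‖ξ‖) ^ 2 / 2 : ℝ))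
        = (Real.exp (-(‖ξ‖ ^ 2 * (1 - Real.exp (-(3 / (2 * ε)) * t) ^ 2)
            / (2 * (3 / (2 * ε))))) : ℝ) := by
      rw [Complex.ofReal_exp, mul_pow, thermalSpeed_sq hε, ← Complex.ofReal_neg]
      congr 3
      field_simp
    rw [h5, charFun_eq_integral_cos _ ξ (uniformVel n u), e1, e2]
    simp only [Complex.ofReal_mul]
    ring
  rw [hval]
  refine hlim2.congr' ?_
  filter_upwards [hprob t ht] with N hN
  rw [← one_smul ℝ ξ, charFun_eq_integral_cos _ ξ (uniformVel n u), one_smul]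
  rfl

theorem limitMarginalsRelax_energyLeaf (hε : 0 < ε) :
    LimitMarginalsRelax (fun N => energyLeaf N ε) 1 0 ε := by
  refine limitMarginalsRelax_of_isSphereLeaf (W := fun _ => ⊤) hε (fun N hN => ?_)
    (fun N _ π x => ?_) ?_ fun n ξ => ?_
  · have : uniformVel N 0 = 0 := by
      ext p
      simp [uniformVel]
    rw [this]
    exact energyLeaf_isSphereLeaf hN hε
  · change energy (permute π x) = N * ε ↔ energy x = N * ε
    rw [energy_permute]
  · refine tendsto_const_nhds.congr' ?_
    filter_upwards [eventually_ge_atTop 1] with N hN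
    have : (0 : ℝ) < N := by exact_mod_cast hN
    simp
    field_simp
  · refine tendsto_const_nhds.congr' ?_
    filter_upwards [eventually_ge_atTop n] with N hN
    rw [Submodule.starProjection_top, ContinuousLinearMap.id_apply, norm_firstVel hN]

lemma momentum_firstVel {n N : ℕ} (hn : n ≤ N) (ξ : Vel n) :
    momentum (firstVel N ξ) = momentum ξ := by
  have ht : ∀ a, firstVel n (translation N a) = translation n a := fun a => by
    ext ⟨k, b⟩
    rw [firstVel_castLE hn]
    rfl
  ext a
  rw [← inner_translation, real_inner_comm, inner_firstVel hn, ht, real_inner_comm,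
    inner_translation]

theorem limitMarginalsRelax_energyMomentumLeaf (u : EuclideanSpace ℝ (Fin 3)) {ε ε₀ : ℝ}
    (hε : ‖u‖ ^ 2 / 2 < ε) (hε₀ : ε₀ = ε - ‖u‖ ^ 2 / 2) :
    LimitMarginalsRelax (fun N => energyMomentumLeaf N u ε) 2 u ε₀ := by
  have hinv : Tendsto (fun N : ℕ => ((N : ℝ))⁻¹) atTop (𝓝 0) :=
    tendsto_inv_atTop_zero.comp tendsto_natCast_atTop_atTop
  refine limitMarginalsRelax_of_isSphereLeaf (W := momentumZero) (by linarith)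
    (fun N hN => energyMomentumLeaf_isSphereLeaf hN u hε hε₀) (fun N _ π x => ?_) ?_ fun n ξ => ?_
  · change momentum (permute π x) = (N : ℝ) • u ∧ energy (permute π x) = N * ε
      ↔ momentum x = (N : ℝ) • u ∧ energy x = N * ε
    rw [energy_permute, momentum_permute]
  · have h1 : Tendsto (fun N : ℕ => 3 - 3 * (N : ℝ)⁻¹) atTop (𝓝 (3 - 3 * 0)) :=
      (hinv.const_mul 3).const_sub 3
    rw [mul_zero, sub_zero] at h1
    refine h1.congr' ?_
    filter_upwards [eventually_ge_atTop 1] with N hN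
    have : (0 : ℝ) < N := by exact_mod_cast hN
    rw [finrank_momentumZero hN, Nat.cast_sub (by omega)]
    push_cast
    field_simp
  · have h1 : Tendsto (fun N : ℕ => ‖ξ‖ ^ 2 - ‖momentum ξ‖ ^ 2 * (N : ℝ)⁻¹) atTop
        (𝓝 (‖ξ‖ ^ 2 - ‖momentum ξ‖ ^ 2 * 0)) := (hinv.const_mul _).const_sub _
    rw [mul_zero, sub_zero] at h1
    refine h1.congr' ?_
    filter_upwards [eventually_ge_atTop n, eventually_ge_atTop 1] with N hn hN
    have hNpos : (0 : ℝ) < N := by exact_mod_cast hN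
    -- The component of the padded `ξ` orthogonal to `momentumZero N` spreads its momentum evenly
    -- over the particles. Its squared norm is `‖momentum ξ‖² / N`, which tends to zero.
    have h2 := (sub_starProjection_eq_uniformVel_iff (u := (N : ℝ)⁻¹ • momentum ξ)
      (x := firstVel N ξ)).2 (by rw [momentum_firstVel hn, smul_inv_smul₀ hNpos.ne'])
    have h3 := Submodule.norm_sq_eq_add_norm_sq_starProjection (firstVel N ξ) (momentumZero N)
    rw [Submodule.starProjection_orthogonal_val, h2, norm_sq_uniformVel, norm_smul, mul_pow,
      norm_firstVel hn, norm_inv, Real.norm_eq_abs, abs_of_pos hNpos] at h3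
    rw [h3]
    field_simp
    ring

end Relaxation

end VelocitySphere

end

theorem mainTheorem5 :
    (∀ ε : ℝ, 0 < ε →
      VelocitySphere.SpectraConverge (fun N => VelocitySphere.energyLeaf N ε) 1
        (VelocitySphere.energyEigenvalue ε) ε ∧
      VelocitySphere.LimitMarginalsRelax (fun N => VelocitySphere.energyLeaf N ε) 1 0 ε) ∧
    (∀ (u : EuclideanSpace ℝ (Fin 3)) (ε ε₀ : ℝ), ‖u‖ ^ 2 / 2 < ε → ε₀ = ε - ‖u‖ ^ 2 / 2 →
      VelocitySphere.SpectraConverge (fun N => VelocitySphere.energyMomentumLeaf N u ε) 2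
        (VelocitySphere.energyMomentumEigenvalue ε₀) ε₀ ∧
      VelocitySphere.LimitMarginalsRelax (fun N => VelocitySphere.energyMomentumLeaf N u ε) 2
        u ε₀) :=
  ⟨fun _ hε => ⟨VelocitySphere.spectraConverge_energyLeaf hε,
      VelocitySphere.limitMarginalsRelax_energyLeaf hε⟩,
    fun u _ _ hε hε₀ => ⟨VelocitySphere.spectraConverge_energyMomentumLeaf u hε hε₀,
      VelocitySphere.limitMarginalsRelax_energyMomentumLeaf u hε hε₀⟩⟩
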